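/- Let $\Sigma$ be a finite ranked alphabet. A bottom-up tree automaton over $\Sigma$ has a finite set of states, a set of final states, and rules $f(q_1,\dots,q_k)\to q$ with $f\in\Sigma$ of rank $k\ge 0$; it recognizes a tree if the tree has a run whose root is labelled by a final state, and it is deterministic (a DBA) if no two of its rules have the same left-hand side (some left-hand sides may have no rule). A deterministic top-down tree automaton (DTA) has a finite set of states, exactly one initial state, and rules $q(f)\to f(q_1,\dots,q_k)$, no two of which have the same left-hand side $q(f)$; its language is that of the bottom-up automaton obtained by reading the rules from right to left and taking the initial state as the only final state. **Theorem.** It is decidable in quadratic time whether the language of a given DBA is recognized by a DTA. That is, there are a program of a random access machine and a constant $c$ such that for every finite ranked alphabet $\Sigma$ and every DBA $A$ over $\Sigma$, the program, given a description of $A$, halts within $c\cdot n^2$ steps, where $n$ is the size of the description, and answers whether there is a DTA that recognizes $L(A)$. Here the symbols and the states of $A$ are numbered $0,1,2,\dots$, and a description of $A$ is a sequence of natural numbers: the number of symbols, the number of states, the rank of each symbol, a bit for each state that tells whether it is final, the number of rules, and the rules $f(q_1,\dots,q_k)\to q$, each written as $f,q_1,\dots,q_k,q$, in an arbitrary order without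 repetitions. The size of a description is the total length of the binary representations of its numbers. The machine has read-only random access to the input sequence and unboundedly many memory cells for natural numbers, initially $0$; loading a constant, addition, truncated subtraction, indirect loading and storing, reading an input number, and testing a cell for being nonzero each cost one step. -/

import Mathlib

namespace TreeAut

/-! ### Ranked trees and tree automata

A ranked alphabet is a type `S` of symbols with a rank function `ar : S → ℕ`. -/

/-- Trees over the ranked alphabet `(S, ar)`. -/
inductive RTree {S : Type} (ar : S → ℕ) : Type
  | node (f : S) (children : Fin (ar f) → RTree ar) : RTree ar

/-- The data `f`, `(q₁, …, q_k)`, `q` of a transition rule, where `k` is the rank of `f`.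
A bottom-up automaton uses it as `f(q₁, …, q_k) → q`,
a top-down automaton as `q(f) → f(q₁, …, q_k)`. -/
structure Rule {S : Type} (ar : S → ℕ) (Q : Type) : Type where
  sym : S
  args : Fin (ar sym) → Q
  state : Q

/-- Bottom-up tree automata: final states and rules `f(q₁, …, q_k) → q`. -/
structure BottomUp {S : Type} (ar : S → ℕ) (Q : Type) : Type where
  final : Set Q
  rules : Set (Rule ar Q)

namespace BottomUp

variable {S : Type} {ar : S → ℕ} {Q : Type}

/-- No two rules with the same left-hand side `f(q₁, …, q_k)`. -/
def IsDeterministic (A : BottomUp ar Q) : Prop :=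
  ∀ (f : S) (qs : Fin (ar f) → Q) (q q' : Q),
    (⟨f, qs, q⟩ : Rule ar Q) ∈ A.rules → (⟨f, qs, q'⟩ : Rule ar Q) ∈ A.rules → q = q'

/-- `A.HasRun t q`: there is a run of `A` on `t` that labels the root of `t` with `q`. -/
inductive HasRun (A : BottomUp ar Q) : RTree ar → Q → Prop
  | node (f : S) (ts : Fin (ar f) → RTree ar) (qs : Fin (ar f) → Q) (q : Q)
      (hrule : (⟨f, qs, q⟩ : Rule ar Q) ∈ A.rules) (hruns : ∀ i, HasRun A (ts i) (qs i)) :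
      HasRun A (RTree.node f ts) q

/-- The set of trees that have a run ending in a final state at the root. -/
def language (A : BottomUp ar Q) : Set (RTree ar) :=
  {t | ∃ q ∈ A.final, A.HasRun t q}

end BottomUp

/-- Top-down tree automata: initial states and rules `q(f) → f(q₁, …, q_k)`. -/
structure TopDown {S : Type} (ar : S → ℕ) (Q : Type) : Type where
  init : Set Q
  rules : Set (Rule ar Q)

namespace TopDown

variable {S : Type} {ar : S → ℕ} {Q : Type}

/-- Exactly one initial state, and no two rules with the same left-hand side `q(f)`. -/
def IsDeterministic (B : TopDown ar Q) : Prop :=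
  (∃ q₀, B.init = {q₀}) ∧
    ∀ (f : S) (q : Q) (qs qs' : Fin (ar f) → Q),
      (⟨f, qs, q⟩ : Rule ar Q) ∈ B.rules → (⟨f, qs', q⟩ : Rule ar Q) ∈ B.rules → qs = qs'

/-- The corresponding bottom-up automaton: all rules are read in the opposite direction, and the
initial states become the final ones. -/
def toBottomUp (B : TopDown ar Q) : BottomUp ar Q where
  final := B.init
  rules := B.rules

/-- The language of a top-down automaton. -/
def language (B : TopDown ar Q) : Set (RTree ar) :=
  B.toBottomUp.language

end TopDown

/-- `L` is recognized by a (finite) deterministic top-down tree automaton. -/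
def IsTopDownDeterministic {S : Type} {ar : S → ℕ} (L : Set (RTree ar)) : Prop :=
  ∃ (Q : Type) (_ : Finite Q) (B : TopDown ar Q), B.IsDeterministic ∧ B.language = L

/-! ### Descriptions of automata as sequences of natural numbers

Symbols are numbered `0, …, s - 1` and states `0, …, m - 1`. -/

/-- A rule `f(q₁, …, q_k) → q` is written as `f, q₁, …, q_k, q`. -/
def Rule.encode {s m : ℕ} {ar : Fin s → ℕ} (r : Rule ar (Fin m)) : List ℕ :=
  (r.sym : ℕ) :: (List.ofFn (fun i => (r.args i : ℕ)) ++ [(r.state : ℕ)])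

open Classical in
/-- The sequence `I` describes the automaton `A`. It consists of the number of symbols, the number
of states, the ranks of the symbols, a bit for each state that tells whether it is final, the
number of rules, and the rules, which are listed in some order without repetitions. -/
def BottomUp.IsDescription {s m : ℕ} {ar : Fin s → ℕ} (A : BottomUp ar (Fin m))
    (I : List ℕ) : Prop :=
  ∃ rs : List (Rule ar (Fin m)), rs.Nodup ∧ (∀ r, r ∈ rs ↔ r ∈ A.rules) ∧
    I = [s, m] ++ List.ofFn ar ++ List.ofFn (fun q : Fin m => if q ∈ A.final then 1 else 0) ++
      [rs.length] ++ rs.flatMap Rule.encode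

/-- The length of the binary representation of `x` (the number `0` has length `1`). -/
def binLength (x : ℕ) : ℕ := max 1 (Nat.size x)

/-- The size of an input: the total length of the binary representations of its numbers. -/
def inputSize (I : List ℕ) : ℕ := (I.map binLength).sum

/-! ### Random access machines with unit cost

The machine has a read-only input `I` and memory cells `M[0], M[1], …` that hold natural numbers.
Its programs are written in structured form (with `if` and `while` in place of jumps). The only
arithmetic operations are addition and truncated subtraction. -/

/-- Elementary instructions; `d`, `a`, `b` and `n` are fixed numbers in the program. -/
inductive Instr : Type
  /-- `M[d] := n` -/
  | const (d n : ℕ) : Instr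
  /-- `M[d] := M[a] + M[b]` -/
  | add (d a b : ℕ) : Instr
  /-- `M[d] := M[a] - M[b]`, and `0` if `M[a] < M[b]` -/
  | sub (d a b : ℕ) : Instr
  /-- `M[d] := M[M[a]]` -/
  | load (d a : ℕ) : Instr
  /-- `M[M[d]] := M[a]` -/
  | store (d a : ℕ) : Instr
  /-- `M[d]` becomes the number at position `M[a]` of the input (counted from `0`), and `0` beyond
  the end of the input -/
  | read (d a : ℕ) : Instr

/-- The effect of an elementary instruction on the memory, for the input `I`. -/
def Instr.apply (I : List ℕ) (M : ℕ → ℕ) : Instr → (ℕ → ℕ)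
  | .const d n => Function.update M d n
  | .add d a b => Function.update M d (M a + M b)
  | .sub d a b => Function.update M d (M a - M b)
  | .load d a => Function.update M d (M (M a))
  | .store d a => Function.update M (M d) (M a)
  | .read d a => Function.update M d (I.getD (M a) 0)

/-- Programs. The tests of `ite` and `loop` ask whether `M[a] ≠ 0`. -/
inductive Prog : Type
  | skip : Prog
  | instr (i : Instr) : Prog
  | seq (p q : Prog) : Prog
  /-- if `M[a] ≠ 0` then `p` else `q` -/
  | ite (a : ℕ) (p q : Prog) : Prog
  /-- while `M[a] ≠ 0` do `p` -/
  | loop (a : ℕ) (p : Prog) : Prog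

/-- `p.Exec I M M' t`: on input `I`, started with memory `M`, the program `p` halts after exactly
`t` steps with memory `M'`. Every elementary instruction and every test takes one step. -/
inductive Prog.Exec (I : List ℕ) : Prog → (ℕ → ℕ) → (ℕ → ℕ) → ℕ → Prop
  | skip (M : ℕ → ℕ) : Exec I .skip M M 1
  | instr (i : Instr) (M : ℕ → ℕ) : Exec I (.instr i) M (i.apply I M) 1
  | seq {p q : Prog} {M M' M'' : ℕ → ℕ} {t t' : ℕ} (hp : Exec I p M M' t)
      (hq : Exec I q M' M'' t') : Exec I (.seq p q) M M'' (t + t')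
  | ite_true {a : ℕ} {p q : Prog} {M M' : ℕ → ℕ} {t : ℕ} (ha : M a ≠ 0)
      (hp : Exec I p M M' t) : Exec I (.ite a p q) M M' (t + 1)
  | ite_false {a : ℕ} {p q : Prog} {M M' : ℕ → ℕ} {t : ℕ} (ha : M a = 0)
      (hq : Exec I q M M' t) : Exec I (.ite a p q) M M' (t + 1)
  | loop_stop {a : ℕ} {p : Prog} {M : ℕ → ℕ} (ha : M a = 0) : Exec I (.loop a p) M M 1
  | loop_step {a : ℕ} {p : Prog} {M M' M'' : ℕ → ℕ} {t t' : ℕ} (ha : M a ≠ 0)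
      (hp : Exec I p M M' t) (hl : Exec I (.loop a p) M' M'' t') :
      Exec I (.loop a p) M M'' (t + t' + 1)

/-- Started on input `I` with all memory cells `0`, the program `p` halts after at most `T` steps,
with `1` in the cell `M[0]` if `φ` holds, and with `0` there otherwise. -/
def Prog.DecidesWithin (p : Prog) (I : List ℕ) (T : ℕ) (φ : Prop) : Prop :=
  ∃ (M : ℕ → ℕ) (t : ℕ), p.Exec I (fun _ => 0) M t ∧ t ≤ T ∧
    (φ → M 0 = 1) ∧ (¬ φ → M 0 = 0)

end TreeAut

set_option linter.constructorNameAsVariable false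
set_option linter.unusedSimpArgs false

namespace TreeAut

/-! ### A structured language with variables and arrays -/

/-! Call a set of accessible states good if it consists of all accessible states that some fixed
context takes to a final state. When a DTA recognizes the language, walking down a context leaves it
no choice, so all trees that complete the context to an accepted tree get the same state at the
hole, and children of two such trees with the same root symbol can be interchanged. This is the
property `BottomUp.Exchange`: for rules with the same symbol and results in a common good set, one
argument may be replaced by the corresponding argument of the other rule. Conversely, under this
property the subset construction on the reversed automaton only meets good sets, and treating the
children independently adds no tree. Hence `BottomUp.isTopDownDeterministic_iff_exchange`.

There can be exponentially many good sets, so the property is rephrased for pairs of states. A pair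
is live if some good set contains both components, and two pairs are equivalent if the same good
sets contain them. For two rules with the same symbol and a live pair of targets, interchanging the
i-th arguments must give a live pair that is equivalent to the pair of targets
(`Inst.Exchange.equiv`). Conversely, it is enough that these equations lie in a relation between
live pairs that respects finality and is compatible with the transitions (`Inst.Exchange.of_bisim`).
Such a relation is found by congruence closure, in the manner of the Hopcroft–Karp equivalence test:
an equation between two classes is checked locally, the classes are merged, and the equations
between successors are queued (`Inst.Exchange.of_closure`). The local check compares finality and
the numbers of letters that lead to live pairs; with equal numbers, one inclusion between these sets
of letters implies the other (`Inst.Half.symm`).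

For the time bound, let n be the size of the input. There are fewer than n argument positions and at
most n states, hence at most n² transitions between pairs. Each is looked up in constant time,
because the left-hand side of a rule is coded as one number that serves as a memory address
(`Inst.code_eq_iff`). A merge costs the out-degree of a pair plus the size of the smaller class.
Out-degrees are constant on classes, so the first part is paid by the label that disappears, in
total O(n²) (`theta_merge`, `sum_deg_le`). The second part sums to N log N for N live pairs
(`psi_merge`). This is again O(n²): with a accessible states N ≤ a², and the numbers of these states
all occur in the description, which forces a log a = O(n) (`lives_mul_log_le`).

The algorithm is written in a small language with variables, arrays and a clock. Its programs are
verified with weakest preconditions and compiled to the machine with a constant factor in the time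
(`Cm.Run.exec_compile`). -/

/-- Names of variables. -/
inductive Vr : Type
  | ok | s | m | R | B | L | p | pp | k | g | w | x | y | u | z | row | q | i | j | r | n
  | hd | tl | np | big | mb | a | b | d | e | pos
  deriving DecidableEq

/-- Names of arrays. -/
inductive Ar : Type
  | st | T | acc | val | D | kap | crow | tgt | PL | nd1 | nd2 | fst | snd | lab | mem | size
  | live | fin | LQ | badj | bcnt | fadj | fcnt | QU | QV
  deriving DecidableEq

/-- States: values of variables and arrays, and a clock. -/
structure St : Type where
  v : Vr → ℕ
  a : Ar → ℕ → ℕ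
  t : ℕ

/-- Expressions. -/
inductive Ex : Type
  | c (n : ℕ) : Ex
  | v (x : Vr) : Ex
  | a (b : Ar) (e : Ex) : Ex
  | rd (e : Ex) : Ex
  | add (e f : Ex) : Ex
  | sub (e f : Ex) : Ex

instance : Add Ex := ⟨Ex.add⟩
instance : Sub Ex := ⟨Ex.sub⟩

/-- Commands. -/
inductive Cm : Type
  | skip : Cm
  | set (x : Vr) (e : Ex) : Cm
  | put (b : Ar) (i e : Ex) : Cm
  | seq (p q : Cm) : Cm
  | ite (e : Ex) (p q : Cm) : Cm
  | loop (e : Ex) (p : Cm) : Cm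

infixr:30 " ;; " => Cm.seq
infix:40 " ::= " => Cm.set

/-- `for x = 0, …, n - 1 do p`. -/
def Cm.for (x n : Vr) (p : Cm) : Cm :=
  x ::= .c 0 ;; .loop (.v n - .v x) (p ;; x ::= .v x + .c 1)

/-- The number at position `x` of the input. -/
def inp (I : List ℕ) (x : ℕ) : ℕ := I.getD x 0

def Ex.eval (I : List ℕ) (σ : St) : Ex → ℕ
  | .c n => n
  | .v x => σ.v x
  | .a b e => σ.a b (e.eval I σ)
  | .rd e => inp I (e.eval I σ)
  | .add e f => e.eval I σ + f.eval I σ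
  | .sub e f => e.eval I σ - f.eval I σ

section eval
variable (I : List ℕ) (σ : St) (e f : Ex)
@[simp] theorem Ex.eval_c (n : ℕ) : (Ex.c n).eval I σ = n := rfl
@[simp] theorem Ex.eval_v (x : Vr) : (Ex.v x).eval I σ = σ.v x := rfl
@[simp] theorem Ex.eval_a (b : Ar) : (Ex.a b e).eval I σ = σ.a b (e.eval I σ) := rfl
@[simp] theorem Ex.eval_rd : (Ex.rd e).eval I σ = inp I (e.eval I σ) := rfl
@[simp] theorem Ex.eval_add : (e + f).eval I σ = e.eval I σ + f.eval I σ := rfl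
@[simp] theorem Ex.eval_sub : (e - f).eval I σ = e.eval I σ - f.eval I σ := rfl
end eval

/-- One more step on the clock. -/
def St.tick (σ : St) : St := ⟨σ.v, σ.a, σ.t + 1⟩
def St.setV (σ : St) (x : Vr) (n : ℕ) : St := ⟨Function.update σ.v x n, σ.a, σ.t + 1⟩
def St.setA (σ : St) (b : Ar) (i n : ℕ) : St :=
  ⟨σ.v, Function.update σ.a b (Function.update (σ.a b) i n), σ.t + 1⟩

section simps
variable (σ : St) (x y : Vr) (b c : Ar) (i j n : ℕ)
@[simp] theorem St.tick_v : σ.tick.v = σ.v := rfl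
@[simp] theorem St.tick_a : σ.tick.a = σ.a := rfl
@[simp] theorem St.tick_t : σ.tick.t = σ.t + 1 := rfl
@[simp] theorem St.setV_v : (σ.setV x n).v y = if y = x then n else σ.v y := by
  simp [St.setV, Function.update_apply]
@[simp] theorem St.setV_a : (σ.setV x n).a = σ.a := rfl
@[simp] theorem St.setV_t : (σ.setV x n).t = σ.t + 1 := rfl
@[simp] theorem St.setA_v : (σ.setA b i n).v = σ.v := rfl
@[simp] theorem St.setA_a :
    (σ.setA b i n).a c = if c = b then Function.update (σ.a b) i n else σ.a c := by
  simp only [St.setA, Function.update_apply]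
@[simp] theorem St.setA_t : (σ.setA b i n).t = σ.t + 1 := rfl
end simps

/-- Execution of commands; every elementary command and every test takes one tick. -/
inductive Cm.Run (I : List ℕ) : Cm → St → St → Prop
  | skip (σ : St) : Run I .skip σ σ.tick
  | set (x : Vr) (e : Ex) (σ : St) : Run I (.set x e) σ (σ.setV x (e.eval I σ))
  | put (b : Ar) (i e : Ex) (σ : St) : Run I (.put b i e) σ (σ.setA b (i.eval I σ) (e.eval I σ))
  | seq {p q : Cm} {σ σ' σ'' : St} : Run I p σ σ' → Run I q σ' σ'' → Run I (.seq p q) σ σ''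
  | ite_true {e : Ex} {p q : Cm} {σ σ' : St} : e.eval I σ ≠ 0 → Run I p σ.tick σ' →
      Run I (.ite e p q) σ σ'
  | ite_false {e : Ex} {p q : Cm} {σ σ' : St} : e.eval I σ = 0 → Run I q σ.tick σ' →
      Run I (.ite e p q) σ σ'
  | loop_end {e : Ex} {p : Cm} {σ : St} : e.eval I σ = 0 → Run I (.loop e p) σ σ.tick
  | loop_step {e : Ex} {p : Cm} {σ σ' σ'' : St} : e.eval I σ ≠ 0 → Run I p σ.tick σ' →
      Run I (.loop e p) σ' σ'' → Run I (.loop e p) σ σ''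

/-! ### Compilation -/

theorem Vr.ctorIdx_injective : Function.Injective Vr.ctorIdx := fun x y h => by
  have := congrArg Vr.ofNat h
  simpa only [Vr.ofNat_ctorIdx] using this

theorem Ar.ctorIdx_injective : Function.Injective Ar.ctorIdx := fun x y h => by
  have := congrArg Ar.ofNat h
  simpa only [Ar.ofNat_ctorIdx] using this

theorem Ar.ctorIdx_lt (b : Ar) : b.ctorIdx < 30 := by cases b <;> decide

/-- The memory is divided by residues modulo 32: residue 0 for the variables, residues 1 to 30 for
the arrays, residue 31 for temporary cells. Thus arrays are unbounded and never collide. The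
variable `ok` has index 0 and therefore occupies cell 0, where the answer is expected. -/
def varAddr (x : Vr) : ℕ := 32 * x.ctorIdx
def arrAddr (b : Ar) (i : ℕ) : ℕ := 32 * i + (1 + b.ctorIdx)
def tmpAddr (d : ℕ) : ℕ := 32 * d + 31

/-- The memory `M` represents the state `σ`. -/
def Rep (σ : St) (M : ℕ → ℕ) : Prop :=
  (∀ x, M (varAddr x) = σ.v x) ∧ ∀ b i, M (arrAddr b i) = σ.a b i

theorem varAddr_ne_tmp (x : Vr) (d : ℕ) : varAddr x ≠ tmpAddr d := by
  unfold varAddr tmpAddr; omega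
theorem arrAddr_ne_tmp (b : Ar) (i d : ℕ) : arrAddr b i ≠ tmpAddr d := by
  have := b.ctorIdx_lt; unfold arrAddr tmpAddr; omega
theorem arrAddr_ne_var (b : Ar) (i : ℕ) (x : Vr) : arrAddr b i ≠ varAddr x := by
  have := b.ctorIdx_lt; unfold arrAddr varAddr; omega
theorem varAddr_inj {x y : Vr} (h : varAddr x = varAddr y) : x = y :=
  Vr.ctorIdx_injective (by unfold varAddr at h; omega)
theorem arrAddr_inj {b c : Ar} {i j : ℕ} (h : arrAddr b i = arrAddr c j) : b = c ∧ i = j := by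
  have := b.ctorIdx_lt; have := c.ctorIdx_lt; unfold arrAddr at h
  exact ⟨Ar.ctorIdx_injective (by omega), by omega⟩
theorem tmpAddr_inj {d e : ℕ} : tmpAddr d = tmpAddr e ↔ d = e := by unfold tmpAddr; omega

theorem Rep.update_tmp {σ : St} {M : ℕ → ℕ} (h : Rep σ M) (d n : ℕ) :
    Rep σ (Function.update M (tmpAddr d) n) := by
  refine ⟨fun x => ?_, fun b i => ?_⟩
  · rw [Function.update_of_ne (varAddr_ne_tmp x d)]; exact h.1 x
  · rw [Function.update_of_ne (arrAddr_ne_tmp b i d)]; exact h.2 b i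

theorem Rep.update_var {σ : St} {M : ℕ → ℕ} (h : Rep σ M) (x : Vr) (n : ℕ) :
    Rep (σ.setV x n) (Function.update M (varAddr x) n) := by
  refine ⟨fun y => ?_, fun b i => ?_⟩
  · by_cases hy : y = x
    · subst hy; simp
    · rw [Function.update_of_ne fun e => hy (varAddr_inj e)]; simp [hy, h.1 y]
  · rw [Function.update_of_ne (arrAddr_ne_var b i x)]; simp [h.2 b i]

theorem Rep.update_arr {σ : St} {M : ℕ → ℕ} (h : Rep σ M) (b : Ar) (i n : ℕ) :
    Rep (σ.setA b i n) (Function.update M (arrAddr b i) n) := by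
  refine ⟨fun y => ?_, fun c j => ?_⟩
  · rw [Function.update_of_ne (arrAddr_ne_var b i y).symm]; simp [h.1 y]
  · by_cases hc : arrAddr c j = arrAddr b i
    · obtain ⟨rfl, rfl⟩ := arrAddr_inj hc; simp
    · rw [Function.update_of_ne hc, h.2 c j]
      by_cases hcb : c = b
      · subst hcb
        have : j ≠ i := fun e => hc (by rw [e])
        simp [Function.update_of_ne this]
      · simp [hcb]

theorem Rep.tick {σ : St} {M : ℕ → ℕ} (h : Rep σ M) : Rep σ.tick M := h

namespace Prog
/-- `M[d] := 32 * M[d] + n`, with `M[e]` as a temporary. -/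
def addr (d e n : ℕ) : Prog :=
  .seq (.instr (.add d d d)) <| .seq (.instr (.add d d d)) <| .seq (.instr (.add d d d)) <|
  .seq (.instr (.add d d d)) <| .seq (.instr (.add d d d)) <| .seq (.instr (.const e n)) <|
  .instr (.add d d e)

/-- `M[d] := M[a]`, with `M[e]` as a temporary. -/
def copy (d e a : ℕ) : Prog := .seq (.instr (.const e 0)) (.instr (.add d a e))
end Prog

/-- Five doublings replace the missing multiplication by 32. The last conjunct writes the new memory
as three updates at the two cells, so that `Rep.update_tmp` applies when these are temporaries. -/
theorem exec_addr (I : List ℕ) (M : ℕ → ℕ) {d e : ℕ} (h : d ≠ e) (n : ℕ) :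
    ∃ M', (Prog.addr d e n).Exec I M M' 7 ∧ M' d = 32 * M d + n ∧
      M' = Function.update (Function.update (Function.update M d (32 * M d)) e n) d (M' d) := by
  refine ⟨_, .seq (.instr _ _) (.seq (.instr _ _) (.seq (.instr _ _) (.seq (.instr _ _)
    (.seq (.instr _ _) (.seq (.instr _ _) (.instr _ _)))))), ?_, ?_⟩
  · simp [Instr.apply, h, h.symm]; ring
  · ext y; simp only [Instr.apply, Function.update_apply]
    split_ifs <;> simp_all

/-- Code that puts the value of an expression into the temporary cell number `d`. -/
def Ex.compile : Ex → ℕ → Prog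
  | .c n, d => .instr (.const (tmpAddr d) n)
  | .v x, d => .copy (tmpAddr d) (tmpAddr (d + 1)) (varAddr x)
  | .a b e, d => .seq (e.compile d) <| .seq (.addr (tmpAddr d) (tmpAddr (d + 1)) (1 + b.ctorIdx)) <|
      .instr (.load (tmpAddr d) (tmpAddr d))
  | .rd e, d => .seq (e.compile d) (.instr (.read (tmpAddr d) (tmpAddr d)))
  | .add e f, d => .seq (e.compile d) <| .seq (f.compile (d + 1)) <|
      .instr (.add (tmpAddr d) (tmpAddr d) (tmpAddr (d + 1)))
  | .sub e f, d => .seq (e.compile d) <| .seq (f.compile (d + 1)) <|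
      .instr (.sub (tmpAddr d) (tmpAddr d) (tmpAddr (d + 1)))

def Ex.cost : Ex → ℕ
  | .c _ => 1
  | .v _ => 2
  | .a _ e => e.cost + 8
  | .rd e => e.cost + 1
  | .add e f => e.cost + (f.cost + 1)
  | .sub e f => e.cost + (f.cost + 1)

/-- Evaluation into temporary cell `d` works with cells from `d` on. The clause about cells below
`d` protects a left operand while the right one is evaluated one level higher. -/
theorem Ex.exec_compile (I : List ℕ) (σ : St) (e : Ex) : ∀ (d : ℕ) (M : ℕ → ℕ), Rep σ M →
    ∃ M', (e.compile d).Exec I M M' e.cost ∧ Rep σ M' ∧ M' (tmpAddr d) = e.eval I σ ∧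
      ∀ d' < d, M' (tmpAddr d') = M (tmpAddr d') := by
  induction e with
  | c n =>
    intro d M h
    refine ⟨_, .instr _ _, h.update_tmp _ _, by simp [Instr.apply], fun d' hd => ?_⟩
    have : tmpAddr d' ≠ tmpAddr d := by rw [Ne, tmpAddr_inj]; omega
    simp [Instr.apply, this]
  | v x =>
    intro d M h
    refine ⟨_, .seq (.instr _ _) (.instr _ _), (h.update_tmp _ _).update_tmp _ _, ?_,
      fun d' hd => ?_⟩
    · simp [Instr.apply, (varAddr_ne_tmp x (d + 1)), h.1 x]
    · have h1 : tmpAddr d' ≠ tmpAddr d := by rw [Ne, tmpAddr_inj]; omega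
      have h2 : tmpAddr d' ≠ tmpAddr (d + 1) := by rw [Ne, tmpAddr_inj]; omega
      simp [Instr.apply, h1, h2]
  | a b e ih =>
    intro d M h
    obtain ⟨M₁, hx, hr, hv, hk⟩ := ih d M h
    have hne : tmpAddr d ≠ tmpAddr (d + 1) := by rw [Ne, tmpAddr_inj]; omega
    obtain ⟨M₂, hx2, hv2, he2⟩ := exec_addr I M₁ hne (1 + b.ctorIdx)
    have hr2 : Rep σ M₂ := by
      rw [he2]; exact ((hr.update_tmp _ _).update_tmp _ _).update_tmp _ _
    refine ⟨_, .seq hx (.seq hx2 (.instr _ _)), hr2.update_tmp _ _, ?_, fun d' hd => ?_⟩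
    · have : M₂ (tmpAddr d) = arrAddr b (e.eval I σ) := by rw [hv2, hv, arrAddr]
      simp [Instr.apply, this, hr2.2]
    · have h1 : tmpAddr d' ≠ tmpAddr d := by rw [Ne, tmpAddr_inj]; omega
      have h2 : tmpAddr d' ≠ tmpAddr (d + 1) := by rw [Ne, tmpAddr_inj]; omega
      simp only [Instr.apply, Function.update_of_ne h1]
      rw [he2]
      simp [h1, h2, hk d' hd]
  | rd e ih =>
    intro d M h
    obtain ⟨M₁, hx, hr, hv, hk⟩ := ih d M h
    refine ⟨_, .seq hx (.instr _ _), hr.update_tmp _ _, by simp [Instr.apply, hv, inp], fun d' hd => ?_⟩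
    have h1 : tmpAddr d' ≠ tmpAddr d := by rw [Ne, tmpAddr_inj]; omega
    simp [Instr.apply, h1, hk d' hd]
  | add e f ihe ihf =>
    intro d M h
    obtain ⟨M₁, hx, hr, hv, hk⟩ := ihe d M h
    obtain ⟨M₂, hx2, hr2, hv2, hk2⟩ := ihf (d + 1) M₁ hr
    refine ⟨_, .seq hx (.seq hx2 (.instr _ _)), hr2.update_tmp _ _, ?_, fun d' hd => ?_⟩
    · simp [Instr.apply, hv2, hk2 d (by omega), hv, Ex.eval]
    · have h1 : tmpAddr d' ≠ tmpAddr d := by rw [Ne, tmpAddr_inj]; omega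
      simp [Instr.apply, h1, hk d' hd, hk2 d' (by omega)]
  | sub e f ihe ihf =>
    intro d M h
    obtain ⟨M₁, hx, hr, hv, hk⟩ := ihe d M h
    obtain ⟨M₂, hx2, hr2, hv2, hk2⟩ := ihf (d + 1) M₁ hr
    refine ⟨_, .seq hx (.seq hx2 (.instr _ _)), hr2.update_tmp _ _, ?_, fun d' hd => ?_⟩
    · simp [Instr.apply, hv2, hk2 d (by omega), hv, Ex.eval]
    · have h1 : tmpAddr d' ≠ tmpAddr d := by rw [Ne, tmpAddr_inj]; omega
      simp [Instr.apply, h1, hk d' hd, hk2 d' (by omega)]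

/-- A machine loop tests a memory cell and not an expression, so the test of a loop is compiled
twice: before the loop and at the end of its body. -/
def Cm.compile : Cm → Prog
  | .skip => .skip
  | .set x e => .seq (e.compile 0) (.copy (varAddr x) (tmpAddr 1) (tmpAddr 0))
  | .put b i e => .seq (i.compile 0) <| .seq (.addr (tmpAddr 0) (tmpAddr 1) (1 + b.ctorIdx)) <|
      .seq (e.compile 1) (.instr (.store (tmpAddr 0) (tmpAddr 1)))
  | .seq p q => .seq p.compile q.compile
  | .ite e p q => .seq (e.compile 0) (.ite (tmpAddr 0) p.compile q.compile)
  | .loop e p => .seq (e.compile 0) (.loop (tmpAddr 0) (.seq p.compile (e.compile 0)))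

/-- A bound for the number of machine steps in one tick. -/
def Cm.cost : Cm → ℕ
  | .skip => 1
  | .set _ e => e.cost + 2
  | .put _ i e => i.cost + (7 + (e.cost + 1))
  | .seq p q => p.cost + q.cost
  | .ite e p q => e.cost + 1 + (p.cost + q.cost)
  | .loop e p => e.cost + 1 + p.cost

/-- Every tick is charged the same amount `K`, a bound for the cost of the program text. Each
elementary command or test costs at most that much, and the additive form of the inequality composes
along a run without subtraction. -/
theorem Cm.Run.exec_compile {I : List ℕ} {p : Cm} {σ σ' : St} (h : p.Run I σ σ') :
    ∀ (K : ℕ), p.cost ≤ K → ∀ M, Rep σ M →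
      ∃ M' t, p.compile.Exec I M M' t ∧ Rep σ' M' ∧ t + K * σ.t ≤ K * σ'.t := by
  induction h with
  | skip σ =>
    intro K hK M hM
    refine ⟨M, 1, .skip M, hM, ?_⟩
    simp only [St.tick_t, mul_add, Cm.cost] at *; omega
  | set x e σ =>
    intro K hK M hM
    obtain ⟨M₁, hx, hr, hv, -⟩ := e.exec_compile I σ 0 M hM
    refine ⟨_, _, .seq hx (.seq (.instr _ _) (.instr _ _)), ?_, ?_⟩
    · have := (hr.update_tmp 1 0).update_var x (e.eval I σ)
      convert this using 2
      have h1 : tmpAddr 0 ≠ tmpAddr 1 := by rw [Ne, tmpAddr_inj]; omega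
      simp [Instr.apply, h1, hv]
    · simp only [St.setV_t, mul_add, Cm.cost] at *; omega
  | put b i e σ =>
    intro K hK M hM
    obtain ⟨M₁, hx, hr, hv, -⟩ := i.exec_compile I σ 0 M hM
    have hne : tmpAddr 0 ≠ tmpAddr 1 := by rw [Ne, tmpAddr_inj]; omega
    obtain ⟨M₂, hx2, hv2, he2⟩ := exec_addr I M₁ hne (1 + b.ctorIdx)
    have hr2 : Rep σ M₂ := by
      rw [he2]; exact ((hr.update_tmp _ _).update_tmp _ _).update_tmp _ _
    obtain ⟨M₃, hx3, hr3, hv3, hk3⟩ := e.exec_compile I σ 1 M₂ hr2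
    refine ⟨_, _, .seq hx (.seq hx2 (.seq hx3 (.instr _ _))), ?_, ?_⟩
    · have := hr3.update_arr b (i.eval I σ) (e.eval I σ)
      convert this using 1
      simp only [Instr.apply]
      rw [hk3 0 (by omega), hv2, hv, hv3, arrAddr]
    · simp only [St.setA_t, mul_add, Cm.cost] at *; omega
  | seq _ _ ih1 ih2 =>
    intro K hK M hM
    simp only [Cm.cost] at hK
    obtain ⟨M₁, t₁, hx, hr, ht⟩ := ih1 K (by omega) M hM
    obtain ⟨M₂, t₂, hx2, hr2, ht2⟩ := ih2 K (by omega) M₁ hr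
    exact ⟨M₂, _, .seq hx hx2, hr2, by omega⟩
  | @ite_true e p q σ σ' hc _ ih =>
    intro K hK M hM
    simp only [Cm.cost] at hK
    obtain ⟨M₁, hx, hr, hv, -⟩ := e.exec_compile I σ 0 M hM
    obtain ⟨M₂, t₂, hx2, hr2, ht2⟩ := ih K (by omega) M₁ hr.tick
    refine ⟨M₂, _, .seq hx (.ite_true (by rwa [hv]) hx2), hr2, ?_⟩
    simp only [St.tick_t, mul_add] at ht2; omega
  | @ite_false e p q σ σ' hc _ ih =>
    intro K hK M hM
    simp only [Cm.cost] at hK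
    obtain ⟨M₁, hx, hr, hv, -⟩ := e.exec_compile I σ 0 M hM
    obtain ⟨M₂, t₂, hx2, hr2, ht2⟩ := ih K (by omega) M₁ hr.tick
    refine ⟨M₂, _, .seq hx (.ite_false (by rwa [hv]) hx2), hr2, ?_⟩
    simp only [St.tick_t, mul_add] at ht2; omega
  | @loop_end e p σ hc =>
    intro K hK M hM
    simp only [Cm.cost] at hK
    obtain ⟨M₁, hx, hr, hv, -⟩ := e.exec_compile I σ 0 M hM
    have hs : (Prog.loop (tmpAddr 0) (.seq p.compile (e.compile 0))).Exec I M₁ M₁ 1 := by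
      constructor; rwa [hv]
    refine ⟨M₁, _, .seq hx hs, hr.tick, ?_⟩
    simp only [St.tick_t, mul_add]; omega
  | @loop_step e p σ σ' σ'' hc _ _ ih1 ih2 =>
    intro K hK M hM
    have hK' := hK
    simp only [Cm.cost] at hK'
    obtain ⟨M₁, hx, hr, hv, -⟩ := e.exec_compile I σ 0 M hM
    obtain ⟨M₂, t₂, hx2, hr2, ht2⟩ := ih1 K (by omega) M₁ hr.tick
    obtain ⟨M₃, t₃, hx3, hr3, ht3⟩ := ih2 K hK M₂ hr2
    -- The run for the remaining iterations starts with an evaluation of the test. It is detached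
    -- and becomes the end of the body of the present iteration.
    obtain _ | _ | ⟨ha, hb⟩ := hx3
    refine ⟨M₃, _, .seq hx (.loop_step (by rwa [hv]) (.seq hx2 ha) hb), hr3, ?_⟩
    simp only [St.tick_t, mul_add] at ht2; omega

/-! ### Weakest preconditions and frames -/

/-- Variables that a command may modify. -/
def Cm.modV : Cm → Vr → Bool
  | .skip, _ => false
  | .set x _, y => decide (y = x)
  | .put _ _ _, _ => false
  | .seq p q, y => p.modV y || q.modV y
  | .ite _ p q, y => p.modV y || q.modV y
  | .loop _ p, y => p.modV y

/-- Arrays that a command may modify. -/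
def Cm.modA : Cm → Ar → Bool
  | .skip, _ => false
  | .set _ _, _ => false
  | .put b _ _, c => decide (c = b)
  | .seq p q, y => p.modA y || q.modA y
  | .ite _ p q, y => p.modA y || q.modA y
  | .loop _ p, y => p.modA y

/-- `σ` and `σ'` agree on everything that `p` does not modify. -/
structure Frame (p : Cm) (σ σ' : St) : Prop where
  v : ∀ x, p.modV x = false → σ'.v x = σ.v x
  a : ∀ b, p.modA b = false → σ'.a b = σ.a b

theorem Frame.refl (p : Cm) (σ : St) : Frame p σ σ := ⟨fun _ _ => rfl, fun _ _ => rfl⟩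

theorem Frame.trans {p : Cm} {σ σ' σ'' : St} (h : Frame p σ σ') (h' : Frame p σ' σ'') :
    Frame p σ σ'' :=
  ⟨fun x hx => (h'.v x hx).trans (h.v x hx), fun x hx => (h'.a x hx).trans (h.a x hx)⟩

theorem Frame.mono {p q : Cm} {σ σ' : St} (h : Frame p σ σ')
    (hv : ∀ x, q.modV x = false → p.modV x = false)
    (ha : ∀ x, q.modA x = false → p.modA x = false) : Frame q σ σ' :=
  ⟨fun x hx => h.v x (hv x hx), fun x hx => h.a x (ha x hx)⟩

theorem Frame.tick {p : Cm} {σ σ' : St} (h : Frame p σ σ') : Frame p σ σ'.tick := ⟨h.v, h.a⟩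
theorem Frame.of_tick {p : Cm} {σ σ' : St} (h : Frame p σ.tick σ') : Frame p σ σ' := ⟨h.v, h.a⟩

theorem Cm.Run.frame {I : List ℕ} {p : Cm} {σ σ' : St} (h : p.Run I σ σ') : Frame p σ σ' := by
  induction h with
  | skip σ => exact (Frame.refl _ _).tick
  | set x e σ =>
    refine ⟨fun y hy => ?_, fun b _ => rfl⟩
    simp only [Cm.modV, decide_eq_false_iff_not] at hy
    simp [hy]
  | put b i e σ =>
    refine ⟨fun y _ => rfl, fun c hc => ?_⟩
    simp only [Cm.modA, decide_eq_false_iff_not] at hc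
    simp [hc]
  | seq _ _ h1 h2 =>
    refine (h1.mono ?_ ?_).trans (h2.mono ?_ ?_) <;> simp +contextual [Cm.modV, Cm.modA]
  | ite_true _ _ h => refine h.of_tick.mono ?_ ?_ <;> simp +contextual [Cm.modV, Cm.modA]
  | ite_false _ _ h => refine h.of_tick.mono ?_ ?_ <;> simp +contextual [Cm.modV, Cm.modA]
  | loop_end _ => exact (Frame.refl _ _).tick
  | loop_step _ _ _ h1 h2 =>
    refine (h1.of_tick.mono ?_ ?_).trans h2 <;> simp [Cm.modV, Cm.modA]

/-- `p` halts from `σ` in a state that satisfies `Q`. -/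
def wp (I : List ℕ) (p : Cm) (Q : St → Prop) (σ : St) : Prop := ∃ σ', p.Run I σ σ' ∧ Q σ'

section wp
variable {I : List ℕ} {p q : Cm} {Q Q' : St → Prop} {σ : St} {e : Ex}

/-- Strengthening the postcondition by the frame. -/
theorem wp.mono (h : wp I p Q σ) (hQ : ∀ σ', Frame p σ σ' → Q σ' → Q' σ') : wp I p Q' σ :=
  let ⟨σ', hr, h'⟩ := h; ⟨σ', hr, hQ σ' hr.frame h'⟩

@[simp] theorem wp_skip : wp I .skip Q σ ↔ Q σ.tick :=
  ⟨fun ⟨_, h, hQ⟩ => by cases h; exact hQ, fun h => ⟨_, .skip _, h⟩⟩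

@[simp] theorem wp_set {x : Vr} : wp I (x ::= e) Q σ ↔ Q (σ.setV x (e.eval I σ)) :=
  ⟨fun ⟨_, h, hQ⟩ => by cases h; exact hQ, fun h => ⟨_, .set _ _ _, h⟩⟩

@[simp] theorem wp_put {b : Ar} {i : Ex} :
    wp I (.put b i e) Q σ ↔ Q (σ.setA b (i.eval I σ) (e.eval I σ)) :=
  ⟨fun ⟨_, h, hQ⟩ => by cases h; exact hQ, fun h => ⟨_, .put _ _ _ _, h⟩⟩

@[simp] theorem wp_seq : wp I (p ;; q) Q σ ↔ wp I p (wp I q Q) σ :=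
  ⟨fun ⟨_, h, hQ⟩ => by cases h with | seq h1 h2 => exact ⟨_, h1, _, h2, hQ⟩,
    fun ⟨_, h1, _, h2, hQ⟩ => ⟨_, .seq h1 h2, hQ⟩⟩

theorem wp_ite : wp I (.ite e p q) Q σ ↔
    (e.eval I σ ≠ 0 → wp I p Q σ.tick) ∧ (e.eval I σ = 0 → wp I q Q σ.tick) := by
  constructor
  · rintro ⟨_, h, hQ⟩
    cases h with
    | ite_true hc h => exact ⟨fun _ => ⟨_, h, hQ⟩, fun h => absurd h hc⟩
    | ite_false hc h => exact ⟨fun h => absurd hc h, fun _ => ⟨_, h, hQ⟩⟩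
  · rintro ⟨h1, h2⟩
    by_cases hc : e.eval I σ = 0
    · obtain ⟨_, h, hQ⟩ := h2 hc; exact ⟨_, .ite_false hc h, hQ⟩
    · obtain ⟨_, h, hQ⟩ := h1 hc; exact ⟨_, .ite_true hc h, hQ⟩

/-- Since `wp` includes termination, the invariant carries a natural number that decreases. The
frame premise gives each iteration all facts about what the loop leaves alone, so that invariants
need not repeat them. -/
theorem wp_loop (Inv : ℕ → St → Prop) (n : ℕ) (h0 : Inv n σ)
    (hstep : ∀ n σ', Frame (.loop e p) σ σ' → Inv n σ' → e.eval I σ' ≠ 0 →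
      wp I p (fun σ'' => ∃ n' < n, Inv n' σ'') σ'.tick)
    (hend : ∀ n σ', Frame (.loop e p) σ σ' → Inv n σ' → e.eval I σ' = 0 → Q σ'.tick) :
    wp I (.loop e p) Q σ := by
  suffices H : ∀ n σ', Frame (.loop e p) σ σ' → Inv n σ' → wp I (.loop e p) Q σ' from
    H n σ (Frame.refl _ _) h0
  intro n
  induction n using Nat.strong_induction_on with
  | _ n ih =>
    intro σ' hf hi
    by_cases hc : e.eval I σ' = 0
    · exact ⟨_, .loop_end hc, hend n σ' hf hi hc⟩
    · obtain ⟨σ₁, hr, n', hn, hi'⟩ := hstep n σ' hf hi hc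
      obtain ⟨σ₂, hr2, hQ⟩ := ih n' hn σ₁ (hf.trans (hr.frame.of_tick.mono (fun _ h => h)
        fun _ h => h)) hi'
      exact ⟨σ₂, .loop_step hc hr hr2, hQ⟩

/-- The number of remaining rounds is the measure, so only an invariant indexed by the counter has
to be supplied. The premise about the counter inside the postcondition of `hstep` comes for free, as
the body does not modify it. -/
theorem wp_for {x n : Vr} (Inv : ℕ → St → Prop) (hn : (Cm.for x n p).modV n = false)
    (hx : p.modV x = false) (h0 : Inv 0 (σ.setV x 0))
    (hstep : ∀ i σ', i < σ.v n → Frame (.for x n p) σ σ' → σ'.v x = i → Inv i σ' →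
      wp I p (fun σ'' => σ''.v x = i → Inv (i + 1) (σ''.setV x (i + 1))) σ'.tick)
    (hend : ∀ σ', Frame (.for x n p) σ σ' → σ'.v x = σ.v n → Inv (σ.v n) σ' → Q σ'.tick) :
    wp I (.for x n p) Q σ := by
  have hnx : n ≠ x := by rintro rfl; simp [Cm.for, Cm.modV] at hn
  have hf0 : Frame (.for x n p) σ (σ.setV x 0) := by
    refine ⟨fun y hy => ?_, fun b _ => rfl⟩
    have : y ≠ x := by rintro rfl; simp [Cm.for, Cm.modV] at hy
    simp [this]
  have hf1 : ∀ {σ₁ σ₂}, Frame (.loop (.v n - .v x) (p ;; x ::= .v x + .c 1)) σ₁ σ₂ →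
      Frame (.for x n p) σ₁ σ₂ := fun h => h.mono
    (by simp +contextual [Cm.for, Cm.modV]) (by simp +contextual [Cm.for, Cm.modA])
  unfold Cm.for
  simp only [wp_seq, wp_set, Ex.eval_c]
  apply wp_loop (fun b σ' => ∃ i, b + i = σ.v n ∧ σ'.v x = i ∧ Inv i σ') (σ.v n)
    ⟨0, rfl, by simp, h0⟩
  · rintro b σ' hf ⟨i, hi, hxi, hI⟩ hc
    have hfr := hf0.trans (hf1 hf)
    have hn' := hfr.v n hn
    simp only [Ex.eval_sub, Ex.eval_v] at hc
    rw [wp_seq]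
    refine (hstep i σ' (by omega) hfr hxi hI).mono fun σ'' hf2 h2 => ?_
    have hx2 : σ''.v x = i := by rw [hf2.v x hx]; simpa using hxi
    simp only [wp_set, Ex.eval_add, Ex.eval_v, Ex.eval_c, hx2]
    exact ⟨b - 1, by omega, i + 1, by omega, by simp, h2 hx2⟩
  · rintro b σ' hf ⟨i, hi, hxi, hI⟩ hc
    have hfr := hf0.trans (hf1 hf)
    have hn' := hfr.v n hn
    simp only [Ex.eval_sub, Ex.eval_v] at hc
    obtain rfl : σ.v n = i := by omega
    exact hend σ' hfr hxi hI

/-- The state in which all variables and arrays are zero. -/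
def St.zero : St := ⟨fun _ => 0, fun _ _ => 0, 0⟩

theorem wp.decidesWithin {T : ℕ} {φ : Prop} (h : wp I p (fun σ => σ.t ≤ T ∧
    (φ → σ.v .ok = 1) ∧ (¬ φ → σ.v .ok = 0)) St.zero) :
    p.compile.DecidesWithin I (p.cost * T) φ := by
  obtain ⟨σ, hr, ht, h1, h0⟩ := h
  obtain ⟨M, t, hx, hM, hle⟩ := hr.exec_compile p.cost le_rfl (fun _ => 0)
    ⟨fun _ => rfl, fun _ _ => rfl⟩
  have hok : M 0 = σ.v .ok := hM.1 .ok
  refine ⟨M, t, hx, ?_, fun h => hok.trans (h1 h), fun h => hok.trans (h0 h)⟩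
  have := Nat.mul_le_mul_left p.cost ht
  omega

end wp

end TreeAut

namespace TreeAut

/-! ### Deterministic top-down recognizability -/

namespace BottomUp

variable {S : Type} {ar : S → ℕ} {Q : Type} {A : BottomUp ar Q}

theorem hasRun_node_iff {f : S} {ts : Fin (ar f) → RTree ar} {q : Q} :
    A.HasRun (RTree.node f ts) q ↔
      ∃ qs : Fin (ar f) → Q, (⟨f, qs, q⟩ : Rule ar Q) ∈ A.rules ∧ ∀ i, A.HasRun (ts i) (qs i) := by
  constructor
  · intro h
    cases h with
    | node f ts qs q hrule hruns => exact ⟨qs, hrule, hruns⟩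
  · rintro ⟨qs, h1, h2⟩
    exact .node f ts qs q h1 h2

theorem IsDeterministic.hasRun_unique (hA : A.IsDeterministic) {t : RTree ar} {q q' : Q}
    (h : A.HasRun t q) (h' : A.HasRun t q') : q = q' := by
  induction t generalizing q q' with
  | node f ts ih =>
    obtain ⟨qs, h1, h2⟩ := hasRun_node_iff.1 h
    obtain ⟨qs', h1', h2'⟩ := hasRun_node_iff.1 h'
    obtain rfl : qs = qs' := funext fun i => ih i (h2 i) (h2' i)
    exact hA f qs q q' h1 h1'

/-- The accessible states. -/
def Acc (A : BottomUp ar Q) (q : Q) : Prop := ∃ t, A.HasRun t q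

theorem Acc.of_rule {f : S} {qs : Fin (ar f) → Q} {q : Q}
    (h : (⟨f, qs, q⟩ : Rule ar Q) ∈ A.rules) (hqs : ∀ i, A.Acc (qs i)) : A.Acc q := by
  choose ts hts using hqs
  exact ⟨_, .node f ts qs q h hts⟩

/-- The sets of accessible states that some context takes to a final state. -/
inductive Good (A : BottomUp ar Q) : Set Q → Prop
  | base : Good A {q | A.Acc q ∧ q ∈ A.final}
  | step {U : Set Q} (f : S) (xs : Fin (ar f) → Q) (q : Q) (i : Fin (ar f))
      (h : (⟨f, xs, q⟩ : Rule ar Q) ∈ A.rules) (hxs : ∀ j, A.Acc (xs j)) (hU : Good A U) :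
      Good A {x | A.Acc x ∧ ∃ q ∈ U, (⟨f, Function.update xs i x, q⟩ : Rule ar Q) ∈ A.rules}

/-- Arguments of rules whose results lie in a common good set can be exchanged. -/
def Exchange (A : BottomUp ar Q) : Prop :=
  ∀ U, A.Good U → ∀ (f : S) (xs ys : Fin (ar f) → Q) (q q' : Q),
    (⟨f, xs, q⟩ : Rule ar Q) ∈ A.rules → (⟨f, ys, q'⟩ : Rule ar Q) ∈ A.rules →
    (∀ j, A.Acc (xs j)) → (∀ j, A.Acc (ys j)) → q ∈ U → q' ∈ U → ∀ i,
      ∃ q'' ∈ U, (⟨f, Function.update xs i (ys i), q''⟩ : Rule ar Q) ∈ A.rules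

/-- Here `plug` completes a tree by a context that belongs to the good set. Going down from the
single initial state along this context, the top-down automaton has no choice, so two accepted
completions have the same state `b` at the hole, and any tree that reaches `b` can be put there. -/
theorem Good.exists_plug (hA : A.IsDeterministic) {Q' : Type} {B : TopDown ar Q'}
    (hB : B.IsDeterministic) (hL : B.language = A.language) {U : Set Q} (hU : A.Good U) :
    ∃ plug : RTree ar → RTree ar,
      (∀ t, plug t ∈ A.language ↔ ∃ q ∈ U, A.HasRun t q) ∧
      ∀ t₁ t₂, plug t₁ ∈ A.language → plug t₂ ∈ A.language →
        ∃ b, B.toBottomUp.HasRun t₁ b ∧ B.toBottomUp.HasRun t₂ b ∧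
          ∀ t₃, B.toBottomUp.HasRun t₃ b → plug t₃ ∈ A.language := by
  induction hU with
  | base =>
    refine ⟨id, fun t => ⟨fun ⟨q, hq, h⟩ => ⟨q, ⟨⟨t, h⟩, hq⟩, h⟩, fun ⟨q, hq, h⟩ => ⟨q, hq.2, h⟩⟩,
      fun t₁ t₂ h₁ h₂ => ?_⟩
    simp only [id] at *
    rw [← hL] at *
    obtain ⟨⟨q₀, hq₀⟩, -⟩ := hB
    obtain ⟨b, hb, hr⟩ := h₁
    obtain ⟨b', hb', hr'⟩ := h₂
    have e : b = q₀ := by simpa [TopDown.toBottomUp, hq₀] using hb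
    have e' : b' = q₀ := by simpa [TopDown.toBottomUp, hq₀] using hb'
    subst e; subst e'
    exact ⟨b', hr, hr', fun t₃ h₃ => ⟨b', hb, h₃⟩⟩
  | @step U f xs q i h hxs hU ih =>
    obtain ⟨plug, hp1, hp2⟩ := ih
    choose ts hts using hxs
    -- The trees `ts j` have no runs other than those to `xs j`, so the states of the children are
    -- determined by the state at the hole.
    have key : ∀ (t : RTree ar) (qs : Fin (ar f) → Q),
        (∀ j, A.HasRun (Function.update ts i t j) (qs j)) ↔
          ∃ x, A.HasRun t x ∧ qs = Function.update xs i x := by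
      intro t qs
      constructor
      · intro hj
        refine ⟨qs i, by simpa using hj i, ?_⟩
        ext1 j
        by_cases hji : j = i
        · subst hji; simp
        · have := hj j
          rw [Function.update_of_ne hji] at this ⊢
          exact hA.hasRun_unique this (hts j)
      · rintro ⟨x, hx, rfl⟩ j
        by_cases hji : j = i
        · subst hji; simpa using hx
        · simpa [hji] using hts j
    refine ⟨fun t => plug (RTree.node f (Function.update ts i t)), fun t => ?_,
      fun t₁ t₂ h₁ h₂ => ?_⟩
    · rw [hp1]
      constructor
      · rintro ⟨q, hq, hr⟩
        obtain ⟨qs, h1, h2⟩ := hasRun_node_iff.1 hr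
        obtain ⟨x, hx, rfl⟩ := (key t qs).1 h2
        exact ⟨x, ⟨⟨t, hx⟩, q, hq, h1⟩, hx⟩
      · rintro ⟨x, ⟨-, q, hq, h1⟩, hx⟩
        exact ⟨q, hq, .node _ _ _ _ h1 ((key t _).2 ⟨x, hx, rfl⟩)⟩
    · obtain ⟨b, hb1, hb2, hb3⟩ := hp2 _ _ h₁ h₂
      obtain ⟨qs, h1, h2⟩ := hasRun_node_iff.1 hb1
      obtain ⟨qs', h1', h2'⟩ := hasRun_node_iff.1 hb2
      obtain rfl : qs = qs' := hB.2 f b qs qs' h1 h1'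
      refine ⟨qs i, by simpa using h2 i, by simpa using h2' i, fun t₃ h₃ => hb3 _ ?_⟩
      refine .node _ _ qs _ h1 fun j => ?_
      by_cases hji : j = i
      · subst hji; simpa using h₃
      · have := h2 j
        rw [Function.update_of_ne hji] at this ⊢
        exact this

/-- Trees that realize the two left-hand sides are plugged into one context. The top-down automaton
reaches both roots in the same state and must use the same rule there, so it also accepts after the
i-th child is interchanged. Uniqueness of runs of `A` turns this into a rule of `A`. -/
theorem Exchange.of_isTopDownDeterministic (hA : A.IsDeterministic)
    (h : IsTopDownDeterministic A.language) : A.Exchange := by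
  obtain ⟨Q', -, B, hB, hL⟩ := h
  intro U hU f xs ys q q' hx hy hxs hys hq hq' i
  obtain ⟨plug, hp1, hp2⟩ := hU.exists_plug hA hB hL
  choose ts hts using hxs
  choose us hus using hys
  obtain ⟨b, hb1, hb2, hb3⟩ := hp2 (.node f ts) (.node f us)
    ((hp1 _).2 ⟨q, hq, .node _ _ _ _ hx hts⟩) ((hp1 _).2 ⟨q', hq', .node _ _ _ _ hy hus⟩)
  obtain ⟨qs, h1, h2⟩ := hasRun_node_iff.1 hb1
  obtain ⟨qs', h1', h2'⟩ := hasRun_node_iff.1 hb2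
  obtain rfl : qs = qs' := hB.2 f b qs qs' h1 h1'
  have h3 : plug (.node f (Function.update ts i (us i))) ∈ A.language := by
    refine hb3 _ (.node _ _ qs _ h1 fun j => ?_)
    by_cases hji : j = i
    · subst hji; simpa using h2' j
    · simpa [hji] using h2 j
  obtain ⟨q'', hq'', hr⟩ := (hp1 _).1 h3
  obtain ⟨ps, h4, h5⟩ := hasRun_node_iff.1 hr
  have : ps = Function.update xs i (ys i) := by
    ext1 j
    refine hA.hasRun_unique (h5 j) ?_
    by_cases hji : j = i
    · subst hji; simpa using hus j
    · simpa [hji] using hts j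
  exact ⟨q'', hq'', this ▸ h4⟩

/-- The states that occur as `i`-th arguments of rules for `f` with a result in `P`. -/
def argSet (A : BottomUp ar Q) (f : S) (P : Set Q) (i : Fin (ar f)) : Set Q :=
  {x | ∃ xs q, (⟨f, xs, q⟩ : Rule ar Q) ∈ A.rules ∧ (∀ j, A.Acc (xs j)) ∧ q ∈ P ∧ xs i = x}

/-- The subset construction for the reversed automaton. -/
def subsetTopDown (A : BottomUp ar Q) : TopDown ar (Set Q) where
  init := {{q | A.Acc q ∧ q ∈ A.final}}
  rules := {r | (∃ xs q, (⟨r.sym, xs, q⟩ : Rule ar Q) ∈ A.rules ∧ (∀ j, A.Acc (xs j)) ∧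
    q ∈ r.state) ∧ r.args = A.argSet r.sym r.state}

theorem subsetTopDown_isDeterministic : A.subsetTopDown.IsDeterministic := by
  refine ⟨⟨_, rfl⟩, ?_⟩
  rintro f q qs qs' ⟨-, h⟩ ⟨-, h'⟩
  exact h.trans h'.symm

/-- The arguments are replaced one at a time. After every replacement there is again a rule with
result in `U`, to which the exchange property applies. -/
theorem Exchange.mix (hE : A.Exchange) {U : Set Q} (hU : A.Good U) {f : S}
    {xs : Fin (ar f) → Q} {q : Q} (hx : (⟨f, xs, q⟩ : Rule ar Q) ∈ A.rules)
    (hxs : ∀ j, A.Acc (xs j)) (hq : q ∈ U) {ys : Fin (ar f) → Q}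
    (hys : ∀ i, ys i ∈ A.argSet f U i) : ∃ q ∈ U, (⟨f, ys, q⟩ : Rule ar Q) ∈ A.rules := by
  have hyA : ∀ i, A.Acc (ys i) := fun i => by
    obtain ⟨zs, -, -, hz, -, e⟩ := hys i
    exact e ▸ hz i
  have key : ∀ s : Finset (Fin (ar f)), ∃ q ∈ U, (⟨f, s.piecewise ys xs, q⟩ : Rule ar Q) ∈ A.rules := by
    intro s
    induction s using Finset.induction_on with
    | empty => exact ⟨q, hq, by simpa using hx⟩
    | insert i s _ ih =>
      obtain ⟨q₁, hq₁, h₁⟩ := ih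
      obtain ⟨zs, q₂, h₂, hzA, hq₂, e⟩ := hys i
      have hA₁ : ∀ j, A.Acc (s.piecewise ys xs j) := fun j => by
        by_cases hj : j ∈ s
        · rw [Finset.piecewise_eq_of_mem _ _ _ hj]; exact hyA j
        · rw [Finset.piecewise_eq_of_notMem _ _ _ hj]; exact hxs j
      obtain ⟨q₃, hq₃, h₃⟩ := hE U hU f _ zs q₁ q₂ h₁ h₂ hA₁ hzA hq₁ hq₂ i
      rw [e] at h₃
      exact ⟨q₃, hq₃, by rwa [Finset.piecewise_insert]⟩
  simpa using key Finset.univ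

/-- By exchange, the set of i-th arguments over all rules with result in `U` equals the preimage of
`U` under the context of a single such rule. Hence the subset construction stays within the good
sets. -/
theorem Exchange.good_argSet (hE : A.Exchange) {U : Set Q} (hU : A.Good U) {f : S}
    {xs : Fin (ar f) → Q} {q : Q} (hx : (⟨f, xs, q⟩ : Rule ar Q) ∈ A.rules)
    (hxs : ∀ j, A.Acc (xs j)) (hq : q ∈ U) (i : Fin (ar f)) : A.Good (A.argSet f U i) := by
  convert Good.step f xs q i hx hxs hU using 1
  ext x
  constructor
  · rintro ⟨ys, q', hy, hys, hq', rfl⟩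
    exact ⟨hys i, hE U hU f xs ys q q' hx hy hxs hys hq hq' i⟩
  · rintro ⟨hxA, q', hq', h⟩
    refine ⟨_, q', h, fun j => ?_, hq', by simp⟩
    by_cases hji : j = i
    · subst hji; simpa using hxA
    · simpa [hji] using hxs j

/-- The subset automaton sends independent sets to the children and forgets which arguments occur
together. `Exchange.mix` shows that every combination occurs, so nothing is lost. -/
theorem Exchange.hasRun_subsetTopDown (hE : A.Exchange) (t : RTree ar) :
    ∀ U, A.Good U → (A.subsetTopDown.toBottomUp.HasRun t U ↔ ∃ q ∈ U, A.HasRun t q) := by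
  induction t with
  | node f ts ih =>
    intro U hU
    rw [hasRun_node_iff]
    constructor
    · rintro ⟨Ps, ⟨⟨xs, q, hx, hxs, hq⟩, hP⟩, h⟩
      simp only at hP hx hxs hq
      have : ∀ i, ∃ y ∈ A.argSet f U i, A.HasRun (ts i) y := fun i => by
        have := h i
        rw [hP, ih i _ (hE.good_argSet hU hx hxs hq i)] at this
        exact this
      choose ys hys hr using this
      obtain ⟨q', hq', hrule⟩ := hE.mix hU hx hxs hq hys
      exact ⟨q', hq', .node _ _ _ _ hrule hr⟩
    · rintro ⟨q, hq, hr⟩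
      obtain ⟨xs, hx, hr⟩ := hasRun_node_iff.1 hr
      have hxs : ∀ j, A.Acc (xs j) := fun j => ⟨_, hr j⟩
      refine ⟨A.argSet f U, ⟨⟨xs, q, hx, hxs, hq⟩, rfl⟩, fun i => ?_⟩
      rw [ih i _ (hE.good_argSet hU hx hxs hq i)]
      exact ⟨xs i, ⟨xs, q, hx, hxs, hq, rfl⟩, hr i⟩

theorem isTopDownDeterministic_iff_exchange [Finite Q] (hA : A.IsDeterministic) :
    IsTopDownDeterministic A.language ↔ A.Exchange := by
  refine ⟨Exchange.of_isTopDownDeterministic hA, fun hE => ?_⟩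
  refine ⟨Set Q, inferInstance, A.subsetTopDown, subsetTopDown_isDeterministic, ?_⟩
  ext t
  constructor
  · rintro ⟨U, hU, hr⟩
    obtain rfl : U = _ := hU
    obtain ⟨q, hq, h⟩ := (hE.hasRun_subsetTopDown t _ .base).1 hr
    exact ⟨q, hq.2, h⟩
  · rintro ⟨q, hq, h⟩
    exact ⟨_, rfl, (hE.hasRun_subsetTopDown t _ .base).2 ⟨q, ⟨⟨t, h⟩, hq⟩, h⟩⟩

end BottomUp

end TreeAut

namespace TreeAut

/-! ### Numerical view of a description -/

/-- The numbers in the description `I` of a deterministic automaton: rule number `j` starts at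
position `st j`, has the symbol `sy j` of rank `rk j`, the arguments `ag j i` and the target
`tg j`. -/
structure Inst (I : List ℕ) : Type where
  (s m R : ℕ)
  (sy rk tg st : ℕ → ℕ)
  ag : ℕ → ℕ → ℕ
  fn : ℕ → Prop
  rd_s : I.getD 0 0 = s
  rd_m : I.getD 1 0 = m
  rd_R : I.getD (2 + s + m) 0 = R
  st_zero : st 0 = 3 + s + m
  st_succ : ∀ j < R, st (j + 1) = st j + rk j + 2
  st_R : st R = I.length
  rd_sy : ∀ j < R, I.getD (st j) 0 = sy j
  rd_rk : ∀ j < R, I.getD (2 + sy j) 0 = rk j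
  rd_ag : ∀ j < R, ∀ i < rk j, I.getD (st j + 1 + i) 0 = ag j i
  rd_tg : ∀ j < R, I.getD (st j + 1 + rk j) 0 = tg j
  sy_lt : ∀ j < R, sy j < s
  ag_lt : ∀ j < R, ∀ i < rk j, ag j i < m
  tg_lt : ∀ j < R, tg j < m
  rd_fn : ∀ q < m, (I.getD (2 + s + q) 0 ≠ 0 ↔ fn q)
  det : ∀ j < R, ∀ j' < R, sy j = sy j' → (∀ i < rk j, ag j i = ag j' i) → j = j'

namespace Inst

variable {I : List ℕ} (G : Inst I)

/-- The accessible states. -/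
inductive Acc : ℕ → Prop
  | intro (j : ℕ) (hj : j < G.R) (h : ∀ i < G.rk j, Acc (G.ag j i)) : Acc (G.tg j)

/-- The rules all of whose arguments are accessible. -/
def Valid (j : ℕ) : Prop := j < G.R ∧ ∀ i < G.rk j, G.Acc (G.ag j i)

/-- Rule `j'` arises from the left-hand side of rule `j` if its `i`-th argument is set to `x`. -/
def Match (j i x j' : ℕ) : Prop :=
  G.Valid j' ∧ G.sy j' = G.sy j ∧ G.ag j' i = x ∧ ∀ l < G.rk j, l ≠ i → G.ag j' l = G.ag j l

/-- The sets of accessible states that some context takes to a final state. -/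
inductive Good : Set ℕ → Prop
  | base : Good {q | G.Acc q ∧ G.fn q}
  | step {U : Set ℕ} (j i : ℕ) (hj : G.Valid j) (hi : i < G.rk j) (hU : Good U) :
      Good {x | ∃ j', G.Match j i x j' ∧ G.tg j' ∈ U}

def Exchange : Prop :=
  ∀ U, G.Good U → ∀ j j' i, G.Valid j → G.Valid j' → G.sy j = G.sy j' → G.tg j ∈ U →
    G.tg j' ∈ U → i < G.rk j → ∃ k, G.Match j i (G.ag j' i) k ∧ G.tg k ∈ U

variable {G}

theorem rk_eq {j j' : ℕ} (hj : j < G.R) (hj' : j' < G.R) (h : G.sy j = G.sy j') :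
    G.rk j = G.rk j' := by rw [← G.rd_rk j hj, ← G.rd_rk j' hj', h]

theorem Acc.lt {q : ℕ} (h : G.Acc q) : q < G.m := by
  cases h with
  | intro j hj h => exact G.tg_lt j hj

theorem Valid.acc_tg {j : ℕ} (h : G.Valid j) : G.Acc (G.tg j) := .intro j h.1 h.2

theorem Match.rk_eq {j i x j' : ℕ} (h : G.Match j i x j') (hj : j < G.R) : G.rk j' = G.rk j :=
  Inst.rk_eq h.1.1 hj h.2.1

theorem Match.self {j : ℕ} (hj : G.Valid j) (i : ℕ) : G.Match j i (G.ag j i) j :=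
  ⟨hj, rfl, rfl, fun _ _ _ => rfl⟩

theorem Match.unique {j i x k k' : ℕ} (hj : j < G.R) (h : G.Match j i x k)
    (h' : G.Match j i x k') : k = k' := by
  refine G.det k h.1.1 k' h'.1.1 (h.2.1.trans h'.2.1.symm) fun l hl => ?_
  rw [h.rk_eq hj] at hl
  by_cases hli : l = i
  · subst hli; rw [h.2.2.1, h'.2.2.1]
  · rw [h.2.2.2 l hl hli, h'.2.2.2 l hl hli]

/-- Matching only depends on the context. -/
theorem Match.congr {j i x k : ℕ} (hj : j < G.R) (h : G.Match j i x k) {y l : ℕ} :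
    G.Match k i y l ↔ G.Match j i y l := by
  constructor
  · rintro ⟨h1, h2, h3, h4⟩
    refine ⟨h1, h2.trans h.2.1, h3, fun a ha hai => ?_⟩
    rw [h4 a (by rwa [h.rk_eq hj]) hai, h.2.2.2 a ha hai]
  · rintro ⟨h1, h2, h3, h4⟩
    refine ⟨h1, h2.trans h.2.1.symm, h3, fun a ha hai => ?_⟩
    rw [h.rk_eq hj] at ha
    rw [h4 a ha hai, h.2.2.2 a ha hai]

theorem Match.acc {j i x k : ℕ} (hj : j < G.R) (hi : i < G.rk j) (h : G.Match j i x k) :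
    G.Acc x := by
  rw [← h.2.2.1]; exact h.1.2 i (by rwa [h.rk_eq hj])

theorem Good.acc {U : Set ℕ} (h : G.Good U) {q : ℕ} (hq : q ∈ U) : G.Acc q := by
  cases h with
  | base => exact hq.1
  | step j i hj hi hU => obtain ⟨k, hk, -⟩ := hq; exact hk.acc hj.1 hi

end Inst

/-! ### The numbers in a description -/

section encode

variable {s m : ℕ} {ar : Fin s → ℕ}

theorem Rule.length_encode (r : Rule ar (Fin m)) : r.encode.length = ar r.sym + 2 := by
  simp [Rule.encode]

theorem getD_flatMap_encode (rs : List (Rule ar (Fin m))) {j : ℕ} (hj : j < rs.length) {x : ℕ}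
    (hx : x < ar rs[j].sym + 2) (pre : List ℕ) :
    (pre ++ rs.flatMap Rule.encode).getD
      (pre.length + ((rs.take j).flatMap Rule.encode).length + x) 0 = rs[j].encode.getD x 0 := by
  have h : rs = rs.take j ++ (rs[j] :: rs.drop (j + 1)) := by simp
  conv_lhs => rw [h]
  rw [List.flatMap_append, List.flatMap_cons, add_assoc, List.getD_append_right _ _ _ _ (by omega),
    Nat.add_sub_cancel_left]
  have e : List.take j (List.take j rs ++ (rs[j] :: List.drop (j + 1) rs)) = List.take j rs := by
    rw [← h]
  rw [e, List.getD_append_right _ _ _ _ (by omega), Nat.add_sub_cancel_left]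
  exact List.getD_append _ _ _ _ (by rw [Rule.length_encode]; exact hx)

end encode

end TreeAut

/-! ### Decoding a description -/

namespace TreeAut

section ofRules

variable {s m : ℕ} {ar : Fin s → ℕ} (A : BottomUp ar (Fin m)) (rs : List (Rule ar (Fin m)))

open Classical in
/-- The description of an automaton that lists its rules in the order `rs`. -/
noncomputable def BottomUp.describe : List ℕ :=
  [s, m] ++ List.ofFn ar ++ List.ofFn (fun q : Fin m => if q ∈ A.final then 1 else 0) ++
    [rs.length] ++ rs.flatMap Rule.encode

open Classical in
/-- The part of a description before the rules. -/
noncomputable def BottomUp.describeHead : List ℕ :=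
  [s, m] ++ List.ofFn ar ++ List.ofFn (fun q : Fin m => if q ∈ A.final then 1 else 0) ++ [rs.length]

theorem BottomUp.describe_eq : A.describe rs = A.describeHead rs ++ rs.flatMap Rule.encode := rfl

theorem BottomUp.length_describeHead : (A.describeHead rs).length = 3 + s + m := by
  simp [BottomUp.describeHead]; omega

theorem BottomUp.getD_describe_rank (f : Fin s) : (A.describe rs).getD (2 + f) 0 = ar f := by
  unfold BottomUp.describe
  rw [List.getD_append _ _ _ _ (by simp; omega), List.getD_append _ _ _ _ (by simp; omega),
    List.getD_append _ _ _ _ (by simp; omega), List.getD_append_right _ _ _ _ (by simp)]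
  simp

open Classical in
theorem BottomUp.getD_describe_final (q : Fin m) :
    (A.describe rs).getD (2 + s + q) 0 = if q ∈ A.final then 1 else 0 := by
  unfold BottomUp.describe
  rw [List.getD_append _ _ _ _ (by simp; omega), List.getD_append _ _ _ _ (by simp; omega),
    List.getD_append_right _ _ _ _ (by simp; omega)]
  have : 2 + s + (q : ℕ) - ([s, m] ++ List.ofFn ar).length = q := by simp; omega
  rw [this]
  simp

theorem BottomUp.getD_describe_length : (A.describe rs).getD (2 + s + m) 0 = rs.length := by
  unfold BottomUp.describe
  rw [List.getD_append _ _ _ _ (by simp; omega), List.getD_append_right _ _ _ _ (by simp; omega)]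
  classical
  have : 2 + s + m - ([s, m] ++ List.ofFn ar ++
    List.ofFn (fun q : Fin m => if q ∈ A.final then 1 else 0)).length = 0 := by simp; omega
  rw [this]
  simp

variable {A rs}

theorem Rule.encode_getD_zero (r : Rule ar (Fin m)) : r.encode.getD 0 0 = r.sym := by
  simp [Rule.encode]

theorem Rule.encode_getD_arg (r : Rule ar (Fin m)) (i : ℕ) (hi : i < ar r.sym) :
    r.encode.getD (1 + i) 0 = r.args ⟨i, hi⟩ := by
  rw [add_comm, Rule.encode, List.getD_cons_succ, List.getD_append _ _ _ _ (by simpa using hi)]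
  simp [hi]

theorem Rule.encode_getD_state (r : Rule ar (Fin m)) :
    r.encode.getD (1 + ar r.sym) 0 = r.state := by
  simp [Rule.encode, add_comm 1 (ar r.sym)]

/-- The numerical view of the description of a deterministic automaton. -/
noncomputable def Inst.ofRules (hA : A.IsDeterministic) (hnd : rs.Nodup)
    (hrs : ∀ r, r ∈ rs ↔ r ∈ A.rules) : Inst (A.describe rs) := by
  classical
  have rd : ∀ j (hj : j < rs.length) x, x < ar rs[j].sym + 2 →
      (A.describe rs).getD (3 + s + m + ((rs.take j).flatMap Rule.encode).length + x) 0 =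
        rs[j].encode.getD x 0 := fun j hj x hx => by
    rw [BottomUp.describe_eq, ← A.length_describeHead rs]
    exact getD_flatMap_encode rs hj hx _
  exact
  { s := s
    m := m
    R := rs.length
    sy := fun j => if h : j < rs.length then rs[j].sym else 0
    rk := fun j => if h : j < rs.length then ar rs[j].sym else 0
    tg := fun j => if h : j < rs.length then rs[j].state else 0
    st := fun j => 3 + s + m + ((rs.take j).flatMap Rule.encode).length
    ag := fun j i => if h : j < rs.length then
      (if hi : i < ar rs[j].sym then rs[j].args ⟨i, hi⟩ else 0) else 0
    fn := fun q => ∃ h : q < m, (⟨q, h⟩ : Fin m) ∈ A.final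
    rd_s := by simp [BottomUp.describe]
    rd_m := by simp [BottomUp.describe]
    rd_R := A.getD_describe_length rs
    st_zero := by simp
    st_succ := fun j hj => by
      rw [List.take_succ_eq_append_getElem hj]
      simp only [hj, dif_pos, List.flatMap_append, List.length_append, List.flatMap_cons,
        List.flatMap_nil, List.append_nil, Rule.length_encode]
      omega
    st_R := by rw [BottomUp.describe_eq]; simp [A.length_describeHead rs]
    rd_sy := fun j hj => by
      have := rd j hj 0 (by omega)
      simp only [add_zero] at this
      rw [this, Rule.encode_getD_zero, dif_pos hj]
    rd_rk := fun j hj => by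
      rw [dif_pos hj, dif_pos hj]; exact A.getD_describe_rank rs _
    rd_ag := fun j hj i hi => by
      rw [dif_pos hj] at hi
      rw [dif_pos hj, dif_pos hi, ← Rule.encode_getD_arg, ← rd j hj (1 + i) (by omega), add_assoc _ 1 i]
    rd_tg := fun j hj => by
      rw [dif_pos hj, dif_pos hj, ← Rule.encode_getD_state, ← rd j hj _ (by omega), add_assoc _ 1]
    sy_lt := fun j hj => by simp [hj]
    ag_lt := fun j hj i hi => by rw [dif_pos hj] at hi; simp [hj, hi]
    tg_lt := fun j hj => by simp [hj]
    rd_fn := fun q hq => by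
      have := A.getD_describe_final rs ⟨q, hq⟩
      simp only at this
      rw [this]
      simp [hq]
    -- Rules with the same left-hand side coincide by determinism of `A`. Their numbers then
    -- coincide because the list has no repetitions.
    det := fun j hj j' hj' h ha => by
      simp only [hj, hj', dif_pos] at h ha
      have h1 : rs[j] = ⟨rs[j].sym, rs[j].args, rs[j].state⟩ := rfl
      have hm : rs[j] ∈ A.rules := (hrs _).1 (List.getElem_mem hj)
      have hm' : rs[j'] ∈ A.rules := (hrs _).1 (List.getElem_mem hj')
      have key : rs[j] = rs[j'] := by
        generalize rs[j] = r at *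
        generalize rs[j'] = r' at *
        obtain ⟨f, xs, q⟩ := r
        obtain ⟨f', xs', q'⟩ := r'
        obtain rfl : f = f' := Fin.ext h
        obtain rfl : xs = xs' := funext fun i => Fin.ext (by simpa using ha i i.2)
        obtain rfl := hA _ _ _ _ hm hm'
        rfl
      exact (List.Nodup.getElem_inj_iff hnd).1 key }

/-! ### Transfer of the exchange property to rule numbers -/

section link

variable (hA : A.IsDeterministic) (hnd : rs.Nodup) (hrs : ∀ r, r ∈ rs ↔ r ∈ A.rules)

local notation "GG" => Inst.ofRules hA hnd hrs

theorem Inst.ofRules_sy {j : ℕ} (hj : j < rs.length) : (GG).sy j = rs[j].sym := dif_pos hj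
theorem Inst.ofRules_rk {j : ℕ} (hj : j < rs.length) : (GG).rk j = ar rs[j].sym := dif_pos hj
theorem Inst.ofRules_tg {j : ℕ} (hj : j < rs.length) : (GG).tg j = rs[j].state := dif_pos hj
theorem Inst.ofRules_ag {j : ℕ} (hj : j < rs.length) (i : Fin (ar rs[j].sym)) :
    (GG).ag j i = rs[j].args i := by
  show (if h : j < rs.length then
      (if hi : (i : ℕ) < ar rs[j].sym then (rs[j].args ⟨i, hi⟩ : ℕ) else 0) else 0) = _
  rw [dif_pos hj, dif_pos i.2]

include hA hnd hrs in
theorem exists_index {f : Fin s} {xs : Fin (ar f) → Fin m} {q : Fin m}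
    (h : (⟨f, xs, q⟩ : Rule ar (Fin m)) ∈ A.rules) :
    ∃ j < (GG).R, (GG).sy j = f ∧ (GG).rk j = ar f ∧ (GG).tg j = q ∧
      ∀ i : Fin (ar f), (GG).ag j i = xs i := by
  obtain ⟨j, hj, e⟩ := List.getElem_of_mem ((hrs _).2 h)
  refine ⟨j, hj, ?_, ?_, ?_, fun i => ?_⟩
  · rw [Inst.ofRules_sy hA hnd hrs hj, e]
  · rw [Inst.ofRules_rk hA hnd hrs hj, e]
  · rw [Inst.ofRules_tg hA hnd hrs hj, e]
  · have : ∀ i : Fin (ar rs[j].sym), (GG).ag j i = rs[j].args i := Inst.ofRules_ag hA hnd hrs hj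
    rw [e] at this
    exact this i

include hA hnd hrs in
theorem exists_rule {j : ℕ} (hj : j < (GG).R) :
    ∃ (f : Fin s) (xs : Fin (ar f) → Fin m) (q : Fin m),
      (⟨f, xs, q⟩ : Rule ar (Fin m)) ∈ A.rules ∧ (GG).sy j = f ∧ (GG).rk j = ar f ∧ (GG).tg j = q ∧
      ∀ i : Fin (ar f), (GG).ag j i = xs i :=
  ⟨rs[j].sym, rs[j].args, rs[j].state, (hrs _).1 (List.getElem_mem hj),
    Inst.ofRules_sy hA hnd hrs hj, Inst.ofRules_rk hA hnd hrs hj, Inst.ofRules_tg hA hnd hrs hj,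
    Inst.ofRules_ag hA hnd hrs hj⟩

theorem Inst.ofRules_acc (q : Fin m) : (GG).Acc q ↔ A.Acc q := by
  constructor
  · intro h
    generalize hx : (q : ℕ) = x at h
    induction h generalizing q with
    | intro j hj h ih =>
      obtain ⟨f, xs, q', hr, e1, e2, e3, e4⟩ := exists_rule hA hnd hrs hj
      obtain rfl : q = q' := Fin.ext (hx.trans e3)
      exact .of_rule hr fun i => ih i (by rw [e2]; exact i.2) _ (e4 i).symm
  · rintro ⟨t, h⟩
    induction h with
    | node f ts qs q hr _ ih =>
      obtain ⟨j, hj, e1, e2, e3, e4⟩ := exists_index hA hnd hrs hr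
      rw [← e3]
      refine .intro j hj fun i hi => ?_
      rw [e2] at hi
      rw [e4 ⟨i, hi⟩]
      exact ih _

/-- The correspondence between rules and their numbers for rules with one argument replaced. -/
theorem Inst.ofRules_match {j : ℕ} {f : Fin s} {xs : Fin (ar f) → Fin m}
    (e1 : (GG).sy j = f) (e2 : (GG).rk j = ar f) (e4 : ∀ i : Fin (ar f), (GG).ag j i = xs i)
    (hxs : ∀ i, A.Acc (xs i)) (i : Fin (ar f)) (x : ℕ) (U : Set (Fin m)) :
    (∃ k, (GG).Match j i x k ∧ (GG).tg k ∈ Fin.val '' U) ↔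
      ∃ x' : Fin m, (x' : ℕ) = x ∧ A.Acc x' ∧ ∃ q ∈ U,
        (⟨f, Function.update xs i x', q⟩ : Rule ar (Fin m)) ∈ A.rules := by
  constructor
  · rintro ⟨k, hk, q, hq, hqk⟩
    obtain ⟨f', ys, q', hr, d1, d2, d3, d4⟩ := exists_rule hA hnd hrs hk.1.1
    obtain rfl : f' = f := Fin.ext (d1.symm.trans (hk.2.1.trans e1))
    obtain rfl : q = q' := Fin.ext (hqk.trans d3)
    have hy : ys = Function.update xs i (ys i) := by
      ext1 l
      by_cases hl : l = i
      · subst hl; simp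
      · rw [Function.update_of_ne hl]
        apply Fin.ext
        rw [← d4, ← e4]
        exact hk.2.2.2 l (by rw [e2]; exact l.2) fun h => hl (Fin.ext h)
    refine ⟨ys i, ?_, ?_, q, hq, hy ▸ hr⟩
    · rw [← d4, hk.2.2.1]
    · rw [← Inst.ofRules_acc hA hnd hrs, ← d4]
      exact hk.1.2 i (by rw [d2]; exact i.2)
  · rintro ⟨x', rfl, hx, q, hq, hr⟩
    obtain ⟨k, hk, d1, d2, d3, d4⟩ := exists_index hA hnd hrs hr
    refine ⟨k, ⟨⟨hk, fun l hl => ?_⟩, d1.trans e1.symm, ?_, fun l hl hli => ?_⟩, q, hq, d3.symm⟩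
    · rw [d2] at hl
      rw [d4 ⟨l, hl⟩, Inst.ofRules_acc]
      by_cases h : (⟨l, hl⟩ : Fin (ar f)) = i
      · subst h; simpa using hx
      · rw [Function.update_of_ne h]; exact hxs _
    · rw [d4]; simp
    · rw [e2] at hl
      have h : (⟨l, hl⟩ : Fin (ar f)) ≠ i := fun h => hli (by rw [← h])
      rw [d4 ⟨l, hl⟩, e4 ⟨l, hl⟩, Function.update_of_ne h]

theorem Inst.ofRules_good {U : Set (Fin m)} (h : A.Good U) : (GG).Good (Fin.val '' U) := by
  induction h with
  | base =>
    convert Inst.Good.base (G := GG) using 1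
    ext x
    constructor
    · rintro ⟨q, ⟨h1, h2⟩, rfl⟩
      exact ⟨(Inst.ofRules_acc hA hnd hrs q).2 h1, q.2, h2⟩
    · rintro ⟨h1, h2, h3⟩
      exact ⟨⟨x, h2⟩, ⟨(Inst.ofRules_acc hA hnd hrs ⟨x, h2⟩).1 h1, h3⟩, rfl⟩
  | @step U f xs q i h hxs hU ih =>
    obtain ⟨j, hj, e1, e2, e3, e4⟩ := exists_index hA hnd hrs h
    have hv : (GG).Valid j := ⟨hj, fun l hl => by
      rw [e2] at hl
      rw [e4 ⟨l, hl⟩, Inst.ofRules_acc]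
      exact hxs _⟩
    convert Inst.Good.step (G := GG) j i hv (by rw [e2]; exact i.2) ih using 1
    ext x
    rw [Set.mem_ofPred_eq, Inst.ofRules_match hA hnd hrs e1 e2 e4 hxs]
    constructor
    · rintro ⟨x', ⟨h1, h2⟩, rfl⟩; exact ⟨x', rfl, h1, h2⟩
    · rintro ⟨x', rfl, h1, h2⟩; exact ⟨x', ⟨h1, h2⟩, rfl⟩

/-- Needed because exchange quantifies over good sets on either side: together with
`Inst.ofRules_good`, the two kinds of good sets correspond under images by `Fin.val`. -/
theorem Inst.good_ofRules {V : Set ℕ} (h : (GG).Good V) :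
    ∃ U : Set (Fin m), A.Good U ∧ V = Fin.val '' U := by
  induction h with
  | base =>
    refine ⟨_, .base, ?_⟩
    ext x
    constructor
    · rintro ⟨h1, h2, h3⟩
      exact ⟨⟨x, h2⟩, ⟨(Inst.ofRules_acc hA hnd hrs ⟨x, h2⟩).1 h1, h3⟩, rfl⟩
    · rintro ⟨q, ⟨h1, h2⟩, rfl⟩
      exact ⟨(Inst.ofRules_acc hA hnd hrs q).2 h1, q.2, h2⟩
  | step j i hj hi hU ih =>
    obtain ⟨U, hU', rfl⟩ := ih
    obtain ⟨f, xs, q, hr, e1, e2, e3, e4⟩ := exists_rule hA hnd hrs hj.1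
    have hxs : ∀ l, A.Acc (xs l) := fun l => by
      rw [← Inst.ofRules_acc hA hnd hrs, ← e4]
      exact hj.2 l (by rw [e2]; exact l.2)
    rw [e2] at hi
    refine ⟨_, .step f xs q ⟨i, hi⟩ hr hxs hU', ?_⟩
    ext x
    have := Inst.ofRules_match hA hnd hrs e1 e2 e4 hxs ⟨i, hi⟩ x U
    simp only at this
    rw [Set.mem_ofPred_eq, this]
    constructor
    · rintro ⟨x', rfl, h1, h2⟩; exact ⟨x', ⟨h1, h2⟩, rfl⟩
    · rintro ⟨x', ⟨h1, h2⟩, rfl⟩; exact ⟨x', rfl, h1, h2⟩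

theorem Inst.ofRules_exchange : (GG).Exchange ↔ A.Exchange := by
  constructor
  · intro h U hU f xs ys q q' hx hy hxs hys hq hq' i
    obtain ⟨j, hj, e1, e2, e3, e4⟩ := exists_index hA hnd hrs hx
    obtain ⟨k, hk, d1, d2, d3, d4⟩ := exists_index hA hnd hrs hy
    have hv : (GG).Valid j := ⟨hj, fun l hl => by
      rw [e2] at hl
      rw [e4 ⟨l, hl⟩, Inst.ofRules_acc]
      exact hxs _⟩
    have hv' : (GG).Valid k := ⟨hk, fun l hl => by
      rw [d2] at hl
      rw [d4 ⟨l, hl⟩, Inst.ofRules_acc]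
      exact hys _⟩
    have := h _ (Inst.ofRules_good hA hnd hrs hU) j k i hv hv' (e1.trans d1.symm)
      ⟨q, hq, e3.symm⟩ ⟨q', hq', d3.symm⟩ (by rw [e2]; exact i.2)
    rw [Inst.ofRules_match hA hnd hrs e1 e2 e4 hxs, d4] at this
    obtain ⟨x', hx', -, h2⟩ := this
    obtain rfl := Fin.ext hx'
    exact h2
  · intro h V hV j k i hj hk hs hjV hkV hi
    obtain ⟨U, hU, rfl⟩ := Inst.good_ofRules hA hnd hrs hV
    obtain ⟨f, xs, q, hr, e1, e2, e3, e4⟩ := exists_rule hA hnd hrs hj.1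
    obtain ⟨f', ys, q', hr', d1, d2, d3, d4⟩ := exists_rule hA hnd hrs hk.1
    obtain rfl : f = f' := Fin.ext (e1.symm.trans (hs.trans d1))
    have hxs : ∀ l, A.Acc (xs l) := fun l => by
      rw [← Inst.ofRules_acc hA hnd hrs, ← e4]
      exact hj.2 l (by rw [e2]; exact l.2)
    have hys : ∀ l, A.Acc (ys l) := fun l => by
      rw [← Inst.ofRules_acc hA hnd hrs, ← d4]
      exact hk.2 l (by rw [d2]; exact l.2)
    rw [e2] at hi
    have hq : q ∈ U := by
      obtain ⟨q₁, h1, h2⟩ := hjV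
      rwa [← Fin.ext (h2.trans e3)]
    have hq' : q' ∈ U := by
      obtain ⟨q₁, h1, h2⟩ := hkV
      rwa [← Fin.ext (h2.trans d3)]
    have := Inst.ofRules_match hA hnd hrs e1 e2 e4 hxs ⟨i, hi⟩ ((GG).ag k i) U
    simp only at this
    rw [this]
    exact ⟨ys ⟨i, hi⟩, (d4 ⟨i, hi⟩).symm, hys _, h U hU f xs ys q q' hr hr' hxs hys hq hq' ⟨i, hi⟩⟩

end link

end ofRules

/-- The numerical view of a description of a deterministic automaton. -/
theorem exists_inst {s m : ℕ} {ar : Fin s → ℕ} {A : BottomUp ar (Fin m)}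
    (hA : A.IsDeterministic) {I : List ℕ} (hI : A.IsDescription I) :
    ∃ G : Inst I, G.Exchange ↔ IsTopDownDeterministic A.language := by
  obtain ⟨rs, hnd, hrs, rfl⟩ := hI
  exact ⟨Inst.ofRules hA hnd hrs, (Inst.ofRules_exchange hA hnd hrs).trans
    (BottomUp.isTopDownDeterministic_iff_exchange hA).symm⟩

end TreeAut

namespace TreeAut

namespace Inst

variable {I : List ℕ} (G : Inst I)

/-! ### Pairs of states -/

/-- `(j, i)` stands for the context of the `i`-th argument in the valid rule `j`. -/
def Letter (j i : ℕ) : Prop := G.Valid j ∧ i < G.rk j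

open Classical in
/-- The state, increased by one, that the context `(j, i)` assigns to `x`; zero if there is none. -/
noncomputable def ap (j i x : ℕ) : ℕ :=
  if h : ∃ k, G.Match j i x k then G.tg h.choose + 1 else 0

/-- The context `(j, i)` takes the pair `u` to the pair `v`. -/
def Step (j i : ℕ) (u v : ℕ × ℕ) : Prop :=
  G.ap j i u.1 = v.1 + 1 ∧ G.ap j i u.2 = v.2 + 1

/-- Both components of `u` lie in `U`. -/
def Sub (u : ℕ × ℕ) (U : Set ℕ) : Prop := u.1 ∈ U ∧ u.2 ∈ U

/-- Some context takes both components of `u` to a final state. -/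
def Live (u : ℕ × ℕ) : Prop := ∃ U, G.Good U ∧ Sub u U

def Fin2 (u : ℕ × ℕ) : Prop := G.fn u.1 ∧ G.fn u.2

/-- The same contexts take both components of `u` and of `v` to final states. -/
def Equiv (u v : ℕ × ℕ) : Prop := ∀ U, G.Good U → (Sub u U ↔ Sub v U)

/-- The contexts, given by rules with `i`-th argument `u.1`, that take `u` to a live pair. -/
def liveOut (u : ℕ × ℕ) : Set (ℕ × ℕ) :=
  {l | G.Letter l.1 l.2 ∧ G.ag l.1 l.2 = u.1 ∧ ∃ w, G.Step l.1 l.2 u w ∧ G.Live w}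

variable {G}

theorem ap_eq {j i x k : ℕ} (hj : j < G.R) (h : G.Match j i x k) : G.ap j i x = G.tg k + 1 := by
  have h' : ∃ k, G.Match j i x k := ⟨k, h⟩
  rw [ap, dif_pos h', Match.unique hj h'.choose_spec h]

theorem exists_match_of_ap {j i x : ℕ} (h : G.ap j i x ≠ 0) :
    ∃ k, G.Match j i x k ∧ G.ap j i x = G.tg k + 1 := by
  unfold ap at *
  split_ifs at h ⊢ with h'
  · exact ⟨_, h'.choose_spec, rfl⟩
  · exact absurd rfl h

theorem ap_eq_succ_iff {j i x t : ℕ} (hj : j < G.R) :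
    G.ap j i x = t + 1 ↔ ∃ k, G.Match j i x k ∧ G.tg k = t := by
  constructor
  · intro h
    obtain ⟨k, hk, e⟩ := exists_match_of_ap (G := G) (j := j) (i := i) (x := x) (by omega)
    exact ⟨k, hk, by omega⟩
  · rintro ⟨k, hk, rfl⟩
    exact ap_eq hj hk

theorem ap_congr {j i x k : ℕ} (hj : j < G.R) (h : G.Match j i x k) (y : ℕ) :
    G.ap k i y = G.ap j i y := by
  by_cases hx : ∃ l, G.Match j i y l
  · obtain ⟨l, hl⟩ := hx
    rw [ap_eq hj hl, ap_eq h.1.1 ((h.congr hj).2 hl)]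
  · rw [ap, ap, dif_neg hx, dif_neg fun ⟨l, hl⟩ => hx ⟨l, (h.congr hj).1 hl⟩]

theorem ap_acc {j i x : ℕ} (h : G.Letter j i) (hx : G.ap j i x ≠ 0) : G.Acc x := by
  obtain ⟨k, hk, -⟩ := exists_match_of_ap hx
  exact hk.acc h.1.1 h.2

theorem acc_of_ap {j i x t : ℕ} (hx : G.ap j i x = t + 1) : G.Acc t := by
  obtain ⟨k, hk, e⟩ := exists_match_of_ap (G := G) (j := j) (i := i) (x := x) (by omega)
  obtain rfl : G.tg k = t := by omega
  exact hk.1.acc_tg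

theorem Letter.of_match {j i x k : ℕ} (h : G.Letter j i) (hk : G.Match j i x k) :
    G.Letter k i := ⟨hk.1, by rw [hk.rk_eq h.1.1]; exact h.2⟩

theorem Letter.ap_self {j i : ℕ} (h : G.Letter j i) : G.ap j i (G.ag j i) = G.tg j + 1 :=
  ap_eq h.1.1 (Match.self h.1 i)

theorem Step.unique {j i : ℕ} {u v v' : ℕ × ℕ} (h : G.Step j i u v) (h' : G.Step j i u v') :
    v = v' := by
  obtain ⟨h1, h2⟩ := h
  obtain ⟨h3, h4⟩ := h'
  exact Prod.ext (by omega) (by omega)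

theorem Step.congr {j i x k : ℕ} (hj : j < G.R) (h : G.Match j i x k) {u v : ℕ × ℕ} :
    G.Step k i u v ↔ G.Step j i u v := by
  simp only [Step, ap_congr hj h]

/-- This translates one inductive step of `Good` into one transition of the deterministic automaton
on pairs; all later arguments about good sets go through it. -/
theorem sub_pre_iff {j i : ℕ} (hj : j < G.R) {u : ℕ × ℕ} {U : Set ℕ} :
    Sub u {x | ∃ k, G.Match j i x k ∧ G.tg k ∈ U} ↔ ∃ v, G.Step j i u v ∧ Sub v U := by
  constructor
  · rintro ⟨⟨k, hk, h⟩, k', hk', h'⟩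
    exact ⟨(G.tg k, G.tg k'), ⟨ap_eq hj hk, ap_eq hj hk'⟩, h, h'⟩
  · rintro ⟨v, ⟨h1, h2⟩, h3, h4⟩
    obtain ⟨k, hk, e⟩ := (ap_eq_succ_iff hj).1 h1
    obtain ⟨k', hk', e'⟩ := (ap_eq_succ_iff hj).1 h2
    exact ⟨⟨k, hk, e ▸ h3⟩, k', hk', e' ▸ h4⟩

theorem Live.acc {u : ℕ × ℕ} (h : G.Live u) : G.Acc u.1 ∧ G.Acc u.2 := by
  obtain ⟨U, hU, h1, h2⟩ := h
  exact ⟨hU.acc h1, hU.acc h2⟩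

theorem Live.base {u : ℕ × ℕ} (h1 : G.Acc u.1) (h2 : G.Acc u.2) (h : G.Fin2 u) : G.Live u :=
  ⟨_, .base, ⟨h1, h.1⟩, ⟨h2, h.2⟩⟩

theorem Live.step {j i : ℕ} {u v : ℕ × ℕ} (hl : G.Letter j i) (h : G.Step j i u v)
    (hv : G.Live v) : G.Live u := by
  obtain ⟨U, hU, hs⟩ := hv
  exact ⟨_, .step j i hl.1 hl.2 hU, (sub_pre_iff hl.1.1).2 ⟨v, h, hs⟩⟩

/-- Liveness is backward reachability from the pairs of accessible final states. This form yields
the completeness of the search for live pairs. -/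
theorem Live.induction {X : Set (ℕ × ℕ)}
    (h0 : ∀ u : ℕ × ℕ, G.Acc u.1 → G.Acc u.2 → G.Fin2 u → u ∈ X)
    (h1 : ∀ j i u v, G.Letter j i → G.Step j i u v → v ∈ X → u ∈ X) {u : ℕ × ℕ}
    (hu : G.Live u) : u ∈ X := by
  obtain ⟨U, hU, hs⟩ := hu
  induction hU generalizing u with
  | base => exact h0 u hs.1.1 hs.2.1 ⟨hs.1.2, hs.2.2⟩
  | step j i hj hi hU ih =>
    obtain ⟨v, hv, hs'⟩ := (sub_pre_iff hj.1).1 hs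
    exact h1 j i u v ⟨hj, hi⟩ hv (ih hs')

theorem Equiv.symm {u v : ℕ × ℕ} (h : G.Equiv u v) : G.Equiv v u := fun U hU => (h U hU).symm
theorem Equiv.fin2 {u v : ℕ × ℕ} (h : G.Equiv u v) (hu : G.Live u) (h2 : G.Fin2 u) :
    G.Fin2 v := by
  have := (h _ .base).1 ⟨⟨hu.acc.1, h2.1⟩, ⟨hu.acc.2, h2.2⟩⟩
  exact ⟨this.1.2, this.2.2⟩

/-- Preceding a context by the letter `(j, i)` gives another context, so equivalence passes to
successors. Liveness of `w` provides one good set that forces a successor of `v` to exist. -/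
theorem Equiv.step {u v w : ℕ × ℕ} {j i : ℕ} (h : G.Equiv u v) (hl : G.Letter j i)
    (hs : G.Step j i u w) (hw : G.Live w) : ∃ z, G.Step j i v z ∧ G.Live z ∧ G.Equiv w z := by
  obtain ⟨U, hU, hwU⟩ := hw
  have key : ∀ U, G.Good U → (Sub w U ↔ ∃ z, G.Step j i v z ∧ Sub z U) := fun U hU => by
    rw [← sub_pre_iff hl.1.1, ← h _ (.step j i hl.1 hl.2 hU), sub_pre_iff hl.1.1]
    exact ⟨fun h => ⟨w, hs, h⟩, fun ⟨w', h1, h2⟩ => hs.unique h1 ▸ h2⟩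
  obtain ⟨z, hz, hzU⟩ := (key U hU).1 hwU
  refine ⟨z, hz, ⟨U, hU, hzU⟩, fun V hV => ?_⟩
  rw [key V hV]
  exact ⟨fun ⟨z', h1, h2⟩ => hz.unique h1 ▸ h2, fun h => ⟨z, hz, h⟩⟩

/-- The exchange property yields equations between pairs. -/
theorem Exchange.equiv (hE : G.Exchange) {j j' i : ℕ} (hj : G.Letter j i) (hj' : G.Valid j')
    (hs : G.sy j = G.sy j') (hl : G.Live (G.tg j, G.tg j')) :
    ∃ v : ℕ × ℕ, G.ap j i (G.ag j' i) = v.1 + 1 ∧ G.ap j' i (G.ag j i) = v.2 + 1 ∧ G.Live v ∧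
      G.Equiv (G.tg j, G.tg j') v := by
  have hi' : i < G.rk j' := by rw [← rk_eq hj.1.1 hj'.1 hs]; exact hj.2
  obtain ⟨U, hU, h1, h2⟩ := hl
  obtain ⟨k, hk, hkU⟩ := hE U hU j j' i hj.1 hj' hs h1 h2 hj.2
  obtain ⟨k', hk', hkU'⟩ := hE U hU j' j i hj' hj.1 hs.symm h2 h1 hi'
  refine ⟨(G.tg k, G.tg k'), ap_eq hj.1.1 hk, ap_eq hj'.1 hk', ⟨U, hU, hkU, hkU'⟩, fun V hV => ?_⟩
  constructor
  · rintro ⟨h3, h4⟩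
    obtain ⟨l, hl, hlV⟩ := hE V hV j j' i hj.1 hj' hs h3 h4 hj.2
    obtain ⟨l', hl', hlV'⟩ := hE V hV j' j i hj' hj.1 hs.symm h4 h3 hi'
    rw [hl.unique hj.1.1 hk] at hlV
    rw [hl'.unique hj'.1 hk'] at hlV'
    exact ⟨hlV, hlV'⟩
  · rintro ⟨h3, h4⟩
    have hss : G.sy k = G.sy k' := by rw [hk.2.1, hk'.2.1, hs]
    have e1 : G.ag k i = G.ag j' i := hk.2.2.1
    have e2 : G.ag k' i = G.ag j i := hk'.2.2.1
    have hik : i < G.rk k := by rw [hk.rk_eq hj.1.1]; exact hj.2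
    have hik' : i < G.rk k' := by rw [hk'.rk_eq hj'.1]; exact hi'
    -- Interchanging the i-th arguments of `k` and `k'` gives back `j` and `j'`, which is why the
    -- implication between the two pairs is an equivalence.
    obtain ⟨l, hl, hlV⟩ := hE V hV k k' i hk.1 hk'.1 hss h3 h4 hik
    obtain ⟨l', hl', hlV'⟩ := hE V hV k' k i hk'.1 hk.1 hss.symm h4 h3 hik'
    rw [e2, hk.congr hj.1.1] at hl
    rw [e1, hk'.congr hj'.1] at hl'
    rw [hl.unique hj.1.1 (Match.self hj.1 i)] at hlV
    rw [hl'.unique hj'.1 (Match.self hj' i)] at hlV'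
    exact ⟨hlV, hlV'⟩

/-- A bisimulation on pairs that relates the required pairs proves the exchange property. -/
theorem Exchange.of_bisim (K : ℕ × ℕ → ℕ × ℕ → Prop)
    (hlive : ∀ u v, K u v → G.Live u ∧ G.Live v)
    (hfin : ∀ u v, K u v → G.Fin2 u → G.Fin2 v)
    (hstep : ∀ u v, K u v → ∀ j i, G.Letter j i → ∀ w, G.Step j i u w → G.Live w →
      ∃ z, G.Step j i v z ∧ K w z)
    (hinit : ∀ j j' i, G.Letter j i → G.Valid j' → G.sy j = G.sy j' →
      G.Live (G.tg j, G.tg j') → ∃ v : ℕ × ℕ, G.ap j i (G.ag j' i) = v.1 + 1 ∧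
        K (G.tg j, G.tg j') v) : G.Exchange := by
  have key : ∀ U, G.Good U → ∀ u v, K u v → Sub u U → Sub v U := by
    intro U hU
    induction hU with
    | base =>
      intro u v h hs
      have := hfin u v h ⟨hs.1.2, hs.2.2⟩
      have ha := (hlive u v h).2.acc
      exact ⟨⟨ha.1, this.1⟩, ⟨ha.2, this.2⟩⟩
    | @step U j i hj hi hU ih =>
      intro u v h hs
      rw [sub_pre_iff hj.1] at hs ⊢
      obtain ⟨w, hw, hwU⟩ := hs
      obtain ⟨z, hz, hK⟩ := hstep u v h j i ⟨hj, hi⟩ w hw ⟨U, hU, hwU⟩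
      exact ⟨z, hz, ih w z hK hwU⟩
  intro U hU j j' i hj hj' hs h1 h2 hi
  obtain ⟨v, hv, hK⟩ := hinit j j' i ⟨hj, hi⟩ hj' hs ⟨U, hU, h1, h2⟩
  obtain ⟨k, hk, e⟩ := (ap_eq_succ_iff hj.1).1 hv
  exact ⟨k, hk, e ▸ (key U hU _ _ hK ⟨h1, h2⟩).1⟩

/-! ### Out-degrees -/

theorem liveOut_finite (u : ℕ × ℕ) : (G.liveOut u).Finite := by
  refine Set.Finite.subset (Set.Finite.biUnion (Set.finite_lt_nat G.R) fun j _ =>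
    (Set.finite_singleton j).prod (Set.finite_lt_nat (G.rk j))) ?_
  rintro ⟨j, i⟩ ⟨h, -⟩
  simp only [Set.mem_iUnion]
  exact ⟨j, h.1.1, rfl, h.2⟩

/-- Live successors of `u` lead to live successors of `v`. -/
def Half (G : Inst I) (u v : ℕ × ℕ) : Prop :=
  ∀ l ∈ G.liveOut u, ∃ z, G.Step l.1 l.2 v z ∧ G.Live z

/-- A context has several names `(j, i)`, one for each rule that matches it. In `liveOut u` the name
with argument `u.1` is used, and the map renames the same context by the rule with argument `v.1`.
-/
theorem Half.exists_map {u v : ℕ × ℕ} (h : G.Half u v) : ∃ f : ℕ × ℕ → ℕ × ℕ,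
    Set.MapsTo f (G.liveOut u) (G.liveOut v) ∧
      ∀ l ∈ G.liveOut u, (f l).2 = l.2 ∧ G.Match l.1 l.2 v.1 (f l).1 := by
  have : ∀ l, ∃ k, l ∈ G.liveOut u → G.Match l.1 l.2 v.1 k := fun l => by
    by_cases hl : l ∈ G.liveOut u
    · obtain ⟨z, hz, -⟩ := h l hl
      obtain ⟨k, hk, -⟩ := (ap_eq_succ_iff hl.1.1.1).1 hz.1
      exact ⟨k, fun _ => hk⟩
    · exact ⟨0, fun h => absurd h hl⟩
  choose f hf using this
  refine ⟨fun l => (f l, l.2), fun l hl => ?_, fun l hl => ⟨rfl, hf l hl⟩⟩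
  obtain ⟨z, hz, hzl⟩ := h l hl
  have hk := hf l hl
  exact ⟨hl.1.of_match hk, hk.2.2.1, z, (Step.congr hl.1.1.1 hk).2 hz, hzl⟩

/-- Renaming keeps the context, and the context together with the argument `u.1` determines the rule
it came from. -/
theorem Half.injOn {u v : ℕ × ℕ} {f : ℕ × ℕ → ℕ × ℕ}
    (hf : ∀ l ∈ G.liveOut u, (f l).2 = l.2 ∧ G.Match l.1 l.2 v.1 (f l).1) :
    Set.InjOn f (G.liveOut u) := by
  intro l hl l' hl' e
  have e2 : l.2 = l'.2 := by rw [← (hf l hl).1, ← (hf l' hl').1, e]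
  have h1 := (hf l hl).2
  have h2 := (hf l' hl').2
  rw [← e, ← e2] at h2
  have a1 := (h1.congr hl.1.1.1 (y := u.1) (l := l.1)).2
    ⟨hl.1.1, rfl, hl.2.1, fun _ _ _ => rfl⟩
  have a2 := (h2.congr hl'.1.1.1 (y := u.1) (l := l'.1)).2
    ⟨hl'.1.1, rfl, by rw [e2]; exact hl'.2.1, fun _ _ _ => rfl⟩
  exact Prod.ext (a1.unique (hl.1.of_match h1).1.1 a2) e2

theorem Half.ncard_le {u v : ℕ × ℕ} (h : G.Half u v) :
    (G.liveOut u).ncard ≤ (G.liveOut v).ncard := by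
  obtain ⟨f, hf, hf'⟩ := h.exists_map
  exact Set.ncard_le_ncard_of_injOn f hf (Half.injOn hf') (liveOut_finite v)

/-- An injection between finite sets of equal size is onto. Hence the algorithm can run through the
letters of `u` alone and compare degrees instead of running through those of `v`. -/
theorem Half.symm {u v : ℕ × ℕ} (h : G.Half u v)
    (he : (G.liveOut u).ncard = (G.liveOut v).ncard) : G.Half v u := by
  obtain ⟨f, hf, hf'⟩ := h.exists_map
  have hs : f '' G.liveOut u = G.liveOut v := by
    refine Set.eq_of_subset_of_ncard_le (Set.image_subset_iff.2 hf) ?_ (liveOut_finite v)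
    rw [(Half.injOn hf').ncard_image, he]
  intro l hl
  rw [← hs] at hl
  obtain ⟨l', hl', rfl⟩ := hl
  obtain ⟨e, hm⟩ := hf' l' hl'
  obtain ⟨w, hw, hwl⟩ := hl'.2.2
  exact ⟨w, by rw [e]; exact (Step.congr hl'.1.1.1 hm).2 hw, hwl⟩

theorem Equiv.half {u v : ℕ × ℕ} (h : G.Equiv u v) : G.Half u v := fun l hl => by
  obtain ⟨w, hw, hwl⟩ := hl.2.2
  obtain ⟨z, hz, hzl, -⟩ := h.step hl.1 hw hwl
  exact ⟨z, hz, hzl⟩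

theorem Equiv.ncard_eq {u v : ℕ × ℕ} (h : G.Equiv u v) :
    (G.liveOut u).ncard = (G.liveOut v).ncard :=
  le_antisymm h.half.ncard_le h.symm.half.ncard_le

/-- Every letter that takes `u` to a live pair can be given by a rule with argument `u.1`. -/
theorem Letter.exists_liveOut {j i : ℕ} (hl : G.Letter j i) {u w : ℕ × ℕ} (h : G.Step j i u w)
    (hw : G.Live w) : ∃ k, G.Match j i u.1 k ∧ (k, i) ∈ G.liveOut u := by
  obtain ⟨k, hk, -⟩ := (ap_eq_succ_iff hl.1.1).1 h.1
  exact ⟨k, hk, hl.of_match hk, hk.2.2.1, w, (Step.congr hl.1.1 hk).2 h, hw⟩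

/-! ### Congruence closure -/

/-- One direction of `Cl`. -/
def Cl1 (G : Inst I) (E : ℕ × ℕ → ℕ × ℕ → Prop) (u v : ℕ × ℕ) : Prop :=
  (G.Fin2 u → G.Fin2 v) ∧ ∀ j i, G.Letter j i → ∀ w, G.Step j i u w → G.Live w →
    ∃ z, G.Step j i v z ∧ G.Live z ∧ Relation.EqvGen E w z

/-- `u` and `v` are locally equivalent, and the equivalence generated by `E` relates their
successors. -/
def Cl (G : Inst I) (E : ℕ × ℕ → ℕ × ℕ → Prop) (u v : ℕ × ℕ) : Prop :=
  G.Cl1 E u v ∧ G.Cl1 E v u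

variable {E E' : ℕ × ℕ → ℕ × ℕ → Prop} {u v w : ℕ × ℕ}

theorem Cl1.mono (h : G.Cl1 E u v) (hE : ∀ u v, E u v → E' u v) : G.Cl1 E' u v :=
  ⟨h.1, fun j i hl w hw hwl => by
    obtain ⟨z, h1, h2, h3⟩ := h.2 j i hl w hw hwl
    exact ⟨z, h1, h2, h3.mono hE⟩⟩

theorem Cl.mono (h : G.Cl E u v) (hE : ∀ u v, E u v → E' u v) : G.Cl E' u v :=
  ⟨h.1.mono hE, h.2.mono hE⟩

theorem Cl1.trans (h : G.Cl1 E u v) (h' : G.Cl1 E v w) : G.Cl1 E u w :=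
  ⟨fun h1 => h'.1 (h.1 h1), fun j i hl x hx hxl => by
    obtain ⟨y, h1, h2, h3⟩ := h.2 j i hl x hx hxl
    obtain ⟨z, h4, h5, h6⟩ := h'.2 j i hl y h1 h2
    exact ⟨z, h4, h5, .trans _ _ _ h3 h6⟩⟩

theorem Cl.refl (u : ℕ × ℕ) : G.Cl E u u :=
  ⟨⟨id, fun _ _ _ w hw hwl => ⟨w, hw, hwl, .refl _⟩⟩, ⟨id, fun _ _ _ w hw hwl => ⟨w, hw, hwl, .refl _⟩⟩⟩

theorem Cl.symm (h : G.Cl E u v) : G.Cl E v u := ⟨h.2, h.1⟩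

theorem Cl.trans (h : G.Cl E u v) (h' : G.Cl E v w) : G.Cl E u w :=
  ⟨h.1.trans h'.1, h'.2.trans h.2⟩

/-- The local check on `u` and `v` that the algorithm performs. -/
theorem Cl.of_check (hf : G.Fin2 u ↔ G.Fin2 v)
    (he : (G.liveOut u).ncard = (G.liveOut v).ncard)
    (h : ∀ l ∈ G.liveOut u, ∃ w z, G.Step l.1 l.2 u w ∧ G.Step l.1 l.2 v z ∧ G.Live z ∧ E w z) :
    G.Cl E u v := by
  have hh : G.Half u v := fun l hl => by
    obtain ⟨w, z, -, h2, h3, -⟩ := h l hl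
    exact ⟨z, h2, h3⟩
  have h1 : ∀ j i, G.Letter j i → ∀ w, G.Step j i u w → G.Live w →
      ∃ z, G.Step j i v z ∧ G.Live z ∧ E w z := fun j i hl w hw hwl => by
    obtain ⟨k, hk, hko⟩ := hl.exists_liveOut hw hwl
    obtain ⟨w', z, a1, a2, a3, a4⟩ := h _ hko
    have a1' : G.Step j i u w' := (Step.congr hl.1.1 hk).1 a1
    rw [a1'.unique hw] at a4
    exact ⟨z, (Step.congr hl.1.1 hk).1 a2, a3, a4⟩
  refine ⟨⟨hf.1, fun j i hl w hw hwl => ?_⟩, ⟨hf.2, fun j i hl z hz hzl => ?_⟩⟩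
  · obtain ⟨z, a1, a2, a3⟩ := h1 j i hl w hw hwl
    exact ⟨z, a1, a2, .rel _ _ a3⟩
  · obtain ⟨k, hk, hko⟩ := hl.exists_liveOut hz hzl
    obtain ⟨w, a1, a2⟩ := hh.symm he _ hko
    have a1' : G.Step j i u w := (Step.congr hl.1.1 hk).1 a1
    obtain ⟨z', b1, b2, b3⟩ := h1 j i hl w a1' a2
    rw [b1.unique hz] at b3
    exact ⟨w, a1', a2, .symm _ _ (.rel _ _ b3)⟩

/-- If the queue `E` contains the required pairs and is contained in an equivalence relation on
live pairs that satisfies `Cl`, then the exchange property holds. -/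
theorem Exchange.of_closure (K : ℕ × ℕ → ℕ × ℕ → Prop) (hK : Equivalence K)
    (hlive : ∀ u v, E u v → G.Live u ∧ G.Live v)
    (hEK : ∀ u v, E u v → K u v) (hcl : ∀ u v, G.Live u → G.Live v → K u v → G.Cl E u v)
    (hinit : ∀ j j' i, G.Letter j i → G.Valid j' → G.sy j = G.sy j' →
      G.Live (G.tg j, G.tg j') → ∃ v : ℕ × ℕ, G.ap j i (G.ag j' i) = v.1 + 1 ∧
        E (G.tg j, G.tg j') v) : G.Exchange := by
  have hgen : ∀ u v, Relation.EqvGen E u v → K u v := fun u v h => by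
    induction h with
    | rel _ _ h => exact hEK _ _ h
    | refl x => exact hK.refl x
    | symm _ _ _ h => exact hK.symm h
    | trans _ _ _ _ _ h h' => exact hK.trans h h'
  refine Exchange.of_bisim (fun u v => G.Live u ∧ G.Live v ∧ K u v) (fun u v h => ⟨h.1, h.2.1⟩)
    (fun u v h => (hcl u v h.1 h.2.1 h.2.2).1.1) ?_ ?_
  · intro u v h j i hl w hw hwl
    obtain ⟨z, a1, a2, a3⟩ := (hcl u v h.1 h.2.1 h.2.2).1.2 j i hl w hw hwl
    exact ⟨z, a1, hwl, a2, hgen _ _ a3⟩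
  · intro j j' i hl hj' hs hu
    obtain ⟨v, h1, h2⟩ := hinit j j' i hl hj' hs hu
    exact ⟨v, h1, hu, (hlive _ _ h2).2, hEK _ _ h2⟩

end Inst

end TreeAut

namespace TreeAut

/-! ### Sizes in a description -/

namespace Inst

variable {I : List ℕ} (G : Inst I)

theorem inp_sy {j : ℕ} (hj : j < G.R) : inp I (G.st j) = G.sy j := G.rd_sy j hj
theorem inp_rk {j : ℕ} (hj : j < G.R) : inp I (2 + G.sy j) = G.rk j := G.rd_rk j hj
theorem inp_ag {j i : ℕ} (hj : j < G.R) (hi : i < G.rk j) :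
    inp I (G.st j + 1 + i) = G.ag j i := G.rd_ag j hj i hi
theorem inp_tg {j : ℕ} (hj : j < G.R) : inp I (G.st j + 1 + G.rk j) = G.tg j := G.rd_tg j hj
theorem inp_fn {q : ℕ} (hq : q < G.m) : inp I (2 + G.s + q) ≠ 0 ↔ G.fn q := G.rd_fn q hq
theorem inp_s : inp I 0 = G.s := G.rd_s
theorem inp_m : inp I 1 = G.m := G.rd_m
theorem inp_R : inp I (2 + G.s + G.m) = G.R := G.rd_R

theorem st_mono_add {j : ℕ} (hj : j ≤ G.R) : G.st 0 + 2 * j ≤ G.st j := by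
  induction j with
  | zero => simp
  | succ j ih => have := ih (by omega); rw [G.st_succ j (by omega)]; omega

theorem st_le {j k : ℕ} (hjk : j ≤ k) (hk : k ≤ G.R) : G.st j ≤ G.st k := by
  induction k, hjk using Nat.le_induction with
  | base => rfl
  | succ k _ ih => have := ih (by omega); rw [G.st_succ k (by omega)]; omega

theorem st_add_rk_le {j k : ℕ} (hjk : j < k) (hk : k ≤ G.R) : G.st j + G.rk j + 2 ≤ G.st k := by
  have := G.st_le (j := j + 1) hjk hk
  rw [G.st_succ j (by omega)] at this
  exact this

theorem st_add_rk_lt {j : ℕ} (hj : j < G.R) : G.st j + G.rk j + 2 ≤ I.length := by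
  rw [← G.st_R]; exact G.st_add_rk_le hj le_rfl

theorem size_le : 3 + G.s + G.m + 2 * G.R ≤ I.length := by
  rw [← G.st_R, ← G.st_zero]; exact G.st_mono_add le_rfl

end Inst

/-! ### Reading the description -/

open Cm Ex

/-- The start of a rule depends on the ranks of all earlier symbols, so the starts are found by one
pass and stored for random access. -/
def parseProg : Cm :=
  .s ::= rd (c 0) ;; .m ::= rd (c 1) ;; .R ::= rd (c 2 + v .s + v .m) ;;
  .B ::= v .s + v .m + c 2 ;; .L ::= v .s + v .m + c 3 ;;
  .for .r .R (put .st (v .r) (v .L) ;; .L ::= v .L + rd (c 2 + rd (v .L)) + c 2)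

/-- The state after reading the description. -/
structure Base {I : List ℕ} (G : Inst I) (σ : St) : Prop where
  s : σ.v .s = G.s
  m : σ.v .m = G.m
  R : σ.v .R = G.R
  B : σ.v .B = G.s + G.m + 2
  L : σ.v .L = I.length
  st : ∀ j < G.R, σ.a .st j = G.st j

theorem Base.frame {I : List ℕ} {G : Inst I} {σ σ' : St} {p : Cm} (h : Base G σ)
    (hf : Frame p σ σ') (hs : p.modV .s = false := by rfl) (hm : p.modV .m = false := by rfl)
    (hR : p.modV .R = false := by rfl) (hB : p.modV .B = false := by rfl)
    (hL : p.modV .L = false := by rfl) (hst : p.modA .st = false := by rfl) : Base G σ' :=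
  ⟨(hf.v _ hs).trans h.s, (hf.v _ hm).trans h.m, (hf.v _ hR).trans h.R, (hf.v _ hB).trans h.B,
    (hf.v _ hL).trans h.L, fun j hj => (congrFun (hf.a _ hst) j).trans (h.st j hj)⟩

variable {I : List ℕ} {G : Inst I}

theorem wp_parse (G : Inst I) (σ : St) :
    wp I parseProg (fun σ' => Base G σ' ∧ σ'.t ≤ σ.t + 10 * I.length) σ := by
  have hsz := G.size_le
  have h0 := G.inp_s; have h4 := G.inp_m; have h5 := G.inp_R
  unfold parseProg
  simp only [wp_seq, wp_set]
  refine wp_for (fun j σ' => σ'.v .L = G.st j ∧ (∀ l < j, σ'.a .st l = G.st l) ∧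
    σ'.t ≤ σ.t + 6 + 4 * j) rfl rfl ?_ ?_ ?_
  · simp [h0, h4, G.st_zero]
    omega
  · rintro j σ' hj hf hr ⟨h1, h2, h3⟩
    simp [h0, h4, h5] at hj
    simp [h1, hr, G.inp_sy hj, G.inp_rk hj, G.st_succ j hj]
    refine ⟨fun l hl => ?_, by omega⟩
    by_cases hlj : l = j
    · subst hlj; simp
    · simp [hlj, h2 l (by omega)]
  · rintro σ' hf hr ⟨h1, h2, h3⟩
    have g1 := hf.v .s rfl; have g2 := hf.v .m rfl; have g3 := hf.v .R rfl; have g4 := hf.v .B rfl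
    simp [h0, h4, h5] at g1 g2 g3 g4 h1 h2 h3
    rw [G.st_R] at h1
    exact ⟨⟨g1, g2, g3, g4, h1, h2⟩, by simp; omega⟩

/-! ### The table of multiples of powers -/

/-- Row `j` is filled by repeated addition of `w`, the `j`-th power of the base. After the last
entry, `x` is the base times `w`, which is the next power; no multiplication is needed. -/
def tableProg : Cm :=
  .w ::= c 1 ;; .row ::= c 0 ;;
  .for .j .L (.x ::= c 0 ;;
    .for .q .B (put .T (v .row + v .q) (v .x) ;; .x ::= v .x + v .w) ;;
    .w ::= v .x ;; .row ::= v .row + v .B)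

/-- The array `T` holds the multiples of the powers of the base. -/
def IsTable (G : Inst I) (σ : St) : Prop :=
  ∀ j < I.length, ∀ q < G.s + G.m + 2, σ.a .T (j * (G.s + G.m + 2) + q) = q * (G.s + G.m + 2) ^ j

theorem wp_table {σ : St} (hB : Base G σ) :
    wp I tableProg (fun σ' => IsTable G σ' ∧
      σ'.t ≤ σ.t + 10 + 10 * (I.length * I.length)) σ := by
  have hsz := G.size_le
  obtain ⟨B, hBdef⟩ : ∃ B, B = G.s + G.m + 2 := ⟨_, rfl⟩
  unfold tableProg IsTable
  rw [← hBdef]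
  simp only [wp_seq, wp_set]
  refine wp_for (fun j σ' => σ'.v .w = B ^ j ∧ σ'.v .row = j * B ∧
    (∀ j' < j, ∀ q < B, σ'.a .T (j' * B + q) = q * B ^ j') ∧
    σ'.t ≤ σ.t + 3 + (4 * B + 7) * j) rfl rfl ?_ ?_ ?_
  · simp
  · rintro j σ' hj hf hr ⟨h1, h2, h3, h4⟩
    have hvB : σ'.v .B = B := by
      rw [hf.v .B rfl]; simp [hB.B, hBdef]
    simp only [wp_seq, wp_set, Ex.eval_c]
    refine wp_for (fun q σ'' => σ''.v .x = q * B ^ j ∧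
      (∀ j' < j, ∀ q' < B, σ''.a .T (j' * B + q') = q' * B ^ j') ∧
      (∀ q' < q, σ''.a .T (j * B + q') = q' * B ^ j) ∧ σ''.t ≤ σ'.t + 3 + 4 * q) rfl rfl ?_ ?_ ?_
    · simp; exact h3
    · rintro q σ'' hq hf' hr' ⟨g1, g2, g3, g4⟩
      simp [hvB] at hq
      have hrow : σ''.v .row = j * B := by rw [hf'.v .row rfl]; simpa using h2
      have hw : σ''.v .w = B ^ j := by rw [hf'.v .w rfl]; simpa using h1
      simp [hrow, g1, hw, hr']
      refine ⟨by ring, fun j' hj' q' hq' => ?_, fun q' hq' => ?_, by omega⟩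
      · have : (j' + 1) * B ≤ j * B := Nat.mul_le_mul_right _ hj'
        have : j' * B + q' ≠ j * B + q := by rw [Nat.add_mul] at this; omega
        simp [this, g2 j' hj' q' hq']
      · by_cases hqq : q' = q
        · subst hqq; simp
        · have : j * B + q' ≠ j * B + q := by omega
          rw [Function.update_of_ne this]; exact g3 q' (by omega)
    · rintro σ'' hf' hr' ⟨g1, g2, g3, g4⟩
      have hvB1 : (σ'.tick.setV .x 0).v .B = B := by simp [hvB]
      rw [hvB1] at g1 g3 g4
      have hrow : σ''.v .row = j * B := by rw [hf'.v .row rfl]; simpa using h2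
      have hvB' : σ''.v .B = B := by rw [hf'.v .B rfl]; simpa using hvB
      simp [hrow, hvB', g1]
      intro _
      refine ⟨by ring, by ring, fun j' hj' q' hq' => ?_, by nlinarith⟩
      rcases Nat.lt_or_eq_of_le hj' with h | rfl
      · exact g2 j' h q' hq'
      · exact g3 q' hq'
  · rintro σ' hf hr ⟨h1, h2, h3, h4⟩
    simp [hB.L] at hr h3 h4
    refine ⟨by simpa using h3, ?_⟩
    have : B + 1 ≤ I.length := by omega
    simp
    nlinarith

/-! ### Accessible states -/

/-- Tests whether all arguments of rule number `r` are accessible. -/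
def checkProg : Cm :=
  .p ::= a .st (v .r) ;; .k ::= rd (c 2 + rd (v .p)) ;; .g ::= c 1 ;;
  .for .i .k (.ite (a .acc (rd (v .p + c 1 + v .i))) .skip (.g ::= c 0))

theorem wp_check {σ : St} (hB : Base G σ) {j : ℕ} (hj : j < G.R) (hr : σ.v .r = j) :
    wp I checkProg (fun σ' => σ'.v .p = G.st j ∧ σ'.v .k = G.rk j ∧
      (σ'.v .g ≠ 0 ↔ ∀ i < G.rk j, σ.a .acc (G.ag j i) ≠ 0) ∧
      σ'.t ≤ σ.t + 5 + 4 * G.rk j) σ := by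
  unfold checkProg
  simp only [wp_seq, wp_set]
  refine wp_for (fun i σ' => (σ'.v .g ≠ 0 ↔ ∀ l < i, σ.a .acc (G.ag j l) ≠ 0) ∧
      σ'.t ≤ σ.t + 4 + 4 * i) rfl rfl ?_ ?_ ?_
  · simp
  · rintro i σ' hi hf hi' ⟨h1, h2⟩
    simp [hr, hB.st j hj, G.inp_sy hj, G.inp_rk hj] at hi
    have hp : σ'.v .p = G.st j := by rw [hf.v .p rfl]; simp [hr, hB.st j hj]
    have hacc : σ'.a .acc = σ.a .acc := by rw [hf.a .acc rfl]; simp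
    simp only [wp_ite, wp_skip, wp_set]
    simp [hp, hi', hacc, G.inp_ag hj hi]
    constructor
    · intro h
      refine ⟨?_, by omega⟩
      rw [← not_iff_not] at h1
      simp at h1
      rw [← not_iff_not]
      simp [h1]
      constructor
      · rintro ⟨l, hl, e⟩; exact ⟨l, by omega, e⟩
      · rintro ⟨l, hl, e⟩
        refine ⟨l, ?_, e⟩
        rcases Nat.lt_or_eq_of_le hl with h' | rfl
        · exact h'
        · exact absurd e h
    · intro h
      exact ⟨⟨i, by omega, h⟩, by omega⟩
  · rintro σ' hf hi' ⟨h1, h2⟩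
    have hp : σ'.v .p = G.st j := by rw [hf.v .p rfl]; simp [hr, hB.st j hj]
    have hk : σ'.v .k = G.rk j := by
      rw [hf.v .k rfl]; simp [hr, hB.st j hj, G.inp_sy hj, G.inp_rk hj]
    simp [hr, hB.st j hj, G.inp_sy hj, G.inp_rk hj] at h1 h2
    exact ⟨hp, hk, by simpa using h1, by simp; omega⟩

def roundProg : Cm :=
  .for .r .R (checkProg ;; .ite (v .g) (put .acc (rd (v .p + c 1 + v .k)) (c 1)) .skip)

/-- Rule `j` costs at most five times its length `rk j + 2` in the description. In the invariant the
costs telescope through `st j`. -/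
theorem wp_round {σ : St} (hB : Base G σ) (hs : ∀ q, σ.a .acc q ≠ 0 → G.Acc q) :
    wp I roundProg (fun σ' => (∀ q, σ'.a .acc q ≠ 0 → G.Acc q) ∧
      (∀ q, σ.a .acc q ≠ 0 → σ'.a .acc q ≠ 0) ∧
      (∀ j < G.R, (∀ i < G.rk j, σ.a .acc (G.ag j i) ≠ 0) → σ'.a .acc (G.tg j) ≠ 0) ∧
      σ'.t ≤ σ.t + 5 * I.length) σ := by
  unfold roundProg
  refine wp_for (fun j σ' => (∀ q, σ'.a .acc q ≠ 0 → G.Acc q) ∧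
      (∀ q, σ.a .acc q ≠ 0 → σ'.a .acc q ≠ 0) ∧
      (∀ l < j, (∀ i < G.rk l, σ.a .acc (G.ag l i) ≠ 0) → σ'.a .acc (G.tg l) ≠ 0) ∧
      σ'.t + 5 * G.st 0 ≤ σ.t + 1 + 5 * G.st j) rfl rfl ?_ ?_ ?_
  · simpa using hs
  · rintro j σ' hj hf hr ⟨h1, h2, h3, h4⟩
    rw [hB.R] at hj
    have hB' : Base G σ'.tick := (hB.frame hf).frame (p := .skip) (Frame.refl _ _).tick
    rw [wp_seq]
    refine (wp_check hB' hj hr).mono fun σ₁ hf1 ⟨c1, c2, c3, c4⟩ => ?_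
    have hacc : σ₁.a .acc = σ'.a .acc := by rw [hf1.a .acc rfl]; rfl
    simp only [wp_ite, wp_skip, wp_put]
    simp only [Ex.eval_v, c3, St.tick_a]
    constructor
    · intro hg hr'
      have hA : G.Acc (G.tg j) := .intro j hj fun i hi => h1 _ (hg i hi)
      simp [c1, c2, G.inp_tg hj, hacc, Function.update_apply, G.st_succ j hj]
      refine ⟨fun q hq => ?_, fun q hq => ?_, fun l hl hi => ?_, by simp at c4; omega⟩
      · by_cases e : q = G.tg j
        · exact e ▸ hA
        · simp [e] at hq; exact h1 q hq
      · split_ifs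
        · simp
        · exact h2 q hq
      · by_cases e : l = j
        · simp [e]
        · split_ifs
          · simp
          · exact h3 l (by omega) hi
    · intro hg hr'
      simp [hacc, G.st_succ j hj]
      have hg' : ¬ (∀ i < G.rk j, σ'.a .acc (G.ag j i) ≠ 0) := fun h => (c3.2 h) hg
      refine ⟨h1, h2, fun l hl hi => ?_, by simp at c4; omega⟩
      by_cases e : l = j
      · subst e
        exact absurd (fun i hi' => h2 _ (hi i hi')) hg'
      · exact h3 l (by omega) hi
  · rintro σ' hf hr ⟨h1, h2, h3, h4⟩
    rw [hB.R] at h3 h4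
    rw [G.st_R] at h4
    have := G.st_zero
    exact ⟨h1, h2, h3, by simp; omega⟩

/-- A round that is not yet saturated marks a new state, so as many rounds as there are states
suffice. Since a round is linear, this is within the quadratic bound and no work list is needed. -/
def accProg : Cm := .for .j .m roundProg

def IsAcc (G : Inst I) (σ : St) : Prop := ∀ q, σ.a .acc q ≠ 0 ↔ G.Acc q

open Classical in
theorem wp_acc {σ : St} (hB : Base G σ) (hs : ∀ q, σ.a .acc q = 0) :
    wp I accProg (fun σ' => IsAcc G σ' ∧ σ'.t ≤ σ.t + 10 + 10 * (I.length * I.length)) σ := by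
  have hsz := G.size_le
  unfold accProg
  refine wp_for (fun n σ' => (∀ q, σ'.a .acc q ≠ 0 → G.Acc q) ∧
      ((∀ q, G.Acc q → σ'.a .acc q ≠ 0) ∨
        n ≤ ((Finset.range G.m).filter fun q => σ'.a .acc q ≠ 0).card) ∧
      σ'.t ≤ σ.t + 1 + (5 * I.length + 2) * n) rfl rfl ?_ ?_ ?_
  · simp [hs]
  · rintro n σ' hn hf hr ⟨h1, h2, h3⟩
    have hB' : Base G σ'.tick := (hB.frame hf).frame (p := .skip) (Frame.refl _ _).tick
    refine (wp_round hB' h1).mono fun σ₁ hf1 ⟨c1, c2, c3, c4⟩ _ => ?_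
    simp only [St.tick_a, St.tick_t, St.setV_a, St.setV_t] at c2 c3 c4 ⊢
    refine ⟨c1, ?_, by nlinarith⟩
    rcases h2 with h2 | h2
    · exact .inl fun q hq => c2 q (h2 q hq)
    · by_cases hcl : ∀ j < G.R, (∀ i < G.rk j, σ'.a .acc (G.ag j i) ≠ 0) → σ'.a .acc (G.tg j) ≠ 0
      · refine .inl fun q hq => c2 q ?_
        induction hq with
        | intro j hj h ih => exact hcl j hj ih
      · push Not at hcl
        obtain ⟨j, hj, hcl, hj0⟩ := hcl
        have hj1 := c3 j hj hcl
        refine .inr (Nat.lt_of_le_of_lt h2 (Finset.card_lt_card ?_))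
        refine (Finset.ssubset_iff_of_subset ?_).2 ⟨G.tg j, ?_, ?_⟩
        · exact fun q hq => Finset.mem_filter.2
            ⟨(Finset.mem_filter.1 hq).1, c2 q (Finset.mem_filter.1 hq).2⟩
        · exact Finset.mem_filter.2 ⟨Finset.mem_range.2 (G.tg_lt j hj), hj1⟩
        · exact fun h => (Finset.mem_filter.1 h).2 hj0
  · rintro σ' hf hr ⟨h1, h2, h3⟩
    rw [hB.m] at h2 h3
    refine ⟨fun q => ⟨h1 q, fun hq => ?_⟩, ?_⟩
    · rcases h2 with h2 | h2
      · exact h2 q hq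
      · have : ((Finset.range G.m).filter fun q => σ'.a .acc q ≠ 0) = Finset.range G.m :=
          Finset.eq_of_subset_of_card_le (Finset.filter_subset _ _) (by simpa using h2)
        have hm : q ∈ (Finset.range G.m).filter fun q => σ'.a .acc q ≠ 0 := by
          rw [this]; simpa using hq.lt
        exact (Finset.mem_filter.1 hm).2
    · simp; nlinarith

end TreeAut

namespace TreeAut

/-! ### Cells of an array as lists -/

/-- The contents of the `n` cells of the array `f` from `b` on. -/
def cells (f : ℕ → ℕ) (b n : ℕ) : List ℕ := (List.range n).map fun i => f (b + i)

@[simp] theorem length_cells (f : ℕ → ℕ) (b n : ℕ) : (cells f b n).length = n := by simp [cells]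
@[simp] theorem cells_zero (f : ℕ → ℕ) (b : ℕ) : cells f b 0 = [] := rfl

theorem cells_succ (f : ℕ → ℕ) (b n : ℕ) : cells f b (n + 1) = cells f b n ++ [f (b + n)] := by
  simp [cells, List.range_succ]

theorem cells_congr {f g : ℕ → ℕ} {b n : ℕ} (h : ∀ i < n, f (b + i) = g (b + i)) :
    cells f b n = cells g b n := by
  refine List.map_congr_left fun i hi => h i (List.mem_range.1 hi)

theorem cells_update_of_ne {f : ℕ → ℕ} {b n x y : ℕ} (h : ∀ i < n, b + i ≠ y) :
    cells (Function.update f y x) b n = cells f b n :=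
  cells_congr fun i hi => Function.update_of_ne (h i hi) _ _

theorem cells_update_end (f : ℕ → ℕ) (b n x : ℕ) :
    cells (Function.update f (b + n) x) b (n + 1) = cells f b n ++ [x] := by
  rw [cells_succ, cells_update_of_ne (by omega), Function.update_self]

theorem getElem_cells {f : ℕ → ℕ} {b n i : ℕ} (h : i < (cells f b n).length) :
    (cells f b n)[i] = f (b + i) := by simp [cells]

/-! ### Codes of left-hand sides -/

theorem digits_unique {B : ℕ} {N : ℕ} {f g : ℕ → ℕ} (hf : ∀ i < N, f i < B) (hg : ∀ i < N, g i < B)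
    (h : ∑ i ∈ Finset.range N, f i * B ^ i = ∑ i ∈ Finset.range N, g i * B ^ i) :
    ∀ i < N, f i = g i := by
  induction N generalizing f g with
  | zero => simp
  | succ N ih =>
    have key : ∀ f : ℕ → ℕ, ∑ i ∈ Finset.range (N + 1), f i * B ^ i =
        f 0 + B * ∑ i ∈ Finset.range N, f (i + 1) * B ^ i := fun f => by
      rw [Finset.sum_range_succ', Finset.mul_sum]
      simp only [pow_zero, mul_one, add_comm]
      congr 1
      exact Finset.sum_congr rfl fun i _ => by ring
    rw [key f, key g] at h
    have h0 : f 0 = g 0 := by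
      have := congrArg (· % B) h
      simpa [Nat.add_mul_mod_self_left, Nat.mod_eq_of_lt (hf 0 (by omega)),
        Nat.mod_eq_of_lt (hg 0 (by omega))] using this
    have hB : 0 < B := lt_of_le_of_lt (Nat.zero_le _) (hf 0 (by omega))
    rw [h0, Nat.add_left_cancel_iff] at h
    have := ih (f := fun i => f (i + 1)) (g := fun i => g (i + 1)) (fun i hi => hf _ (by omega))
      (fun i hi => hg _ (by omega)) (Nat.eq_of_mul_eq_mul_left hB h)
    intro i hi
    cases i with
    | zero => exact h0
    | succ i => exact this i (by omega)

namespace Inst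

variable {I : List ℕ} (G : Inst I)

/-- The base of the codes. -/
def base : ℕ := G.s + G.m + 2

/-- The digits of the code of the left-hand side of a rule. -/
def dg (j : ℕ) : ℕ → ℕ
  | 0 => G.sy j
  | i + 1 => if i < G.rk j then G.ag j i + 1 else 0

/-- The code of the left-hand side of rule `j`. -/
def code (j : ℕ) : ℕ := ∑ i ∈ Finset.range I.length, G.dg j i * G.base ^ i

/-- The code of the context of the `i`-th argument in rule `j`. -/
def kap (j i : ℕ) : ℕ := G.code j - (G.ag j i + 1) * G.base ^ (i + 1)

/-- The position of the `i`-th argument of rule `j` in the description. -/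
def pos (j i : ℕ) : ℕ := G.st j + 1 + i

variable {G}

theorem rk_succ_lt {j : ℕ} (hj : j < G.R) : G.rk j + 1 < I.length := by
  have := G.st_add_rk_lt hj
  have := G.st_le (Nat.zero_le j) hj.le
  have := G.st_zero
  omega

theorem dg_lt {j : ℕ} (hj : j < G.R) (i : ℕ) : G.dg j i < G.base := by
  unfold base
  cases i with
  | zero => have := G.sy_lt j hj; simp only [dg]; omega
  | succ i =>
    simp only [dg]
    split_ifs with h
    · have := G.ag_lt j hj i h; omega
    · omega

theorem sum_dg_eq_code {j n : ℕ} (hn : G.rk j + 1 ≤ n) (hn' : n ≤ I.length) :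
    ∑ i ∈ Finset.range n, G.dg j i * G.base ^ i = G.code j := by
  refine Finset.sum_subset (Finset.range_mono hn') fun i _ hi => ?_
  obtain ⟨i, rfl⟩ : ∃ i', i = i' + 1 := ⟨i - 1, by simp at hi; omega⟩
  have : ¬ i < G.rk j := by simp at hi; omega
  simp [dg, this]

/-- `kap` clears the digit of the i-th argument; adding `(x + 1) * base ^ (i + 1)` puts `x` there.
Thus the code of a left-hand side with one argument replaced costs a single addition. -/
theorem kap_add {j i : ℕ} (hj : j < G.R) (hi : i < G.rk j) (x : ℕ) :
    G.kap j i + (x + 1) * G.base ^ (i + 1) =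
      ∑ l ∈ Finset.range I.length, Function.update (G.dg j) (i + 1) (x + 1) l * G.base ^ l := by
  have hm : i + 1 ∈ Finset.range I.length := by
    have := rk_succ_lt hj
    simp; omega
  have h1 := Finset.add_sum_erase _ (fun l => G.dg j l * G.base ^ l) hm
  have h2 := Finset.add_sum_erase _
    (fun l => Function.update (G.dg j) (i + 1) (x + 1) l * G.base ^ l) hm
  have h3 : ∑ l ∈ (Finset.range I.length).erase (i + 1),
      Function.update (G.dg j) (i + 1) (x + 1) l * G.base ^ l =
        ∑ l ∈ (Finset.range I.length).erase (i + 1), G.dg j l * G.base ^ l := by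
    refine Finset.sum_congr rfl fun l hl => ?_
    rw [Function.update_of_ne (Finset.ne_of_mem_erase hl)]
  rw [h3] at h2
  simp only [Function.update_self] at h2
  have h4 : G.dg j (i + 1) = G.ag j i + 1 := by simp [dg, hi]
  simp only [h4] at h1
  rw [← h2, kap, code, ← h1]
  omega

/-- By uniqueness of digits: digit 0 gives the symbol and hence the rank, the other digits give the
arguments. So reading a table at this address finds the rule that matches a given context and
argument. -/
theorem code_eq_iff {j i j' x : ℕ} (hj : j < G.R) (hi : i < G.rk j) (hj' : j' < G.R)
    (hx : x < G.m) : G.code j' = G.kap j i + (x + 1) * G.base ^ (i + 1) ↔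
      G.sy j' = G.sy j ∧ G.ag j' i = x ∧ ∀ l < G.rk j, l ≠ i → G.ag j' l = G.ag j l := by
  have hr := rk_succ_lt hj
  rw [kap_add hj hi, code]
  constructor
  · intro h
    have hd := digits_unique (fun l _ => dg_lt hj' l) (fun l _ => by
      by_cases hl : l = i + 1
      · subst hl; simp [base]; omega
      · rw [Function.update_of_ne hl]; exact dg_lt hj l) h
    have hs : G.sy j' = G.sy j := by simpa [dg] using hd 0 (by omega)
    have hk := rk_eq hj' hj hs
    refine ⟨hs, ?_, fun l hl hli => ?_⟩
    · have := hd (i + 1) (by omega)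
      simpa [dg, hk, hi] using this
    · have := hd (l + 1) (by omega)
      simpa [dg, hk, hl, hli] using this
  · rintro ⟨h1, h2, h3⟩
    have hk := rk_eq hj' hj h1
    refine Finset.sum_congr rfl fun l _ => ?_
    congr 1
    cases l with
    | zero => simpa [dg] using h1
    | succ l =>
      by_cases hli : l = i
      · subst hli; simp [dg, hk, hi, h2]
      · have : l + 1 ≠ i + 1 := by omega
        rw [Function.update_of_ne this]
        simp only [dg, hk]
        split_ifs with hl
        · rw [h3 l hl hli]
        · rfl

theorem code_inj {j j' : ℕ} (hj : j < G.R) (hj' : j' < G.R) (h : G.code j = G.code j') :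
    j = j' := by
  have hr := rk_succ_lt hj
  have hd := digits_unique (fun l _ => dg_lt hj l) (fun l _ => dg_lt hj' l) h
  have hs : G.sy j = G.sy j' := by simpa [dg] using hd 0 (by omega)
  refine G.det j hj j' hj' hs fun i hi => ?_
  have := hd (i + 1) (by omega)
  simpa [dg, hi, ← rk_eq hj hj' hs] using this

theorem pos_inj {j i j' i' : ℕ} (hj : j < G.R) (hi : i < G.rk j) (hj' : j' < G.R)
    (hi' : i' < G.rk j') (h : G.pos j i = G.pos j' i') : j = j' ∧ i = i' := by
  unfold pos at h
  rcases lt_trichotomy j j' with hlt | rfl | hlt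
  · have := G.st_add_rk_le hlt hj'.le; omega
  · exact ⟨rfl, by omega⟩
  · have := G.st_add_rk_le hlt hj.le; omega

/-! ### Argument positions of valid rules -/

variable (G)

open Classical in
/-- The letters of the rules below `n`. -/
noncomputable def letters (n : ℕ) : List (ℕ × ℕ) :=
  (List.range n).flatMap fun j => if G.Valid j then (List.range (G.rk j)).map fun i => (j, i) else []

open Classical in
theorem letters_succ (n : ℕ) : G.letters (n + 1) = G.letters n ++
    if G.Valid n then (List.range (G.rk n)).map fun i => (n, i) else [] := by
  simp [letters, List.range_succ]

variable {G}

theorem mem_letters {n : ℕ} {l : ℕ × ℕ} : l ∈ G.letters n ↔ l.1 < n ∧ G.Letter l.1 l.2 := by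
  simp only [letters, List.mem_flatMap, List.mem_range]
  constructor
  · rintro ⟨j, hj, h⟩
    split_ifs at h with hv
    · obtain ⟨i, hi, rfl⟩ := List.mem_map.1 h
      exact ⟨hj, hv, List.mem_range.1 hi⟩
    · simp at h
  · rintro ⟨h1, h2⟩
    refine ⟨l.1, h1, ?_⟩
    rw [if_pos h2.1]
    exact List.mem_map.2 ⟨l.2, List.mem_range.2 h2.2, rfl⟩

theorem nodup_letters (n : ℕ) : (G.letters n).Nodup := by
  induction n with
  | zero => simp [letters]
  | succ n ih =>
    rw [letters_succ]
    split_ifs with hv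
    · refine ih.append (List.nodup_range.map fun i i' h => by simpa using h) ?_
      intro l hl hl'
      obtain ⟨i, -, rfl⟩ := List.mem_map.1 hl'
      have := (mem_letters.1 hl).1
      simp at this
    · simpa using ih

theorem length_letters {n : ℕ} (hn : n ≤ G.R) : (G.letters n).length + G.st 0 ≤ G.st n := by
  induction n with
  | zero => simp [letters]
  | succ n ih =>
    have := ih (by omega)
    rw [letters_succ, List.length_append, G.st_succ n (by omega)]
    split_ifs
    · simp; omega
    · simp; omega

theorem length_letters_lt : (G.letters G.R).length < I.length := by
  have := length_letters (G := G) le_rfl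
  rw [G.st_R] at this
  have := G.st_zero
  omega

end Inst

/-! ### The table of rules -/

open Cm Ex

variable {I : List ℕ} {G : Inst I}

theorem Base.B' {σ : St} (h : Base G σ) : σ.v .B = G.base := h.B

theorem IsTable.eq {σ : St} (h : IsTable G σ) {j q : ℕ} (hj : j < I.length) (hq : q < G.base) :
    σ.a .T (j * G.base + q) = q * G.base ^ j := h j hj q hq

/-- Computes the code of rule number `r`. -/
def codeProg : Cm :=
  .x ::= a .T (rd (v .p)) ;; .row ::= v .B ;;
  .for .i .k (.x ::= v .x + a .T (v .row + rd (v .p + c 1 + v .i) + c 1) ;; .row ::= v .row + v .B)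

theorem wp_code {σ : St} (hB : Base G σ) (hT : IsTable G σ) {j : ℕ} (hj : j < G.R)
    (hp : σ.v .p = G.st j) (hk : σ.v .k = G.rk j) :
    wp I codeProg (fun σ' => σ'.v .x = G.code j ∧ σ'.t ≤ σ.t + 4 + 4 * G.rk j) σ := by
  have hr := Inst.rk_succ_lt hj
  unfold codeProg
  simp only [wp_seq, wp_set]
  refine wp_for (fun i σ' => σ'.v .x = ∑ l ∈ Finset.range (i + 1), G.dg j l * G.base ^ l ∧
    σ'.v .row = (i + 1) * G.base ∧ σ'.t ≤ σ.t + 3 + 4 * i) rfl rfl ?_ ?_ ?_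
  · have h0 := hT.eq (j := 0) (q := G.sy j) (by omega) (Inst.dg_lt hj 0)
    simp at h0
    simp [hp, G.inp_sy hj, h0, hB.B', Inst.dg]
  · rintro i σ' hi hf hi' ⟨h1, h2, h3⟩
    simp [hk] at hi
    have hp' : σ'.v .p = G.st j := by rw [hf.v .p rfl]; simpa using hp
    have hB' : σ'.v .B = G.base := by rw [hf.v .B rfl]; simpa using hB.B'
    have hT' : σ'.a .T = σ.a .T := by rw [hf.a .T rfl]; simp
    have h0 := hT.eq (j := i + 1) (q := G.dg j (i + 1)) (by omega) (Inst.dg_lt hj _)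
    have hdg : G.dg j (i + 1) = G.ag j i + 1 := by simp [Inst.dg, hi]
    have e : (i + 1) * G.base + G.ag j i + 1 = (i + 1) * G.base + G.dg j (i + 1) := by omega
    simp [hp', hi', G.inp_ag hj hi, h2, hB', hT', h1, e, h0]
    refine ⟨?_, by ring, by omega⟩
    rw [Finset.sum_range_succ _ (i + 1)]
  · rintro σ' hf hi' ⟨h1, h2, h3⟩
    simp [hk] at h1 h3
    rw [Inst.sum_dg_eq_code le_rfl hr.le] at h1
    exact ⟨h1, by simp; omega⟩

/-- Stores the data of the argument positions of rule number `r`. -/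
def posProg : Cm :=
  .row ::= v .B ;;
  .for .i .k (.q ::= v .p + c 1 + v .i ;; put .kap (v .q) (v .x - a .T (v .row + rd (v .q) + c 1)) ;;
    put .crow (v .q) (v .row + c 1) ;; put .tgt (v .q) (rd (v .p + c 1 + v .k)) ;;
    put .PL (v .np) (v .q) ;; .np ::= v .np + c 1 ;; .row ::= v .row + v .B)

/-- The data of the argument position `(j, i)` are stored. -/
def PosOK (G : Inst I) (σ : St) (j i : ℕ) : Prop :=
  σ.a .kap (G.pos j i) = G.kap j i ∧ σ.a .crow (G.pos j i) = (i + 1) * G.base + 1 ∧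
    σ.a .tgt (G.pos j i) = G.tg j

theorem wp_pos {σ : St} (hB : Base G σ) (hT : IsTable G σ) {j : ℕ} (hj : j < G.R)
    (hp : σ.v .p = G.st j) (hk : σ.v .k = G.rk j) (hx : σ.v .x = G.code j) :
    wp I posProg (fun σ' => cells (σ'.a .PL) 0 (σ'.v .np) =
        cells (σ.a .PL) 0 (σ.v .np) ++ (List.range (G.rk j)).map (G.pos j) ∧
      (∀ i < G.rk j, PosOK G σ' j i) ∧
      (∀ j' < G.R, j' ≠ j → ∀ i < G.rk j', PosOK G σ j' i → PosOK G σ' j' i) ∧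
      σ'.t ≤ σ.t + 3 + 9 * G.rk j) σ := by
  have hr := Inst.rk_succ_lt hj
  unfold posProg
  simp only [wp_seq, wp_set]
  refine wp_for (fun i σ' => cells (σ'.a .PL) 0 (σ'.v .np) =
        cells (σ.a .PL) 0 (σ.v .np) ++ (List.range i).map (G.pos j) ∧
      σ'.v .row = (i + 1) * G.base ∧
      (∀ l < i, PosOK G σ' j l) ∧
      (∀ j' < G.R, j' ≠ j → ∀ l < G.rk j', PosOK G σ j' l → PosOK G σ' j' l) ∧
      σ'.t ≤ σ.t + 2 + 9 * i) rfl rfl ?_ ?_ ?_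
  · simp [hB.B']
    exact fun _ _ _ _ _ h => h
  · rintro i σ' hi hf hi' ⟨h1, h2, h3, h4, h5⟩
    simp [hk] at hi
    have hp' : σ'.v .p = G.st j := by rw [hf.v .p rfl]; simpa using hp
    have hk' : σ'.v .k = G.rk j := by rw [hf.v .k rfl]; simpa using hk
    have hx' : σ'.v .x = G.code j := by rw [hf.v .x rfl]; simpa using hx
    have hB' : σ'.v .B = G.base := by rw [hf.v .B rfl]; simpa using hB.B'
    have hT' : σ'.a .T = σ.a .T := by rw [hf.a .T rfl]; simp
    have h0 := hT.eq (j := i + 1) (q := G.dg j (i + 1)) (by omega) (Inst.dg_lt hj _)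
    have hdg : G.dg j (i + 1) = G.ag j i + 1 := by simp [Inst.dg, hi]
    have e : (i + 1) * G.base + G.ag j i + 1 = (i + 1) * G.base + (G.ag j i + 1) := by omega
    rw [hdg] at h0
    have e1 : G.st j + 1 + i = G.pos j i := rfl
    have e2 := G.inp_ag hj hi
    rw [e1] at e2
    simp [hp', hi', e1, e2, h2, hB', hT', hx', e, h0, hk', G.inp_tg hj, hdg, PosOK]
    refine ⟨?_, by ring, fun l hl => ?_, fun j' hj' hjj l hl p1 p2 p3 => ?_, by omega⟩
    · have := cells_update_end (σ'.a .PL) 0 (σ'.v .np) (G.pos j i)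
      rw [zero_add] at this
      rw [this, h1, List.range_succ]
      simp
    · by_cases hli : l = i
      · subst hli; simp [Inst.kap]
      · have : G.pos j l ≠ G.pos j i := by unfold Inst.pos; omega
        simp only [Function.update_of_ne this]
        exact h3 l (by omega)
    · have : G.pos j' l ≠ G.pos j i := fun h => hjj (Inst.pos_inj hj' hl hj hi h).1
      simp only [Function.update_of_ne this]
      exact h4 j' hj' hjj l hl ⟨p1, p2, p3⟩
  · rintro σ' hf hi' ⟨h1, h2, h3, h4, h5⟩
    simp [hk] at h1 h3 h5
    exact ⟨by simpa using h1, h3, h4, by simp; omega⟩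

/-- The target is stored increased by one at the address given by the code, so that 0 means that
there is no rule; this relies on memory that is initially zero. Only rules with accessible arguments
are entered, as in `Match`. -/
def dtabProg : Cm :=
  .np ::= c 0 ;;
  .for .r .R (checkProg ;; put .val (v .r) (v .g) ;;
    .ite (v .g) (codeProg ;; put .D (v .x) (rd (v .p + c 1 + v .k) + c 1) ;; posProg) .skip)

/-- The tables that the rest of the algorithm uses. -/
structure Tab (G : Inst I) (σ : St) : Prop where
  base : Base G σ
  acc : IsAcc G σ
  val : ∀ j < G.R, (σ.a .val j ≠ 0 ↔ G.Valid j)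
  PL : cells (σ.a .PL) 0 (σ.v .np) = (G.letters G.R).map fun l => G.pos l.1 l.2
  tgt : ∀ j i, G.Letter j i → σ.a .tgt (G.pos j i) = G.tg j
  look : ∀ j i, G.Letter j i → ∀ x < G.m,
    σ.a .D (σ.a .kap (G.pos j i) + σ.a .T (σ.a .crow (G.pos j i) + x)) = G.ap j i x

theorem Tab.frame {σ σ' : St} {p : Cm} (h : Tab G σ) (hf : Frame p σ σ')
    (hs : p.modV .s = false := by rfl) (hm : p.modV .m = false := by rfl)
    (hR : p.modV .R = false := by rfl) (hB : p.modV .B = false := by rfl)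
    (hL : p.modV .L = false := by rfl) (hst : p.modA .st = false := by rfl)
    (hnp : p.modV .np = false := by rfl)
    (hacc : p.modA .acc = false := by rfl) (hval : p.modA .val = false := by rfl)
    (hPL : p.modA .PL = false := by rfl) (htgt : p.modA .tgt = false := by rfl)
    (hD : p.modA .D = false := by rfl) (hkap : p.modA .kap = false := by rfl)
    (hT : p.modA .T = false := by rfl) (hcrow : p.modA .crow = false := by rfl) : Tab G σ' := by
  refine ⟨h.base.frame hf hs hm hR hB hL hst, ?_, ?_, ?_, ?_, ?_⟩
  · intro q; rw [hf.a _ hacc]; exact h.acc q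
  · intro q; rw [hf.a _ hval]; exact h.val q
  · rw [hf.a _ hPL, hf.v _ hnp]; exact h.PL
  · rw [hf.a _ htgt]; exact h.tgt
  · rw [hf.a _ hD, hf.a _ hkap, hf.a _ hT, hf.a _ hcrow]; exact h.look

theorem wp_dtab {σ : St} (hB : Base G σ) (hT : IsTable G σ) (hA : IsAcc G σ)
    (hD : ∀ x, σ.a .D x = 0) :
    wp I dtabProg (fun σ' => Tab G σ' ∧ σ'.t ≤ σ.t + 20 * I.length) σ := by
  unfold dtabProg
  simp only [wp_seq, wp_set, Ex.eval_c]
  refine wp_for (fun n σ' => (∀ l < n, (σ'.a .val l ≠ 0 ↔ G.Valid l)) ∧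
    cells (σ'.a .PL) 0 (σ'.v .np) = (G.letters n).map (fun l => G.pos l.1 l.2) ∧
    (∀ j < n, ∀ i < G.rk j, G.Valid j → PosOK G σ' j i) ∧
    (∀ j < n, G.Valid j → σ'.a .D (G.code j) = G.tg j + 1) ∧
    -- This clause is needed for lookups that should fail: a nonzero entry always comes from a valid
    -- rule, which then matches the context.
    (∀ x, σ'.a .D x ≠ 0 → ∃ j, G.Valid j ∧ G.code j = x) ∧
    σ'.t + 20 * G.st 0 ≤ σ.t + 2 + 20 * G.st n) rfl rfl ?_ ?_ ?_
  · simp [hD, Inst.letters]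
  · rintro j σ' hj hf hr ⟨h1, h2, h3, h4, h5, h6⟩
    simp [hB.R] at hj
    have hB' : Base G σ'.tick := ((hB.frame (p := .np ::= c 0) (by
      exact ⟨fun x hx => by simp [modV] at hx; simp [hx], fun _ _ => rfl⟩)).frame hf).frame
        (p := .skip) (Frame.refl _ _).tick
    have hT' : IsTable G σ'.tick := by
      intro a ha b hb; simp only [St.tick_a]; rw [hf.a .T rfl]; exact hT a ha b hb
    have hA' : IsAcc G σ'.tick := by
      intro q; simp only [St.tick_a]; rw [hf.a .acc rfl]; exact hA q
    rw [wp_seq]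
    refine (wp_check hB' hj hr).mono fun σ₁ hf1 ⟨c1, c2, c3, c4⟩ => ?_
    have hr1 : σ₁.v .r = j := by rw [hf1.v .r rfl]; exact hr
    have c3' : σ₁.v .g ≠ 0 ↔ G.Valid j := by
      rw [c3]
      exact ⟨fun h => ⟨hj, fun i hi => (hA' _).1 (h i hi)⟩, fun h i hi => (hA' _).2 (h.2 i hi)⟩
    simp only [wp_put, wp_ite, wp_seq, wp_skip, Ex.eval_v, hr1]
    simp only [St.setA_v]
    have hB1 := hB'.frame hf1
    have hT1 : IsTable G σ₁ := by
      intro a ha b hb; rw [hf1.a .T rfl]; exact hT' a ha b hb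
    have fr : Frame (put .val (v .r) (v .g)) σ₁ (σ₁.setA .val j (σ₁.v .g)).tick := by
      refine ⟨fun _ _ => rfl, fun b hb => ?_⟩
      simp [modA] at hb
      simp [hb]
    have hval : ∀ l < j + 1, (Function.update (σ₁.a .val) j (σ₁.v .g) l ≠ 0 ↔ G.Valid l) := by
      intro l hl
      by_cases hlj : l = j
      · subst hlj; simpa using c3'
      · rw [Function.update_of_ne hlj, hf1.a .val rfl]; exact h1 l (by omega)
    constructor
    · intro hg
      have hv := c3'.1 hg
      refine (wp_code (hB1.frame fr) (by
        intro a ha b hb; rw [fr.a .T rfl]; exact hT1 a ha b hb) hj (by simpa using c1)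
        (by simpa using c2)).mono fun σ₂ hf2 ⟨d1, d2⟩ => ?_
      have hB2 := (hB1.frame fr).frame hf2
      have fr2 : Frame (put .D (v .x) (rd (v .p + c 1 + v .k) + c 1)) σ₂
          (σ₂.setA .D (σ₂.v .x) (inp I (σ₂.v .p + 1 + σ₂.v .k) + 1)) := by
        refine ⟨fun _ _ => rfl, fun b hb => ?_⟩
        simp [modA] at hb
        simp [hb]
      have hp2 : σ₂.v .p = G.st j := by rw [hf2.v .p rfl]; simpa using c1
      have hk2 : σ₂.v .k = G.rk j := by rw [hf2.v .k rfl]; simpa using c2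
      rw [wp_seq, wp_put]
      refine (wp_pos (hB2.frame fr2) (by
        intro a ha b hb; rw [fr2.a .T rfl, hf2.a .T rfl, fr.a .T rfl]; exact hT1 a ha b hb) hj
        (by simpa using hp2) (by simpa using hk2) (by simpa using d1)).mono
        fun σ₃ hf3 ⟨e1, e2, e3, e4⟩ => ?_
      intro hr3
      have hD3 : σ₃.a .D = Function.update (σ'.a .D) (G.code j) (G.tg j + 1) := by
        rw [hf3.a .D rfl]
        simp [d1, hp2, hk2, G.inp_tg hj]
        rw [hf2.a .D rfl]; simp; rw [hf1.a .D rfl]; simp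
      have hval3 : σ₃.a .val = Function.update (σ₁.a .val) j (σ₁.v .g) := by
        rw [hf3.a .val rfl, fr2.a .val rfl, hf2.a .val rfl]; simp
      have hPO : ∀ j' i, PosOK G σ' j' i → PosOK G
          (σ₂.setA .D (σ₂.v .x) (inp I (σ₂.v .p + 1 + σ₂.v .k) + 1)) j' i := by
        intro j' i h
        unfold PosOK
        rw [fr2.a .kap rfl, fr2.a .crow rfl, fr2.a .tgt rfl, hf2.a .kap rfl, hf2.a .crow rfl,
          hf2.a .tgt rfl, fr.a .kap rfl, fr.a .crow rfl, fr.a .tgt rfl, hf1.a .kap rfl,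
          hf1.a .crow rfl, hf1.a .tgt rfl]
        exact h
      have hPL : cells ((σ₂.setA .D (σ₂.v .x) (inp I (σ₂.v .p + 1 + σ₂.v .k) + 1)).a .PL) 0
          ((σ₂.setA .D (σ₂.v .x) (inp I (σ₂.v .p + 1 + σ₂.v .k) + 1)).v .np) =
          cells (σ'.a .PL) 0 (σ'.v .np) := by
        rw [fr2.a .PL rfl, hf2.a .PL rfl, fr.a .PL rfl, hf1.a .PL rfl, fr2.v .np rfl,
          hf2.v .np rfl, fr.v .np rfl, hf1.v .np rfl]
        rfl
      rw [hPL] at e1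
      simp only [St.setV_a, St.setV_v, St.setV_t, hval3, hD3, reduceCtorEq, if_false]
      refine ⟨hval, ?_, fun l hl i hi hlv => ?_, fun l hl hlv => ?_, fun x hx => ?_, ?_⟩
      · rw [e1, h2, Inst.letters_succ, if_pos hv]
        simp
      · by_cases hlj : l = j
        · subst hlj; exact e2 i hi
        · exact e3 l hlv.1 hlj i hi (hPO l i (h3 l (by omega) i hi hlv))
      · by_cases hlj : l = j
        · subst hlj; simp
        · rw [Function.update_of_ne fun h => hlj (Inst.code_inj hlv.1 hj h)]
          exact h4 l (by omega) hlv
      · by_cases hxj : x = G.code j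
        · exact ⟨j, hv, hxj.symm⟩
        · rw [Function.update_of_ne hxj] at hx
          exact h5 x hx
      · simp at d2 c4 e4
        rw [G.st_succ j hj]
        omega
    · intro hg
      have hv : ¬ G.Valid j := fun h => (c3'.2 h) hg
      intro hr3
      simp only [St.setV_a, St.setV_v, St.setV_t, St.tick_a, St.tick_v, St.tick_t, St.setA_v,
        St.setA_a, St.setA_t, reduceCtorEq, if_false, if_true]
      have q1 : σ₁.a .PL = σ'.a .PL := hf1.a .PL rfl
      have q2 : σ₁.v .np = σ'.v .np := hf1.v .np rfl
      have q3 : σ₁.a .D = σ'.a .D := hf1.a .D rfl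
      have q4 : σ₁.a .kap = σ'.a .kap := hf1.a .kap rfl
      have q5 : σ₁.a .crow = σ'.a .crow := hf1.a .crow rfl
      have q6 : σ₁.a .tgt = σ'.a .tgt := hf1.a .tgt rfl
      rw [q1, q2, q3]
      refine ⟨hval, ?_, fun l hl i hi hlv => ?_, fun l hl hlv => ?_, h5, ?_⟩
      · rw [h2, Inst.letters_succ, if_neg hv]; simp
      · have hlj : l ≠ j := by rintro rfl; exact hv hlv
        simp [PosOK, q4, q5, q6]
        exact h3 l (by omega) i hi hlv
      · have hlj : l ≠ j := by rintro rfl; exact hv hlv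
        exact h4 l (by omega) hlv
      · simp at c4
        rw [G.st_succ j hj]
        omega
  · rintro σ' hf hr ⟨h1, h2, h3, h4, h5, h6⟩
    simp [hB.R] at h1 h2 h3 h4 h5 h6
    have hz := G.st_zero
    rw [G.st_R] at h6
    refine ⟨⟨?_, ?_, by simpa using h1, by simpa using h2, fun j i hl => ?_,
      fun j i hl x hx => ?_⟩, by simp; omega⟩
    · exact ((hB.frame (p := .np ::= c 0) (by
        exact ⟨fun x hx => by simp [modV] at hx; simp [hx], fun _ _ => rfl⟩)).frame hf).frame
          (p := .skip) (Frame.refl _ _).tick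
    · intro q; simp only [St.tick_a]; rw [hf.a .acc rfl]; exact hA q
    · exact (h3 j hl.1.1 i hl.2 hl.1).2.2
    · have hr := Inst.rk_succ_lt hl.1.1
      have hi := hl.2
      obtain ⟨k1, k2, -⟩ := h3 j hl.1.1 i hl.2 hl.1
      have hT' : σ'.a .T = σ.a .T := by rw [hf.a .T rfl]; simp
      have h0 := hT.eq (j := i + 1) (q := x + 1) (by omega) (by unfold Inst.base; omega)
      have e : (i + 1) * G.base + 1 + x = (i + 1) * G.base + (x + 1) := by ring
      simp only [St.tick_a]
      rw [k1, k2, hT', e, h0]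
      by_cases hm : ∃ k, G.Match j i x k
      · obtain ⟨k, hk⟩ := hm
        rw [Inst.ap_eq hl.1.1 hk, ← (Inst.code_eq_iff hl.1.1 hl.2 hk.1.1 hx).2 hk.2,
          h4 k hk.1.1 hk.1]
      · by_contra hne
        have hap : G.ap j i x = 0 := by rw [Inst.ap, dif_neg hm]
        rw [hap] at hne
        obtain ⟨k, hk, e⟩ := h5 _ hne
        exact hm ⟨k, hk, (Inst.code_eq_iff hl.1.1 hl.2 hk.1 hx).1 e⟩

end TreeAut

namespace TreeAut

open Cm Ex

/-! ### Numbers of pairs -/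

namespace Inst

variable {I : List ℕ} (G : Inst I)

/-- The number of a pair of states. The numbers are so far apart that data about the pairs can be
stored in lists that start there. -/
def nid (u : ℕ × ℕ) : ℕ := u.1 * (G.m * (I.length * I.length)) + u.2 * (I.length * I.length)

/-- Pairs of states. -/
def Nd (u : ℕ × ℕ) : Prop := u.1 < G.m ∧ u.2 < G.m

/-- The position of a pair in lexicographic order. -/
def idx (u : ℕ × ℕ) : ℕ := u.1 * G.m + u.2

variable {G}

theorem idx_inj {u v : ℕ × ℕ} (hu : G.Nd u) (hv : G.Nd v) (h : G.idx u = G.idx v) : u = v := by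
  have h0 : 0 < G.m := by have := hu.1; omega
  have key : ∀ u : ℕ × ℕ, G.Nd u → G.idx u / G.m = u.1 ∧ G.idx u % G.m = u.2 := fun u hu => by
    unfold idx
    rw [mul_comm, Nat.mul_add_div h0, Nat.mul_add_mod, Nat.mod_eq_of_lt hu.2, Nat.div_eq_of_lt hu.2]
    simp
  exact Prod.ext (by rw [← (key u hu).1, h, (key v hv).1]) (by rw [← (key u hu).2, h, (key v hv).2])

theorem nid_eq (u : ℕ × ℕ) : G.nid u = (I.length * I.length) * G.idx u := by
  unfold nid idx; ring

/-- Numbers of distinct pairs differ by multiples of the squared input length, so lists shorter than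
this square that start there do not overlap. -/
theorem nid_add_inj {u v : ℕ × ℕ} (hu : G.Nd u) (hv : G.Nd v) {i j : ℕ}
    (hi : i < I.length * I.length) (hj : j < I.length * I.length) (h : G.nid u + i = G.nid v + j) :
    u = v ∧ i = j := by
  rw [nid_eq, nid_eq] at h
  have h0 : 0 < I.length * I.length := by omega
  have h1 := congrArg (· / (I.length * I.length)) h
  simp only [Nat.mul_add_div h0, Nat.div_eq_of_lt hi, Nat.div_eq_of_lt hj, add_zero] at h1
  have := idx_inj hu hv h1
  subst this
  exact ⟨rfl, by omega⟩

theorem sq_pos (G : Inst I) : 0 < I.length * I.length := by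
  have := G.size_le
  exact Nat.mul_pos (by omega) (by omega)

theorem nid_inj {u v : ℕ × ℕ} (hu : G.Nd u) (hv : G.Nd v) (h : G.nid u = G.nid v) : u = v :=
  (nid_add_inj hu hv (i := 0) (j := 0) G.sq_pos G.sq_pos (by simpa using h)).1

theorem idx_lt_succ {u : ℕ × ℕ} (hu : G.Nd u) {p q : ℕ} (hp : p < G.m) (hq : q < G.m) :
    G.idx u < p * G.m + (q + 1) ↔ G.idx u < p * G.m + q ∨ u = (p, q) := by
  rw [← add_assoc, Nat.lt_succ_iff_lt_or_eq]
  refine or_congr Iff.rfl ⟨fun h => idx_inj hu (v := (p, q)) ⟨hp, hq⟩ h, ?_⟩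
  rintro rfl; rfl

theorem idx_lt {u : ℕ × ℕ} (hu : G.Nd u) : G.idx u < G.m * G.m := by
  have h1 : (u.1 + 1) * G.m ≤ G.m * G.m := Nat.mul_le_mul_right _ hu.1
  have h2 := hu.2
  unfold idx
  rw [Nat.add_mul] at h1
  omega

theorem Live.nd {u : ℕ × ℕ} (h : G.Live u) : G.Nd u := ⟨h.acc.1.lt, h.acc.2.lt⟩

theorem length_le_of_nodup {l : List (ℕ × ℕ)} (hl : l.Nodup) (h : ∀ u ∈ l, G.Nd u) :
    l.length ≤ G.m * G.m := by
  have h1 : (l.map G.idx).Nodup :=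
    hl.map_on fun u hu v hv e => idx_inj (h u hu) (h v hv) e
  have h2 : (l.map G.idx).toFinset ⊆ Finset.range (G.m * G.m) := by
    intro x hx
    obtain ⟨u, hu, rfl⟩ := List.mem_map.1 (List.mem_toFinset.1 hx)
    exact Finset.mem_range.2 (idx_lt (h u hu))
  have := Finset.card_le_card h2
  rw [List.toFinset_card_of_nodup h1] at this
  simpa using this

end Inst

variable {I : List ℕ} {G : Inst I}

/-- The square of the input length, its multiples and their m-fold values arise by repeated
addition, since products are not available. -/
def nidProg : Cm :=
  .x ::= c 0 ;; .for .j .L (.x ::= v .x + v .L) ;; .big ::= v .x ;;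
  .x ::= c 0 ;; .for .q .m (put .nd2 (v .q) (v .x) ;; .x ::= v .x + v .big) ;; .mb ::= v .x ;;
  .x ::= c 0 ;; .for .q .m (put .nd1 (v .q) (v .x) ;; .x ::= v .x + v .mb)

/-- The tables for the numbers of pairs. -/
def IsNid (G : Inst I) (σ : St) : Prop :=
  (∀ q < G.m, σ.a .nd1 q = q * (G.m * (I.length * I.length))) ∧
    ∀ q < G.m, σ.a .nd2 q = q * (I.length * I.length)

theorem IsNid.eq {σ : St} (h : IsNid G σ) {u : ℕ × ℕ} (hu : G.Nd u) :
    σ.a .nd1 u.1 + σ.a .nd2 u.2 = G.nid u := by rw [h.1 _ hu.1, h.2 _ hu.2, Inst.nid]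

theorem wp_nid {σ : St} (hB : Base G σ) :
    wp I nidProg (fun σ' => IsNid G σ' ∧ σ'.t ≤ σ.t + 20 * I.length) σ := by
  have hsz := G.size_le
  unfold nidProg
  simp only [wp_seq, wp_set, Ex.eval_c]
  refine wp_for (fun j σ' => σ'.v .x = j * I.length ∧ σ'.t ≤ σ.t + 2 + 3 * j) rfl rfl ?_ ?_ ?_
  · simp
  · rintro j σ' hj hf hj' ⟨h1, h2⟩
    have hL : σ'.v .L = I.length := by rw [hf.v .L rfl]; simp [hB.L]
    simp [h1, hL]
    intro _
    exact ⟨by ring, by omega⟩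
  rintro σ₁ hf1 - ⟨h1, t1⟩
  simp [hB.L] at h1 t1
  simp only [wp_seq, wp_set, Ex.eval_c, Ex.eval_v]
  have hm1 : σ₁.v .m = G.m := by rw [hf1.v .m rfl]; simp [hB.m]
  refine wp_for (fun j σ' => σ'.v .x = j * (I.length * I.length) ∧
    (∀ q < j, σ'.a .nd2 q = q * (I.length * I.length)) ∧ σ'.t ≤ σ₁.t + 4 + 4 * j) rfl rfl ?_ ?_ ?_
  · simp
  · rintro j σ' hj hf hj' ⟨h2, h3, h4⟩
    have hL : σ'.v .big = I.length * I.length := by rw [hf.v .big rfl]; simp [h1]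
    simp [h2, hj', hL]
    refine ⟨by ring, fun q hq => ?_, by omega⟩
    by_cases hqj : q = j
    · subst hqj; simp
    · rw [Function.update_of_ne hqj]; exact h3 q (by omega)
  rintro σ₂ hf2 - ⟨h2, h3, t2⟩
  simp [hm1] at h2 h3 t2
  simp only [wp_seq, wp_set, Ex.eval_c, Ex.eval_v]
  have hm2 : σ₂.v .m = G.m := by rw [hf2.v .m rfl]; simp [hm1]
  refine wp_for (fun j σ' => σ'.v .x = j * (G.m * (I.length * I.length)) ∧
    (∀ q < j, σ'.a .nd1 q = q * (G.m * (I.length * I.length))) ∧ σ'.t ≤ σ₂.t + 4 + 4 * j)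
    rfl rfl ?_ ?_ ?_
  · simp
  · rintro j σ' hj hf hj' ⟨h4, h5, h6⟩
    have hL : σ'.v .mb = G.m * (I.length * I.length) := by rw [hf.v .mb rfl]; simp [h2]
    simp [h4, hj', hL]
    refine ⟨by ring, fun q hq => ?_, by omega⟩
    by_cases hqj : q = j
    · subst hqj; simp
    · rw [Function.update_of_ne hqj]; exact h5 q (by omega)
  rintro σ₃ hf3 - ⟨h4, h5, t3⟩
  simp [hm2] at h4 h5 t3
  refine ⟨⟨h5, fun q hq => ?_⟩, by simp; omega⟩
  simp only [St.tick_a]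
  rw [hf3.a .nd2 rfl]
  simpa using h3 q hq

/-! ### Initialization of the data about pairs -/

def initProg : Cm :=
  .tl ::= c 0 ;;
  .for .p .m (.for .q .m (.u ::= a .nd1 (v .p) + a .nd2 (v .q) ;;
    put .fst (v .u) (v .p) ;; put .snd (v .u) (v .q) ;; put .lab (v .u) (v .u) ;;
    put .mem (v .u) (v .u) ;; put .size (v .u) (c 1) ;;
    .ite (a .acc (v .p)) (.ite (a .acc (v .q)) (.ite (rd (c 2 + v .s + v .p))
      (.ite (rd (c 2 + v .s + v .q)) (put .live (v .u) (c 1) ;; put .fin (v .u) (c 1) ;;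
        put .LQ (v .tl) (v .u) ;; .tl ::= v .tl + c 1) .skip) .skip) .skip) .skip))

/-- Pairs of accessible final states. -/
def Inst.AccFin (G : Inst I) (u : ℕ × ℕ) : Prop := G.Acc u.1 ∧ G.Acc u.2 ∧ G.Fin2 u

/-- The data about single pairs. -/
structure NodeOK (G : Inst I) (σ : St) (u : ℕ × ℕ) : Prop where
  fst : σ.a .fst (G.nid u) = u.1
  snd : σ.a .snd (G.nid u) = u.2
  lab : σ.a .lab (G.nid u) = G.nid u
  mem : σ.a .mem (G.nid u) = G.nid u
  size : σ.a .size (G.nid u) = 1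

/-- The state when the first `k` pairs have been initialized. -/
structure InitOK (G : Inst I) (σ : St) (k : ℕ) : Prop where
  node : ∀ u, G.Nd u → G.idx u < k → NodeOK G σ u
  live : ∀ u, G.Nd u → (σ.a .live (G.nid u) ≠ 0 ↔ G.idx u < k ∧ G.AccFin u)
  fin : ∀ u, G.Nd u → (σ.a .fin (G.nid u) ≠ 0 ↔ G.idx u < k ∧ G.AccFin u)
  fin_le : ∀ u, σ.a .fin u ≤ 1
  queue : ∃ lq : List (ℕ × ℕ), lq.Nodup ∧ cells (σ.a .LQ) 0 (σ.v .tl) = lq.map G.nid ∧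
    ∀ u, u ∈ lq ↔ G.Nd u ∧ G.idx u < k ∧ G.AccFin u

theorem InitOK.congr {σ σ' : St} {k : ℕ} (h : InitOK G σ k) (ha : σ'.a = σ.a)
    (hv : σ'.v .tl = σ.v .tl) : InitOK G σ' k := by
  refine ⟨fun u hu hk => ?_, ?_, ?_, ?_, ?_⟩
  · obtain ⟨h1, h2, h3, h4, h5⟩ := h.node u hu hk
    exact ⟨by rw [ha, h1], by rw [ha, h2], by rw [ha, h3], by rw [ha, h4], by rw [ha, h5]⟩
  · rw [ha]; exact h.live
  · rw [ha]; exact h.fin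
  · rw [ha]; exact h.fin_le
  · rw [ha, hv]; exact h.queue

theorem wp_init {σ : St} (hB : Base G σ) (hA : IsAcc G σ) (hN : IsNid G σ)
    (hl : ∀ x, σ.a .live x = 0) (hf0 : ∀ x, σ.a .fin x = 0) :
    wp I initProg (fun σ' => InitOK G σ' (G.m * G.m) ∧
      σ'.t ≤ σ.t + 20 * (I.length * I.length)) σ := by
  have hsz := G.size_le
  unfold initProg
  simp only [wp_seq, wp_set, Ex.eval_c]
  refine wp_for (fun p σ' => InitOK G σ' (p * G.m) ∧ σ'.t ≤ σ.t + 2 + (17 * G.m + 4) * p)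
    rfl rfl ?_ ?_ ?_
  · refine ⟨⟨by simp, by simp [hl], by simp [hf0], by simp [hf0], [], by simp⟩, by simp⟩
  · rintro p σ' hp hf hp' ⟨hI, ht⟩
    simp [hB.m] at hp
    have hm : σ'.v .m = G.m := by rw [hf.v .m rfl]; simp [hB.m]
    refine wp_for (fun q σ'' => InitOK G σ'' (p * G.m + q) ∧ σ''.t ≤ σ'.t + 2 + 17 * q)
      rfl rfl ?_ ?_ ?_
    · exact ⟨hI.congr (by simp) (by simp), by simp⟩
    · rintro q σ₁ hq hf1 hq' ⟨hI1, ht1⟩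
      simp [hm] at hq
      have hu : G.Nd (p, q) := ⟨hp, hq⟩
      have hp1 : σ₁.v .p = p := by rw [hf1.v .p rfl]; exact hp'
      have hs1 : σ₁.v .s = G.s := by
        rw [hf1.v .s rfl]; simp; rw [hf.v .s rfl]; simp [hB.s]
      have hacc1 : σ₁.a .acc = σ.a .acc := by
        rw [hf1.a .acc rfl]; simp; rw [hf.a .acc rfl]; simp
      have hn1 : σ₁.a .nd1 = σ.a .nd1 := by
        rw [hf1.a .nd1 rfl]; simp; rw [hf.a .nd1 rfl]; simp
      have hn2 : σ₁.a .nd2 = σ.a .nd2 := by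
        rw [hf1.a .nd2 rfl]; simp; rw [hf.a .nd2 rfl]; simp
      have hnid : σ.a .nd1 p + σ.a .nd2 q = G.nid (p, q) := hN.eq hu
      have hne : ∀ u, G.Nd u → u ≠ (p, q) → G.nid u ≠ G.nid (p, q) :=
        fun u h h' e => h' (Inst.nid_inj h hu e)
      have hidx : ¬ G.idx (p, q) < p * G.m + q := by simp [Inst.idx]
      -- the state in which the pair is not accessible and final
      have caseNot : ∀ σ₂ : St, ¬ G.AccFin (p, q) → (∀ b, b ≠ .fst → b ≠ .snd → b ≠ .lab →
          b ≠ .mem → b ≠ .size → σ₂.a b = σ₁.a b) →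
          σ₂.a .fst = Function.update (σ₁.a .fst) (G.nid (p, q)) p →
          σ₂.a .snd = Function.update (σ₁.a .snd) (G.nid (p, q)) q →
          σ₂.a .lab = Function.update (σ₁.a .lab) (G.nid (p, q)) (G.nid (p, q)) →
          σ₂.a .mem = Function.update (σ₁.a .mem) (G.nid (p, q)) (G.nid (p, q)) →
          σ₂.a .size = Function.update (σ₁.a .size) (G.nid (p, q)) 1 → σ₂.v .tl = σ₁.v .tl →
          InitOK G σ₂ (p * G.m + (q + 1)) := by
        intro σ₂ hn hb b1 b2 b3 b4 b5 b6
        have hiff : ∀ u, G.Nd u → (G.idx u < p * G.m + q ∧ G.AccFin u ↔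
            G.idx u < p * G.m + (q + 1) ∧ G.AccFin u) := by
          intro u hu'
          rw [Inst.idx_lt_succ hu' hp hq]
          constructor
          · rintro ⟨h1, h2⟩; exact ⟨.inl h1, h2⟩
          · rintro ⟨h1 | rfl, h2⟩
            · exact ⟨h1, h2⟩
            · exact absurd h2 hn
        refine ⟨fun u hu' hi => ?_, fun u hu' => ?_, fun u hu' => ?_, ?_, ?_⟩
        · by_cases e : u = (p, q)
          · subst e
            exact ⟨by simp [b1], by simp [b2], by simp [b3], by simp [b4], by simp [b5]⟩
          · have := hI1.node u hu' (((Inst.idx_lt_succ hu' hp hq).1 hi).resolve_right e)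
            have h' := hne u hu' e
            exact ⟨by rw [b1, Function.update_of_ne h']; exact this.fst,
              by rw [b2, Function.update_of_ne h']; exact this.snd,
              by rw [b3, Function.update_of_ne h']; exact this.lab,
              by rw [b4, Function.update_of_ne h']; exact this.mem,
              by rw [b5, Function.update_of_ne h']; exact this.size⟩
        · rw [hb .live (by simp) (by simp) (by simp) (by simp) (by simp), hI1.live u hu', hiff u hu']
        · rw [hb .fin (by simp) (by simp) (by simp) (by simp) (by simp), hI1.fin u hu', hiff u hu']
        · rw [hb .fin (by simp) (by simp) (by simp) (by simp) (by simp)]; exact hI1.fin_le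
        · rw [hb .LQ (by simp) (by simp) (by simp) (by simp) (by simp), b6]
          obtain ⟨lq, c1, c2, c3⟩ := hI1.queue
          refine ⟨lq, c1, c2, fun u => ?_⟩
          rw [c3]
          exact and_congr_right fun hu' => hiff u hu'
      simp only [wp_seq, wp_set, wp_put, wp_ite, wp_skip]
      simp [hp1, hq', hn1, hn2, hnid, hacc1, hs1]
      have i1 := G.inp_fn hp; have i2 := G.inp_fn hq
      have a1 := hA p; have a2 := hA q
      refine ⟨fun g1 => ⟨fun g2 => ⟨fun g3 => ⟨fun g4 => ?_, fun g4 => ?_⟩, fun g3 => ?_⟩,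
        fun g2 => ?_⟩, fun g1 => ?_⟩
      · have hAF : G.AccFin (p, q) := ⟨a1.1 g1, a2.1 g2, i1.1 g3, i2.1 g4⟩
        refine ⟨⟨fun u hu' hi => ?_, fun u hu' => ?_, fun u hu' => ?_, fun u => ?_, ?_⟩, by omega⟩
        · by_cases e : u = (p, q)
          · subst e
            exact ⟨by simp, by simp, by simp, by simp, by simp⟩
          · have := hI1.node u hu' (((Inst.idx_lt_succ hu' hp hq).1 hi).resolve_right e)
            have h' := hne u hu' e
            exact ⟨by simp [h', this.fst], by simp [h', this.snd], by simp [h', this.lab],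
              by simp [h', this.mem], by simp [h', this.size]⟩
        · by_cases e : u = (p, q)
          · subst e
            simp [Inst.idx, hAF]
          · have h' := hne u hu' e
            simp [h', Inst.idx_lt_succ hu' hp hq, e]
            simpa using hI1.live u hu'
        · by_cases e : u = (p, q)
          · subst e
            simp [Inst.idx, hAF]
          · have h' := hne u hu' e
            simp [h', Inst.idx_lt_succ hu' hp hq, e]
            simpa using hI1.fin u hu'
        · simp [Function.update_apply]
          split_ifs
          · simp
          · exact hI1.fin_le u
        · obtain ⟨lq, c1, c2, c3⟩ := hI1.queue
          refine ⟨lq ++ [(p, q)], ?_, ?_, fun u => ?_⟩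
          · refine c1.append (by simp) ?_
            simp [c3, hidx]
          · have := cells_update_end (σ₁.a .LQ) 0 (σ₁.v .tl) (G.nid (p, q))
            rw [zero_add] at this
            simp [this, c2]
          · rw [List.mem_append, c3, List.mem_singleton]
            constructor
            · rintro (⟨h1, h2, h3⟩ | rfl)
              · exact ⟨h1, (Inst.idx_lt_succ h1 hp hq).2 (.inl h2), h3⟩
              · exact ⟨hu, (Inst.idx_lt_succ hu hp hq).2 (.inr rfl), hAF⟩
            · rintro ⟨h1, h2, h3⟩
              rcases (Inst.idx_lt_succ h1 hp hq).1 h2 with h | h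
              · exact .inl ⟨h1, h, h3⟩
              · exact .inr h
      · refine ⟨caseNot _ (fun h => (i2.2 h.2.2.2) g4) ?_ ?_ ?_ ?_ ?_ ?_ ?_, by omega⟩
        · intro b d1 d2 d3 d4 d5; simp [d1, d2, d3, d4, d5]
        all_goals simp
      · refine ⟨caseNot _ (fun h => (i1.2 h.2.2.1) g3) ?_ ?_ ?_ ?_ ?_ ?_ ?_, by omega⟩
        · intro b d1 d2 d3 d4 d5; simp [d1, d2, d3, d4, d5]
        all_goals simp
      · refine ⟨caseNot _ (fun h => (a2.2 h.2.1) g2) ?_ ?_ ?_ ?_ ?_ ?_ ?_, by omega⟩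
        · intro b d1 d2 d3 d4 d5; simp [d1, d2, d3, d4, d5]
        all_goals simp
      · refine ⟨caseNot _ (fun h => (a1.2 h.1) g1) ?_ ?_ ?_ ?_ ?_ ?_ ?_, by omega⟩
        · intro b d1 d2 d3 d4 d5; simp [d1, d2, d3, d4, d5]
        all_goals simp
    · rintro σ₁ hf1 - ⟨hI1, ht1⟩ -
      simp [hm] at hI1 ht1
      rw [← Nat.succ_mul] at hI1
      refine ⟨hI1.congr (by simp) (by simp), ?_⟩
      simp
      nlinarith
  · rintro σ₁ hf1 - ⟨hI1, ht1⟩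
    simp [hB.m] at hI1 ht1
    refine ⟨hI1.congr (by simp) (by simp), ?_⟩
    simp
    nlinarith

/-! ### Enumeration of the transitions between pairs -/

/-- Performs `act` for all transitions between pairs. -/
def edgeProg (act : Cm) : Cm :=
  .for .j .np (.pos ::= a .PL (v .j) ;; .p ::= rd (v .pos) ;;
    .for .q .m (.ite (a .acc (v .q))
      (.d ::= a .D (a .kap (v .pos) + a .T (a .crow (v .pos) + v .q)) ;;
      .ite (v .d) (.x ::= a .nd1 (a .tgt (v .pos)) + a .nd2 (v .d - c 1) ;;
        .u ::= a .nd1 (v .p) + a .nd2 (v .q) ;; act) .skip) .skip))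

/-- Transitions, given by a rule, an argument position, and another state. -/
abbrev Edge : Type := (ℕ × ℕ) × ℕ

namespace Inst

def src (G : Inst I) (e : Edge) : ℕ × ℕ := (G.ag e.1.1 e.1.2, e.2)
noncomputable def dst (G : Inst I) (e : Edge) : ℕ × ℕ := (G.tg e.1.1, G.ap e.1.1 e.1.2 e.2 - 1)
def IsEdge (G : Inst I) (e : Edge) : Prop :=
  G.Letter e.1.1 e.1.2 ∧ e.2 < G.m ∧ G.ap e.1.1 e.1.2 e.2 ≠ 0

theorem IsEdge.nd_src {e : Edge} (h : G.IsEdge e) : G.Nd (G.src e) :=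
  ⟨G.ag_lt _ h.1.1.1 _ h.1.2, h.2.1⟩

theorem IsEdge.step {e : Edge} (h : G.IsEdge e) : G.Step e.1.1 e.1.2 (G.src e) (G.dst e) := by
  refine ⟨h.1.ap_self, ?_⟩
  have := h.2.2
  simp only [src, dst]
  omega

theorem IsEdge.nd_dst {e : Edge} (h : G.IsEdge e) : G.Nd (G.dst e) :=
  ⟨(acc_of_ap h.step.1).lt, (acc_of_ap h.step.2).lt⟩

end Inst

/-- A transition is named by the rule for the first component, the position, and the state in the
second component, so running through all positions and states meets each transition once. The action
is a parameter because the enumeration is used twice, for predecessor lists and for the letters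
leading to live pairs. The strict bound on `es` leaves room for one more entry in such lists. -/
theorem wp_edges {act : Cm} (hV : ∀ x, act.modV x = false)
    (hA : ∀ b, b ≠ .badj → b ≠ .bcnt → b ≠ .fadj → b ≠ .fcnt → act.modA b = false)
    {σ : St} (hT : Tab G σ) (hN : IsNid G σ) (Inv : List Edge → (Ar → ℕ → ℕ) → Prop)
    (h0 : Inv [] σ.a)
    (hstep : ∀ es e σ', (∀ b, act.modA b = false → σ'.a b = σ.a b) → G.IsEdge e →
      es.length < I.length * I.length → Inv es σ'.a → σ'.v .pos = G.pos e.1.1 e.1.2 →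
      σ'.v .x = G.nid (G.dst e) → σ'.v .u = G.nid (G.src e) →
      wp I act (fun σ'' => Inv (es ++ [e]) σ''.a ∧ σ''.t ≤ σ'.t + 4) σ') :
    wp I (edgeProg act) (fun σ' => ∃ es, es.Nodup ∧ (∀ e, e ∈ es ↔ G.IsEdge e) ∧
      es.length ≤ I.length * I.length ∧ Inv es σ'.a ∧
      σ'.t ≤ σ.t + 20 * (I.length * I.length)) σ := by
  have hsz := G.size_le
  have hlen := Inst.length_letters_lt (G := G)
  have hnp : σ.v .np = (G.letters G.R).length := by
    have := congrArg List.length hT.PL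
    simpa using this
  unfold edgeProg
  refine wp_for (fun n σ' => (∃ es : List Edge, es.Nodup ∧ (∀ e, e ∈ es ↔ G.IsEdge e ∧
      e.1 ∈ (G.letters G.R).take n) ∧ es.length ≤ n * G.m ∧ Inv es σ'.a) ∧
      σ'.t ≤ σ.t + 1 + (12 * G.m + 7) * n) (by simp [Cm.for, modV, hV]) (by simp [Cm.for, modV, hV])
      ?_ ?_ ?_
  · exact ⟨⟨[], by simp [h0]⟩, by simp⟩
  · rintro n σ' hn hf hn' ⟨⟨es, e1, e2, e3, e4⟩, ht⟩
    rw [hnp] at hn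
    obtain ⟨l, hl⟩ : ∃ l, (G.letters G.R)[n] = l := ⟨_, rfl⟩
    have hlL : G.Letter l.1 l.2 := (Inst.mem_letters.1 (hl ▸ List.getElem_mem hn)).2
    have hfa : ∀ b, act.modA b = false → σ'.a b = σ.a b := fun b hb =>
      hf.a b (by simp [Cm.for, modA, hb])
    have hPL : σ'.a .PL n = G.pos l.1 l.2 := by
      rw [hfa .PL (hA _ (by simp) (by simp) (by simp) (by simp))]
      have h1 : n < (cells (σ.a .PL) 0 (σ.v .np)).length := by simpa [hnp] using hn
      have h2 := getElem_cells h1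
      rw [zero_add] at h2
      rw [← h2]
      simp only [hT.PL, List.getElem_map, hl]
    have hinp : inp I (G.pos l.1 l.2) = G.ag l.1 l.2 := G.inp_ag hlL.1.1 hlL.2
    have hm : σ'.v .m = G.m := by
      rw [hf.v .m (by simp [Cm.for, modV, hV])]; exact hT.base.m
    simp only [wp_seq, wp_set]
    simp only [Ex.eval_a, Ex.eval_v, Ex.eval_rd, St.tick_a, St.tick_v, hn', St.setV_v, if_true,
      hPL, hinp]
    have htake : (G.letters G.R).take (n + 1) = (G.letters G.R).take n ++ [l] := by
      rw [List.take_succ_eq_append_getElem hn, hl]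
    have hlnot : l ∉ (G.letters G.R).take n := by
      have := (List.take_sublist (n + 1) _).nodup (Inst.nodup_letters (G := G) G.R)
      rw [htake] at this
      intro hh
      have := List.disjoint_of_nodup_append this hh
      simp at this
    refine wp_for (fun q σ'' => (∃ es : List Edge, es.Nodup ∧ (∀ e, e ∈ es ↔ G.IsEdge e ∧
      (e.1 ∈ (G.letters G.R).take n ∨ e.1 = l ∧ e.2 < q)) ∧ es.length ≤ n * G.m + q ∧ Inv es σ''.a) ∧
      σ''.t ≤ σ'.t + 4 + 12 * q) (by simp [Cm.for, modV, hV]) (by simp [Cm.for, modV, hV]) ?_ ?_ ?_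
    · exact ⟨⟨es, e1, by simpa using e2, by simpa using e3, e4⟩, by simp⟩
    · rintro q σ₁ hq hf1 hq' ⟨⟨es, e1, e2, e3, e4⟩, ht1⟩
      simp [hm] at hq
      have hfa1 : ∀ b, act.modA b = false → σ₁.a b = σ.a b := fun b hb => by
        rw [hf1.a b (by simp [Cm.for, modA, hb])]; exact hfa b hb
      have hpos1 : σ₁.v .pos = G.pos l.1 l.2 := by
        rw [hf1.v .pos (by simp [Cm.for, modV, hV])]; simp
      have hp1 : σ₁.v .p = G.ag l.1 l.2 := by
        rw [hf1.v .p (by simp [Cm.for, modV, hV])]; simp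
      have A1 := hfa1 .acc (hA _ (by simp) (by simp) (by simp) (by simp))
      have A2 := hfa1 .D (hA _ (by simp) (by simp) (by simp) (by simp))
      have A3 := hfa1 .kap (hA _ (by simp) (by simp) (by simp) (by simp))
      have A4 := hfa1 .T (hA _ (by simp) (by simp) (by simp) (by simp))
      have A5 := hfa1 .crow (hA _ (by simp) (by simp) (by simp) (by simp))
      have A6 := hfa1 .nd1 (hA _ (by simp) (by simp) (by simp) (by simp))
      have A7 := hfa1 .nd2 (hA _ (by simp) (by simp) (by simp) (by simp))
      have A8 := hfa1 .tgt (hA _ (by simp) (by simp) (by simp) (by simp))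
      have hlook := hT.look l.1 l.2 hlL q hq
      have skipCase : ∀ t, t ≤ σ₁.t + 10 → G.ap l.1 l.2 q = 0 → ∀ a', a' = σ₁.a →
          (∃ es : List Edge, es.Nodup ∧ (∀ e, e ∈ es ↔ G.IsEdge e ∧
          (e.1 ∈ (G.letters G.R).take n ∨ e.1 = l ∧ e.2 < q + 1)) ∧
          es.length ≤ n * G.m + (q + 1) ∧ Inv es a') ∧ t ≤ σ'.t + 4 + 12 * (q + 1) := by
        rintro t ht2 hap _ rfl
        refine ⟨⟨es, e1, fun e => ?_, by omega, e4⟩, by omega⟩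
        rw [e2]
        refine and_congr_right fun he => or_congr Iff.rfl (and_congr_right fun hel => ?_)
        have : e.2 ≠ q := by rintro rfl; subst hel; exact he.2.2 hap
        omega
      simp only [wp_seq, wp_set, wp_ite, wp_skip]
      simp only [Ex.eval_a, Ex.eval_v, Ex.eval_add, Ex.eval_sub, Ex.eval_c, St.tick_a, St.tick_v,
        St.setV_a, St.setV_v, hq', hpos1, hp1, reduceCtorEq, if_true, if_false, A1, A2, A3, A4, A5,
        A6, A7, A8, hlook, hT.tgt _ _ hlL]
      refine ⟨fun hac => ⟨fun hap => ?_, fun hap _ => ?_⟩, fun hac _ => ?_⟩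
      · have he : G.IsEdge (l, q) := ⟨hlL, hq, hap⟩
        have hx : σ.a .nd1 (G.tg l.1) + σ.a .nd2 (G.ap l.1 l.2 q - 1) = G.nid (G.dst (l, q)) :=
          hN.eq he.nd_dst
        have hu : σ.a .nd1 (G.ag l.1 l.2) + σ.a .nd2 q = G.nid (G.src (l, q)) :=
          hN.eq he.nd_src
        rw [hx, hu]
        have hlt : es.length < I.length * I.length := by nlinarith
        refine (hstep es (l, q) _ ?_ he hlt ?_ ?_ ?_ ?_).mono fun σ₂ hf2 ⟨b1, b2⟩ _ => ?_
        · simpa using hfa1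
        · simpa using e4
        · simpa using hpos1
        · simp
        · simp
        · refine ⟨⟨es ++ [(l, q)], ?_, fun e => ?_, by simp; omega, b1⟩, ?_⟩
          · refine e1.append (by simp) ?_
            simp [e2, hlnot]
          · rw [List.mem_append, e2, List.mem_singleton]
            constructor
            · rintro (⟨h1, h2 | ⟨h2, h3⟩⟩ | rfl)
              · exact ⟨h1, .inl h2⟩
              · exact ⟨h1, .inr ⟨h2, by omega⟩⟩
              · exact ⟨he, .inr ⟨rfl, by simp⟩⟩
            · rintro ⟨h1, h2 | ⟨h2, h3⟩⟩
              · exact .inl ⟨h1, .inl h2⟩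
              · rcases Nat.lt_succ_iff_lt_or_eq.1 h3 with h | h
                · exact .inl ⟨h1, .inr ⟨h2, h⟩⟩
                · exact .inr (Prod.ext h2 h)
          · simp at b2 ⊢
            omega
      · refine skipCase _ ?_ (by simpa using hap) _ rfl
        simp
      · refine skipCase _ ?_ ?_ _ rfl
        · simp
        · by_contra hap
          exact ((hT.acc q).2 (Inst.ap_acc hlL hap)) hac
    · rintro σ₁ hf1 - ⟨⟨es, e1, e2, e3, e4⟩, ht1⟩ -
      simp [hm] at e2 e3 ht1
      refine ⟨⟨es, e1, fun e => ?_, ?_, e4⟩, ?_⟩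
      · obtain ⟨l', q'⟩ := e
        obtain ⟨a', b'⟩ := l'
        rw [e2, htake, List.mem_append, List.mem_singleton]
        refine and_congr_right fun he => or_congr Iff.rfl ?_
        simp only [and_iff_left_iff_imp]
        exact fun _ => he.2.1
      · rw [Nat.succ_mul]; exact e3
      · simp
        nlinarith
  · rintro σ₁ hf1 - ⟨⟨es, e1, e2, e3, e4⟩, ht1⟩
    rw [hnp] at e2 e3 ht1
    refine ⟨es, e1, fun e => ?_, ?_, e4, ?_⟩
    · rw [e2, List.take_length, and_iff_left_iff_imp]
      exact fun h => Inst.mem_letters.2 ⟨h.1.1.1, h.1⟩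
    · nlinarith
    · simp
      nlinarith

end TreeAut

namespace TreeAut

open Cm Ex

/-- As `l` has no repetitions, every element of `es` is counted for at most one value. This bounds a
total cost by the number of transitions or letters. -/
theorem sum_length_filter_le {α β : Type*} [DecidableEq β] (f : α → β) (es : List α) {l : List β}
    (hl : l.Nodup) :
    (l.map fun v => (es.filter fun e => decide (f e = v)).length).sum ≤ es.length := by
  induction es with
  | nil => simp
  | cons e es ih =>
    have h : ∀ l : List β,
        (l.map fun v => ((e :: es).filter fun e => decide (f e = v)).length).sum =
        (l.map fun v => (es.filter fun e => decide (f e = v)).length).sum + l.count (f e) := by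
      intro l
      induction l with
      | nil => simp
      | cons v l ih =>
        have h1 : ((e :: es).filter fun e => decide (f e = v)).length =
            (es.filter fun e => decide (f e = v)).length + if v = f e then 1 else 0 := by
          by_cases hv : f e = v
          · simp [hv]
          · simp [hv, Ne.symm hv]
        simp only [List.map_cons, List.sum_cons, ih, List.count_cons, h1, beq_iff_eq]
        omega
    rw [h, List.length_cons]
    have := List.nodup_iff_count_le_one.1 hl (f e)
    omega

variable {I : List ℕ} {G : Inst I}

/-! ### Lists of data about pairs -/

/-- The lists `ls` are stored in the array `adj`, with their lengths in the array `cnt`. -/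
def Lists (G : Inst I) (adj cnt : ℕ → ℕ) (ls : ℕ × ℕ → List ℕ) : Prop :=
  ∀ v, G.Nd v → cells adj (G.nid v) (cnt (G.nid v)) = ls v

theorem Lists.length {adj cnt : ℕ → ℕ} {ls : ℕ × ℕ → List ℕ} (h : Lists G adj cnt ls)
    {v : ℕ × ℕ} (hv : G.Nd v) : cnt (G.nid v) = (ls v).length := by
  rw [← h v hv, length_cells]

/-- The new entry still lies in the gap behind `nid u`, so by `Inst.nid_add_inj` no other list is
touched. -/
theorem Lists.push {adj cnt : ℕ → ℕ} {ls ls' : ℕ × ℕ → List ℕ} (h : Lists G adj cnt ls)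
    (hlen : ∀ v, (ls v).length < I.length * I.length) {u : ℕ × ℕ} (hu : G.Nd u) {x : ℕ}
    (h1 : ls' u = ls u ++ [x]) (h2 : ∀ v, v ≠ u → ls' v = ls v) :
    Lists G (Function.update adj (G.nid u + cnt (G.nid u)) x)
      (Function.update cnt (G.nid u) (cnt (G.nid u) + 1)) ls' := by
  intro v hv
  by_cases e : v = u
  · subst e
    rw [Function.update_self, cells_update_end, h v hv, h1]
  · rw [Function.update_of_ne fun h' => e (Inst.nid_inj hv hu h'), cells_update_of_ne, h v hv, h2 v e]
    intro i hi h'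
    rw [h.length hv] at hi
    have := hlen u
    rw [← h.length hu] at this
    exact e (Inst.nid_add_inj hv hu (hi.trans (hlen v)) this h').1

/-! ### Lists of predecessors -/

def backAct : Cm :=
  put .badj (v .x + a .bcnt (v .x)) (v .u) ;; put .bcnt (v .x) (a .bcnt (v .x) + c 1)

open Classical in
/-- Numbers of the predecessors of a pair. -/
noncomputable def backList (G : Inst I) (es : List Edge) (v : ℕ × ℕ) : List ℕ :=
  (es.filter fun e => G.dst e = v).map fun e => G.nid (G.src e)

theorem wp_back {σ : St} (hT : Tab G σ) (hN : IsNid G σ) (h0 : ∀ x, σ.a .bcnt x = 0) :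
    wp I (edgeProg backAct) (fun σ' => ∃ es, es.Nodup ∧ (∀ e, e ∈ es ↔ G.IsEdge e) ∧
      es.length ≤ I.length * I.length ∧ Lists G (σ'.a .badj) (σ'.a .bcnt) (backList G es) ∧
      σ'.t ≤ σ.t + 20 * (I.length * I.length)) σ := by
  refine wp_edges (fun x => rfl) (fun b h1 h2 _ _ => by simp [backAct, modA, h1, h2]) hT hN
    (fun es f => Lists G (f .badj) (f .bcnt) (backList G es)) ?_ ?_
  · intro v hv
    simp [h0, backList]
  · intro es e σ' _ he hlen hI _ hx hu
    unfold backAct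
    simp only [wp_seq, wp_put]
    simp [hx, hu]
    refine hI.push (fun v => ?_) he.nd_dst ?_ ?_
    · simp only [backList, List.length_map]
      exact (List.length_filter_le _ _).trans_lt hlen
    · simp [backList]
    · intro v hv
      simp [backList, Ne.symm hv]

/-! ### Live pairs -/

def liveProg : Cm :=
  .hd ::= c 0 ;; .loop (v .tl - v .hd) (.x ::= a .LQ (v .hd) ;; .hd ::= v .hd + c 1 ;;
    .k ::= a .bcnt (v .x) ;;
    .for .j .k (.u ::= a .badj (v .x + v .j) ;; .ite (a .live (v .u)) .skip
      (put .live (v .u) (c 1) ;; put .LQ (v .tl) (v .u) ;; .tl ::= v .tl + c 1)))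

/-- The queue of pairs that have been found to be live. -/
structure LiveQ (G : Inst I) (σ : St) (lq : List (ℕ × ℕ)) : Prop where
  nodup : lq.Nodup
  queue : cells (σ.a .LQ) 0 (σ.v .tl) = lq.map G.nid
  live : ∀ u ∈ lq, G.Live u
  mem : ∀ u, G.Nd u → (σ.a .live (G.nid u) ≠ 0 ↔ u ∈ lq)
  fin : ∀ u, G.AccFin u → u ∈ lq

theorem LiveQ.tl {σ : St} {lq : List (ℕ × ℕ)} (h : LiveQ G σ lq) : σ.v .tl = lq.length := by
  have := congrArg List.length h.queue
  simpa using this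

theorem LiveQ.congr {σ σ' : St} {lq : List (ℕ × ℕ)} (h : LiveQ G σ lq) (ha : σ'.a = σ.a)
    (hv : σ'.v .tl = σ.v .tl) : LiveQ G σ' lq :=
  ⟨h.nodup, by rw [ha, hv, h.queue], h.live, by rw [ha]; exact h.mem, h.fin⟩

theorem LiveQ.push {σ σ' : St} {lq : List (ℕ × ℕ)} (h : LiveQ G σ lq) {u : ℕ × ℕ}
    (hu : G.Live u) (hul : u ∉ lq)
    (h1 : σ'.a .LQ = Function.update (σ.a .LQ) (σ.v .tl) (G.nid u))
    (h2 : σ'.a .live = Function.update (σ.a .live) (G.nid u) 1)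
    (h3 : σ'.v .tl = σ.v .tl + 1) : LiveQ G σ' (lq ++ [u]) := by
  refine ⟨?_, ?_, ?_, ?_, ?_⟩
  · refine h.nodup.append (by simp) ?_
    simpa using hul
  · have := cells_update_end (σ.a .LQ) 0 (σ.v .tl) (G.nid u)
    rw [zero_add] at this
    rw [h1, h3, this, h.queue]
    simp
  · intro w hw
    rcases List.mem_append.1 hw with hw | hw
    · exact h.live w hw
    · rw [List.mem_singleton.1 hw]; exact hu
  · intro w hw
    rw [h2]
    by_cases e : w = u
    · subst e; simp
    · rw [Function.update_of_ne fun h' => e (Inst.nid_inj hw hu.nd h'), h.mem w hw]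
      simp [e]
  · intro w hw
    exact List.mem_append_left _ (h.fin w hw)

theorem Inst.Live.exists_edge {j i : ℕ} {u w : ℕ × ℕ} (hl : G.Letter j i) (h : G.Step j i u w)
    (hu : G.Nd u) : ∃ e, G.IsEdge e ∧ G.src e = u ∧ G.dst e = w := by
  obtain ⟨k, hk, -⟩ := (Inst.ap_eq_succ_iff hl.1.1).1 h.1
  have hkl : G.Letter k i := hl.of_match hk
  have hs : G.Step k i u w := (Inst.Step.congr hl.1.1 hk).2 h
  have he : G.IsEdge ((k, i), u.2) := ⟨hkl, hu.2, by rw [hs.2]; omega⟩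
  have hsrc : G.src ((k, i), u.2) = u := Prod.ext hk.2.2.1 rfl
  refine ⟨_, he, hsrc, ?_⟩
  have := he.step
  rw [hsrc] at this
  exact this.unique hs

/-- Backward breadth-first search. The predecessors of every processed pair are in the queue; the
queue has no repetitions, so it has at most m² entries, and the time is charged to its entries and
to the transitions into processed pairs. -/
theorem wp_live {σ : St} (hI : InitOK G σ (G.m * G.m)) {es : List Edge}
    (hes : ∀ e, e ∈ es ↔ G.IsEdge e) (hlen : es.length ≤ I.length * I.length)
    (hL : Lists G (σ.a .badj) (σ.a .bcnt) (backList G es)) :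
    wp I liveProg (fun σ' => (∀ u, G.Nd u → (σ'.a .live (G.nid u) ≠ 0 ↔ G.Live u)) ∧
      σ'.t ≤ σ.t + 30 * (I.length * I.length)) σ := by
  classical
  have hsz := G.size_le
  have hmm : 2 + G.m * G.m ≤ I.length * I.length := by nlinarith
  unfold liveProg
  simp only [wp_seq, wp_set, Ex.eval_c]
  refine wp_loop (fun n σ' => ∃ lq, LiveQ G σ' lq ∧ σ'.v .hd ≤ lq.length ∧
    n + σ'.v .hd = G.m * G.m ∧
    (∀ e ∈ es, G.dst e ∈ lq.take (σ'.v .hd) → G.src e ∈ lq) ∧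
    σ'.t ≤ σ.t + 1 + 10 * σ'.v .hd +
      10 * ((lq.take (σ'.v .hd)).map fun v =>
        (es.filter fun e => decide (G.dst e = v)).length).sum) (G.m * G.m) ?_ ?_ ?_
  · obtain ⟨lq, h1, h2, h3⟩ := hI.queue
    refine ⟨lq, ⟨h1, by simpa using h2, fun u hu => ?_, fun u hu => ?_, fun u hu => ?_⟩,
      by simp, by simp, by simp, by simp⟩
    · have := ((h3 u).1 hu).2.2
      exact .base this.1 this.2.1 this.2.2
    · simp only [St.setV_a]
      rw [hI.live u hu, h3]
      simp [hu]
    · have hn : G.Nd u := ⟨hu.1.lt, hu.2.1.lt⟩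
      exact (h3 u).2 ⟨hn, Inst.idx_lt hn, hu⟩
  · rintro n σ' hf ⟨lq, hq, hhd, hn, hcl, ht⟩ hc
    simp only [Ex.eval_sub, Ex.eval_v, hq.tl] at hc
    have hlt : σ'.v .hd < lq.length := by omega
    obtain ⟨w, hw⟩ : ∃ w, lq[σ'.v .hd] = w := ⟨_, rfl⟩
    have hwl : G.Live w := hq.live w (hw ▸ List.getElem_mem hlt)
    have hx : σ'.a .LQ (σ'.v .hd) = G.nid w := by
      have h1 : σ'.v .hd < (cells (σ'.a .LQ) 0 (σ'.v .tl)).length := by simpa [hq.tl] using hlt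
      have h2 := getElem_cells h1
      rw [zero_add] at h2
      rw [← h2]
      simp only [hq.queue, List.getElem_map, hw]
    have hlm : lq.length ≤ G.m * G.m :=
      Inst.length_le_of_nodup hq.nodup fun u hu => (hq.live u hu).nd
    have hba : σ'.a .badj = σ.a .badj := by rw [hf.a .badj rfl]; simp
    have hbc : σ'.a .bcnt = σ.a .bcnt := by rw [hf.a .bcnt rfl]; simp
    have hcell := hL w hwl.nd
    obtain ⟨bs, hbs⟩ : ∃ bs, bs = es.filter fun e => decide (G.dst e = w) := ⟨_, rfl⟩
    have hcell' : cells (σ.a .badj) (G.nid w) (σ.a .bcnt (G.nid w)) =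
      bs.map fun e => G.nid (G.src e) := by rw [hcell, backList, hbs]
    have hk : σ.a .bcnt (G.nid w) = bs.length := by
      have := congrArg List.length hcell'
      simpa using this
    have htake : lq.take (σ'.v .hd + 1) = lq.take (σ'.v .hd) ++ [w] := by
      rw [List.take_succ_eq_append_getElem hlt, hw]
    simp only [wp_seq, wp_set, Ex.eval_c, Ex.eval_a, Ex.eval_v, Ex.eval_add, St.tick_a, St.tick_v]
    simp only [St.setV_a, St.setV_v, reduceCtorEq, if_false, if_true, St.tick_a, St.tick_v, hx,
      hbc, hk]
    refine wp_for (fun j σ'' => ∃ lq', LiveQ G σ'' (lq ++ lq') ∧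
      (∀ e ∈ bs.take j, G.src e ∈ lq ++ lq') ∧ σ''.t ≤ σ'.t + 5 + 7 * j) rfl rfl ?_ ?_ ?_
    · refine ⟨[], ?_, by simp, by simp⟩
      rw [List.append_nil]
      exact hq.congr (by simp) (by simp)
    · rintro j σ₁ hj hf1 hj' ⟨lq', hq1, hb1, ht1⟩
      simp at hj
      have hx1 : σ₁.v .x = G.nid w := by rw [hf1.v .x rfl]; simp [hx]
      have hba1 : σ₁.a .badj = σ.a .badj := by rw [hf1.a .badj rfl]; simp [hba]
      obtain ⟨e, he⟩ : ∃ e, bs[j] = e := ⟨_, rfl⟩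
      have hebs : e ∈ bs := he ▸ List.getElem_mem hj
      rw [hbs, List.mem_filter, decide_eq_true_iff] at hebs
      have hee := (hes e).1 hebs.1
      have hu : σ.a .badj (G.nid w + j) = G.nid (G.src e) := by
        have h1 : j < (cells (σ.a .badj) (G.nid w) (σ.a .bcnt (G.nid w))).length := by
          simpa [hk] using hj
        rw [← getElem_cells h1]
        simp only [hcell', List.getElem_map, he]
      have hlive : G.Live (G.src e) := .step hee.1 hee.step (hebs.2 ▸ hwl)
      have htk : bs.take (j + 1) = bs.take j ++ [e] := by
        rw [List.take_succ_eq_append_getElem hj, he]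
      simp only [wp_seq, wp_set, wp_ite, wp_skip, wp_put]
      simp only [Ex.eval_a, Ex.eval_v, Ex.eval_add, Ex.eval_c, St.tick_a, St.tick_v, St.tick_t,
        St.setV_a, St.setV_v, St.setV_t, St.setA_a, St.setA_v, St.setA_t, hx1, hj', hba1, hu,
        reduceCtorEq, if_true, if_false]
      rw [hq1.mem _ hlive.nd]
      constructor
      · intro hm _
        refine ⟨lq', hq1.congr (by simp) (by simp), ?_, by omega⟩
        rw [htk]
        intro e' he'
        rcases List.mem_append.1 he' with h | h
        · exact hb1 e' h
        · rw [List.mem_singleton.1 h]; exact hm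
      · intro hm _
        have hm' : G.src e ∉ lq ++ lq' := fun h => (hq1.mem _ hlive.nd).2 h hm
        refine ⟨lq' ++ [G.src e], ?_, ?_, by omega⟩
        · rw [← List.append_assoc]
          exact hq1.push hlive hm' (by simp) (by simp) (by simp)
        · rw [htk, ← List.append_assoc]
          intro e' he'
          rcases List.mem_append.1 he' with h | h
          · exact List.mem_append_left _ (hb1 e' h)
          · rw [List.mem_singleton.1 h]; simp
    · rintro σ₁ hf1 - ⟨lq', hq1, hb1, ht1⟩
      have hhd1 : σ₁.v .hd = σ'.v .hd + 1 := by rw [hf1.v .hd rfl]; simp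
      simp at hb1 ht1
      simp only [St.tick_v, hhd1]
      have ht2 : (lq ++ lq').take (σ'.v .hd + 1) = lq.take (σ'.v .hd) ++ [w] := by
        rw [List.take_append_of_le_length hlt, htake]
      refine ⟨n - 1, by omega, lq ++ lq', hq1.congr (by simp) (by simp), by simp; omega, by omega,
        ?_, ?_⟩
      · rw [ht2]
        intro e he hd
        rcases List.mem_append.1 hd with h | h
        · exact List.mem_append_left _ (hcl e he h)
        · refine List.mem_append.2 (hb1 _ _ _ ?_)
          rw [hbs, List.mem_filter]
          exact ⟨he, by simpa using h⟩
      · rw [ht2, List.map_append, List.sum_append]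
        simp only [List.map_cons, List.map_nil, List.sum_cons, List.sum_nil, ← hbs, St.tick_t]
        omega
  · rintro n σ' hf ⟨lq, hq, hhd, hn, hcl, ht⟩ hc
    simp only [Ex.eval_sub, Ex.eval_v, hq.tl] at hc
    have hhl : σ'.v .hd = lq.length := by omega
    have hlm : lq.length ≤ G.m * G.m :=
      Inst.length_le_of_nodup hq.nodup fun u hu => (hq.live u hu).nd
    rw [hhl, List.take_length] at hcl ht
    have := sum_length_filter_le G.dst es hq.nodup
    refine ⟨fun u hu => ?_, by simp; omega⟩
    simp only [St.tick_a]
    rw [hq.mem u hu]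
    refine ⟨hq.live u, fun h => ?_⟩
    -- The final queue contains the accessible final pairs and is closed under predecessors, hence
    -- contains all live pairs.
    refine Inst.Live.induction (X := {u | u ∈ lq}) (fun u h1 h2 h3 => hq.fin u ⟨h1, h2, h3⟩) ?_ h
    intro j i u v hl hs hv
    have hnu : G.Nd u :=
      ⟨(Inst.ap_acc hl (by rw [hs.1]; omega)).lt, (Inst.ap_acc hl (by rw [hs.2]; omega)).lt⟩
    obtain ⟨e, h1, rfl, rfl⟩ := Inst.Live.exists_edge hl hs hnu
    exact hcl e ((hes e).2 h1) hv

/-! ### Lists of letters that lead to live pairs -/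

def outAct : Cm :=
  .ite (a .live (v .x)) (put .fadj (v .u + a .fcnt (v .u)) (v .pos) ;;
    put .fcnt (v .u) (a .fcnt (v .u) + c 1)) .skip

open Classical in
noncomputable def outEdges (G : Inst I) (es : List Edge) (u : ℕ × ℕ) : List Edge :=
  es.filter fun e => G.src e = u ∧ G.Live (G.dst e)

/-- The letters that lead from a pair to live pairs are stored. -/
def IsOut (G : Inst I) (σ : St) : Prop :=
  ∀ u, G.Nd u → ∃ ls : List (ℕ × ℕ), ls.Nodup ∧ (∀ l, l ∈ ls ↔ l ∈ G.liveOut u) ∧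
    cells (σ.a .fadj) (G.nid u) (σ.a .fcnt (G.nid u)) = ls.map fun l => G.pos l.1 l.2

theorem IsOut.ncard {σ : St} (h : IsOut G σ) {u : ℕ × ℕ} (hu : G.Nd u) :
    σ.a .fcnt (G.nid u) = (G.liveOut u).ncard := by
  classical
  obtain ⟨ls, h1, h2, h3⟩ := h u hu
  have h4 := congrArg List.length h3
  rw [length_cells, List.length_map] at h4
  have : G.liveOut u = (ls.toFinset : Set (ℕ × ℕ)) := by ext l; simp [h2]
  rw [h4, this, Set.ncard_coe_finset, List.toFinset_card_of_nodup h1]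

theorem wp_out {σ : St} (hT : Tab G σ) (hN : IsNid G σ) (h0 : ∀ x, σ.a .fcnt x = 0)
    (hl : ∀ u, G.Nd u → (σ.a .live (G.nid u) ≠ 0 ↔ G.Live u)) :
    wp I (edgeProg outAct) (fun σ' => IsOut G σ' ∧
      σ'.t ≤ σ.t + 20 * (I.length * I.length)) σ := by
  classical
  refine (wp_edges (act := outAct) (fun x => rfl)
    (fun b _ _ h1 h2 => by simp [outAct, modA, h1, h2]) hT hN
    (fun es f => Lists G (f .fadj) (f .fcnt)
      fun u => (outEdges G es u).map fun e => G.pos e.1.1 e.1.2) ?_ ?_).mono ?_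
  · intro v hv
    simp [h0, outEdges]
  · intro es e σ' hfr he hlen hI hpos hx hu
    unfold outAct
    simp only [wp_seq, wp_put, wp_ite, wp_skip]
    simp only [Ex.eval_a, Ex.eval_v, Ex.eval_add, Ex.eval_c, St.tick_a, St.tick_v, St.tick_t,
        St.setA_a, St.setA_v, St.setA_t, hx, hu, hpos, reduceCtorEq, if_true, if_false]
    rw [hfr .live rfl]
    rw [hl _ he.nd_dst]
    constructor
    · intro hlv
      refine ⟨hI.push (fun v => ?_) he.nd_src ?_ ?_, by omega⟩
      · simp only [outEdges, List.length_map]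
        exact (List.length_filter_le _ _).trans_lt hlen
      · simp [outEdges, hlv]
      · intro v hv
        simp [outEdges, Ne.symm hv]
    · intro hlv
      have hlv' : ¬ G.Live (G.dst e) := fun h => (hl _ he.nd_dst).2 h hlv
      refine ⟨?_, by omega⟩
      simpa [outEdges, hlv'] using hI
  · rintro σ' - ⟨es, h1, h2, h3, h4, h5⟩
    refine ⟨fun u hu => ⟨(outEdges G es u).map (·.1), ?_, fun l => ?_, ?_⟩, h5⟩
    -- Transitions from one pair `u` have the same second state `u.2`, so they are distinguished by
    -- their letters alone.
    · refine (h1.filter _).map_on ?_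
      intro e he e' he' h
      have h7 := (of_decide_eq_true (List.mem_filter.1 he).2).1
      have h8 := (of_decide_eq_true (List.mem_filter.1 he').2).1
      have h9 : (G.src e).2 = (G.src e').2 := by rw [h7, h8]
      exact Prod.ext h h9
    · simp only [List.mem_map, outEdges, List.mem_filter, decide_eq_true_iff, h2]
      constructor
      · rintro ⟨e, ⟨he, rfl, hlv⟩, rfl⟩
        exact ⟨he.1, rfl, _, he.step, hlv⟩
      · rintro ⟨hL, hag, w, hw, hwl⟩
        have he : G.IsEdge (l, u.2) := ⟨hL, hu.2, by rw [hw.2]; omega⟩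
        have hs : G.src (l, u.2) = u := Prod.ext hag rfl
        have hst := he.step
        rw [hs] at hst
        exact ⟨_, ⟨he, hs, by rw [hst.unique hw]; exact hwl⟩, rfl⟩
    · rw [h4 u hu, List.map_map]
      rfl

end TreeAut

/-! ### The queue of equations between live pairs -/

namespace TreeAut

open Cm Ex

variable {I : List ℕ} {G : Inst I}

/-- The contents of the arrays that are not changed any more. -/
structure Env (G : Inst I) (f : Ar → ℕ → ℕ) : Prop where
  st : ∀ j < G.R, f .st j = G.st j
  val : ∀ j < G.R, (f .val j ≠ 0 ↔ G.Valid j)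
  tgt : ∀ j i, G.Letter j i → f .tgt (G.pos j i) = G.tg j
  look : ∀ j i, G.Letter j i → ∀ x < G.m,
    f .D (f .kap (G.pos j i) + f .T (f .crow (G.pos j i) + x)) = G.ap j i x
  nd : ∀ u, G.Nd u → f .nd1 u.1 + f .nd2 u.2 = G.nid u
  live : ∀ u, G.Nd u → (f .live (G.nid u) ≠ 0 ↔ G.Live u)
  fst : ∀ u, G.Nd u → f .fst (G.nid u) = u.1
  snd : ∀ u, G.Nd u → f .snd (G.nid u) = u.2
  fin : ∀ u v, G.Live u → G.Live v → (f .fin (G.nid u) = f .fin (G.nid v) ↔ (G.Fin2 u ↔ G.Fin2 v))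
  cnt : ∀ u, G.Nd u → f .fcnt (G.nid u) = (G.liveOut u).ncard
  out : ∀ u, G.Nd u → ∃ ls : List (ℕ × ℕ), (∀ l, l ∈ ls ↔ l ∈ G.liveOut u) ∧
    cells (f .fadj) (G.nid u) (f .fcnt (G.nid u)) = ls.map fun l => G.pos l.1 l.2

theorem Env.congr {f f' : Ar → ℕ → ℕ} (h : Env G f) (hb : ∀ b, b ≠ .QU → b ≠ .QV → b ≠ .lab →
    b ≠ .mem → b ≠ .size → f' b = f b) : Env G f' := by
  have hb' : ∀ b, (b ≠ .QU ∧ b ≠ .QV ∧ b ≠ .lab ∧ b ≠ .mem ∧ b ≠ .size) → f' b = f b :=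
    fun b ⟨h1, h2, h3, h4, h5⟩ => hb b h1 h2 h3 h4 h5
  obtain ⟨h1, h2, h3, h4, h5, h6, h7, h8, h9, h10, h11⟩ := h
  refine ⟨?_, ?_, ?_, ?_, ?_, ?_, ?_, ?_, ?_, ?_, ?_⟩
  · rw [hb' .st (by simp)]; exact h1
  · rw [hb' .val (by simp)]; exact h2
  · rw [hb' .tgt (by simp)]; exact h3
  · rw [hb' .D (by simp), hb' .kap (by simp), hb' .T (by simp), hb' .crow (by simp)]; exact h4
  · rw [hb' .nd1 (by simp), hb' .nd2 (by simp)]; exact h5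
  · rw [hb' .live (by simp)]; exact h6
  · rw [hb' .fst (by simp)]; exact h7
  · rw [hb' .snd (by simp)]; exact h8
  · rw [hb' .fin (by simp)]; exact h9
  · rw [hb' .fcnt (by simp)]; exact h10
  · rw [hb' .fadj (by simp), hb' .fcnt (by simp)]; exact h11

theorem Env.frame {p : Cm} {σ σ' : St} (h : Env G σ.a) (hf : Frame p σ σ')
    (hp : ∀ b, b ≠ .QU → b ≠ .QV → b ≠ .lab → b ≠ .mem → b ≠ .size → p.modA b = false) :
    Env G σ'.a :=
  h.congr fun b h1 h2 h3 h4 h5 => hf.a b (hp b h1 h2 h3 h4 h5)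

/-! ### The queue of equations -/

/-- The queue contains the equations `qs` between live pairs; `ok` is zero only if the exchange
property fails, and otherwise the exchange property implies the equations. -/
structure Queue (G : Inst I) (σ : St) (qs : List ((ℕ × ℕ) × (ℕ × ℕ))) : Prop where
  left : cells (σ.a .QU) 0 (σ.v .tl) = qs.map fun e => G.nid e.1
  right : cells (σ.a .QV) 0 (σ.v .tl) = qs.map fun e => G.nid e.2
  live : ∀ e ∈ qs, G.Live e.1 ∧ G.Live e.2
  sound : G.Exchange → ∀ e ∈ qs, G.Equiv e.1 e.2
  ok : σ.v .ok = 1 ∨ σ.v .ok = 0 ∧ ¬ G.Exchange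

theorem Queue.tl {σ : St} {qs : List ((ℕ × ℕ) × (ℕ × ℕ))} (h : Queue G σ qs) :
    σ.v .tl = qs.length := by
  have := congrArg List.length h.left
  simpa using this

theorem Queue.congr {σ σ' : St} {qs : List ((ℕ × ℕ) × (ℕ × ℕ))} (h : Queue G σ qs)
    (h1 : σ'.a .QU = σ.a .QU) (h2 : σ'.a .QV = σ.a .QV) (h3 : σ'.v .tl = σ.v .tl)
    (h4 : σ'.v .ok = σ.v .ok) : Queue G σ' qs :=
  ⟨by rw [h1, h3, h.left], by rw [h2, h3, h.right], h.live, h.sound, by rw [h4]; exact h.ok⟩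

theorem Queue.fail {σ σ' : St} {qs : List ((ℕ × ℕ) × (ℕ × ℕ))} (h : Queue G σ qs)
    (h1 : σ'.a .QU = σ.a .QU) (h2 : σ'.a .QV = σ.a .QV) (h3 : σ'.v .tl = σ.v .tl)
    (h4 : σ'.v .ok = 0) (hE : ¬ G.Exchange) : Queue G σ' qs :=
  ⟨by rw [h1, h3, h.left], by rw [h2, h3, h.right], h.live, h.sound, .inr ⟨h4, hE⟩⟩

/-- Adds the equation between pair number `x` and the pair of `d - 1` and `e - 1`. -/
def pushProg : Cm :=
  .ite (v .d) (.ite (v .e) (.y ::= a .nd1 (v .d - c 1) + a .nd2 (v .e - c 1) ;;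
    .ite (a .live (v .y)) (put .QU (v .tl) (v .x) ;; put .QV (v .tl) (v .y) ;;
      .tl ::= v .tl + c 1) (.ok ::= c 0)) (.ok ::= c 0)) (.ok ::= c 0)

/-- The premise `hEx` says that exchange would provide a live partner of `w`. So if a lookup fails
or its result is not live, exchange is refuted and `ok` may be cleared; otherwise the equation is
recorded. -/
theorem wp_push {σ : St} {qs : List ((ℕ × ℕ) × (ℕ × ℕ))} (hE : Env G σ.a) (hQ : Queue G σ qs)
    {w : ℕ × ℕ} (hw : G.Live w) (hx : σ.v .x = G.nid w) (hd : σ.v .d ≤ G.m) (he : σ.v .e ≤ G.m)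
    (hEx : G.Exchange → ∃ z : ℕ × ℕ, σ.v .d = z.1 + 1 ∧ σ.v .e = z.2 + 1 ∧ G.Live z ∧
      G.Equiv w z) :
    wp I pushProg (fun σ' => ∃ qs', Queue G σ' (qs ++ qs') ∧ qs'.length ≤ 1 ∧
      (σ'.v .ok = 1 → σ.v .ok = 1 ∧ ∃ z : ℕ × ℕ, σ.v .d = z.1 + 1 ∧ σ.v .e = z.2 + 1 ∧ G.Live z ∧
        (w, z) ∈ qs ++ qs') ∧ σ'.t ≤ σ.t + 7) σ := by
  have fail : ∀ σ' : St, σ'.a = σ.a → σ'.v .tl = σ.v .tl → σ'.v .ok = 0 → ¬ G.Exchange →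
      σ'.t ≤ σ.t + 7 → ∃ qs', Queue G σ' (qs ++ qs') ∧ qs'.length ≤ 1 ∧
      (σ'.v .ok = 1 → σ.v .ok = 1 ∧ ∃ z : ℕ × ℕ, σ.v .d = z.1 + 1 ∧ σ.v .e = z.2 + 1 ∧ G.Live z ∧
        (w, z) ∈ qs ++ qs') ∧ σ'.t ≤ σ.t + 7 := by
    intro σ' h1 h2 h3 h4 h5
    refine ⟨[], ?_, by simp, by simp [h3], h5⟩
    rw [List.append_nil]
    exact hQ.fail (by rw [h1]) (by rw [h1]) h2 h3 h4
  revert fail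
  -- The postcondition is made opaque so that simplifying the program leaves it intact.
  generalize hP : (fun σ' : St => ∃ qs', Queue G σ' (qs ++ qs') ∧ qs'.length ≤ 1 ∧
    (σ'.v .ok = 1 → σ.v .ok = 1 ∧ ∃ z : ℕ × ℕ, σ.v .d = z.1 + 1 ∧ σ.v .e = z.2 + 1 ∧ G.Live z ∧
      (w, z) ∈ qs ++ qs') ∧ σ'.t ≤ σ.t + 7) = P
  intro fail
  have fail' : ∀ σ' : St, σ'.a = σ.a → σ'.v .tl = σ.v .tl → σ'.v .ok = 0 → ¬ G.Exchange →
      σ'.t ≤ σ.t + 7 → P σ' := by rw [← hP]; exact fail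
  unfold pushProg
  simp only [wp_ite, wp_seq, wp_set, wp_put]
  simp only [Ex.eval_v, Ex.eval_add, Ex.eval_sub, Ex.eval_a, Ex.eval_c, St.tick_a, St.tick_v,
    St.setV_a, St.setV_v, reduceCtorEq, if_true, if_false]
  refine ⟨fun hd0 => ⟨fun he0 => ?_, fun he0 => ?_⟩, fun hd0 => ?_⟩
  · have hz : G.Nd (σ.v .d - 1, σ.v .e - 1) := ⟨by simp only; omega, by simp only; omega⟩
    have h1 := hE.nd _ hz
    simp only at h1
    rw [h1, hE.live _ hz]
    constructor
    · intro hzl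
      rw [← hP]
      refine ⟨[(w, (σ.v .d - 1, σ.v .e - 1))], ⟨?_, ?_, ?_, ?_, ?_⟩, by simp, ?_, ?_⟩
      · have := cells_update_end (σ.a .QU) 0 (σ.v .tl) (G.nid w)
        rw [zero_add] at this
        simp [hx, this, hQ.left]
      · have := cells_update_end (σ.a .QV) 0 (σ.v .tl) (G.nid (σ.v .d - 1, σ.v .e - 1))
        rw [zero_add] at this
        simp [this, hQ.right]
      · intro e h
        rcases List.mem_append.1 h with h | h
        · exact hQ.live e h
        · rw [List.mem_singleton.1 h]; exact ⟨hw, hzl⟩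
      · intro hX e h
        rcases List.mem_append.1 h with h | h
        · exact hQ.sound hX e h
        · rw [List.mem_singleton.1 h]
          obtain ⟨z, h1, h2, h3, h4⟩ := hEx hX
          rw [h1, h2]
          exact h4
      · simpa using hQ.ok
      · intro h
        refine ⟨by simpa using h, _, ?_, ?_, hzl, by simp⟩
        · simp only; omega
        · simp only; omega
      · simp
    · intro hzl
      refine fail' _ (by simp) (by simp) (by simp) (fun hX => ?_) (by simp)
      obtain ⟨z, h1, h2, h3, h4⟩ := hEx hX
      have : z = (σ.v .d - 1, σ.v .e - 1) := Prod.ext (by simp only; omega) (by simp only; omega)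
      rw [this] at h3
      exact (hE.live _ hz).2 h3 hzl
  · refine fail' _ (by simp) (by simp) (by simp) (fun hX => ?_) (by simp)
    obtain ⟨z, h1, h2, h3, h4⟩ := hEx hX
    omega
  · refine fail' _ (by simp) (by simp) (by simp) (fun hX => ?_) (by simp)
    obtain ⟨z, h1, h2, h3, h4⟩ := hEx hX
    omega

theorem Inst.ap_le {j i x : ℕ} : G.ap j i x ≤ G.m := by
  by_cases h : G.ap j i x = 0
  · omega
  · obtain ⟨k, hk, e⟩ := Inst.exists_match_of_ap h
    have := G.tg_lt k hk.1.1
    omega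

/-! ### The initial equations -/

/-- Adds the equations for the rules number `r` and `j`. -/
def eqnProg : Cm :=
  .for .i .k (
    .d ::= a .D (a .kap (v .p + c 1 + v .i) +
      a .T (a .crow (v .p + c 1 + v .i) + rd (v .pp + c 1 + v .i))) ;;
    .e ::= a .D (a .kap (v .pp + c 1 + v .i) +
      a .T (a .crow (v .pp + c 1 + v .i) + rd (v .p + c 1 + v .i))) ;; pushProg)

/-- The queue contains the equation for the rules `j` and `j'` and the argument position `i`. -/
def EqnIn (G : Inst I) (qs : List ((ℕ × ℕ) × (ℕ × ℕ))) (j j' i : ℕ) : Prop :=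
  G.Letter j i → G.Valid j' → G.sy j = G.sy j' → G.Live (G.tg j, G.tg j') →
    ∃ v : ℕ × ℕ, G.ap j i (G.ag j' i) = v.1 + 1 ∧ ((G.tg j, G.tg j'), v) ∈ qs

theorem EqnIn.append {qs qs' : List ((ℕ × ℕ) × (ℕ × ℕ))} {j j' i : ℕ} (h : EqnIn G qs j j' i) :
    EqnIn G (qs ++ qs') j j' i := fun h1 h2 h3 h4 => by
  obtain ⟨v, h5, h6⟩ := h h1 h2 h3 h4
  exact ⟨v, h5, List.mem_append_left _ h6⟩

theorem wp_eqn {σ : St} {qs : List ((ℕ × ℕ) × (ℕ × ℕ))} (hE : Env G σ.a) (hQ : Queue G σ qs)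
    {j j' : ℕ} (hj : G.Valid j) (hj' : G.Valid j') (hs : G.sy j = G.sy j')
    (hl : G.Live (G.tg j, G.tg j')) (hx : σ.v .x = G.nid (G.tg j, G.tg j'))
    (hk : σ.v .k = G.rk j) (hp : σ.v .p = G.st j) (hpp : σ.v .pp = G.st j') :
    wp I eqnProg (fun σ' => ∃ qs', Queue G σ' (qs ++ qs') ∧ qs'.length ≤ G.rk j ∧
      (σ'.v .ok = 1 → σ.v .ok = 1 ∧ ∀ i, EqnIn G (qs ++ qs') j j' i) ∧
      σ'.t ≤ σ.t + 2 + 11 * G.rk j) σ := by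
  unfold eqnProg
  refine wp_for (fun n σ' => ∃ qs', Queue G σ' (qs ++ qs') ∧ qs'.length ≤ n ∧
      (σ'.v .ok = 1 → σ.v .ok = 1 ∧ ∀ i < n, EqnIn G (qs ++ qs') j j' i) ∧
      σ'.t ≤ σ.t + 1 + 11 * n) rfl rfl ?_ ?_ ?_
  · refine ⟨[], ?_, by simp, by simp, by simp⟩
    rw [List.append_nil]
    exact hQ.congr rfl rfl (by simp) (by simp)
  · rintro i σ' hi hf hi' ⟨qs', hQ', hlen, hok, ht⟩
    rw [hk] at hi
    have hE' : Env G σ'.a := hE.frame hf fun b _ _ _ _ _ => by cases b <;> first | rfl | contradiction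
    have hp' : σ'.v .p = G.st j := by rw [hf.v .p rfl, hp]
    have hpp' : σ'.v .pp = G.st j' := by rw [hf.v .pp rfl, hpp]
    have hx' : σ'.v .x = G.nid (G.tg j, G.tg j') := by rw [hf.v .x rfl, hx]
    have hrk : G.rk j = G.rk j' := Inst.rk_eq hj.1 hj'.1 hs
    have hL : G.Letter j i := ⟨hj, hi⟩
    have hL' : G.Letter j' i := ⟨hj', hrk ▸ hi⟩
    have e1 : G.st j + 1 + i = G.pos j i := rfl
    have e2 : G.st j' + 1 + i = G.pos j' i := rfl
    have e3 : inp I (G.pos j i) = G.ag j i := G.inp_ag hj.1 hi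
    have e4 : inp I (G.pos j' i) = G.ag j' i := G.inp_ag hj'.1 hL'.2
    have d1 : σ'.a .D (σ'.a .kap (G.pos j i) + σ'.a .T (σ'.a .crow (G.pos j i) + G.ag j' i)) =
        G.ap j i (G.ag j' i) := hE'.look _ _ hL _ (G.ag_lt _ hj'.1 _ hL'.2)
    have d2 : σ'.a .D (σ'.a .kap (G.pos j' i) + σ'.a .T (σ'.a .crow (G.pos j' i) + G.ag j i)) =
        G.ap j' i (G.ag j i) := hE'.look _ _ hL' _ (G.ag_lt _ hj.1 _ hi)
    simp only [wp_seq, wp_set]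
    simp only [Ex.eval_v, Ex.eval_add, Ex.eval_rd, Ex.eval_a, Ex.eval_c, St.tick_a, St.tick_v,
      St.setV_a, St.setV_v, reduceCtorEq, if_true, if_false, hp', hpp', hi', e1, e2, e3, e4, d1, d2]
    refine (wp_push (qs := qs ++ qs') (w := (G.tg j, G.tg j')) (by simpa using hE')
      (hQ'.congr (by simp) (by simp) (by simp) (by simp)) hl (by simpa using hx')
      (by simpa using Inst.ap_le) (by simpa using Inst.ap_le) ?_).mono ?_
    · intro hX
      simpa using hX.equiv hL hj' hs hl
    · rintro σ₁ hf1 ⟨qs₁, h1, h2, h3, h4⟩ -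
      refine ⟨qs' ++ qs₁, ?_, by simp; omega, fun h => ?_, ?_⟩
      · rw [← List.append_assoc]
        exact h1.congr (by simp) (by simp) (by simp) (by simp)
      · obtain ⟨h5, z, h6, h7, h8, h9⟩ := h3 h
        simp at h5 h6
        obtain ⟨h10, h11⟩ := hok h5
        refine ⟨h10, fun l hl' => ?_⟩
        rw [← List.append_assoc]
        rcases Nat.lt_succ_iff_lt_or_eq.1 hl' with h | rfl
        · exact (h11 l h).append
        · exact fun _ _ _ _ => ⟨z, h6, h9⟩
      · simp at h4 ⊢
        omega
  · rintro σ' hf hi' ⟨qs', hQ', hlen, hok, ht⟩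
    rw [hk] at hlen ht hok
    refine ⟨qs', hQ'.congr rfl rfl rfl rfl, hlen, fun h => ?_, by simp; omega⟩
    obtain ⟨h1, h2⟩ := hok h
    refine ⟨h1, fun i => ?_⟩
    by_cases hi : i < G.rk j
    · exact h2 i hi
    · exact fun hL => absurd hL.2 hi

/-- The equality test: the value is zero if and only if the arguments are equal. -/
def dif (e f : Ex) : Ex := (e - f) + (f - e)

theorem eval_dif (I : List ℕ) (σ : St) (e f : Ex) :
    (dif e f).eval I σ = 0 ↔ e.eval I σ = f.eval I σ := by
  simp only [dif, Ex.eval_add, Ex.eval_sub]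
  omega

/-- Adds the equations for rule number `r`. -/
def rowProg : Cm :=
  .for .j .R (.ite (a .val (v .j)) (.pp ::= a .st (v .j) ;;
    .ite (dif (rd (v .p)) (rd (v .pp))) .skip
      (.x ::= a .nd1 (rd (v .p + c 1 + v .k)) + a .nd2 (rd (v .pp + c 1 + v .k)) ;;
        .ite (a .live (v .x)) eqnProg .skip)) .skip)

theorem wp_row {σ : St} {qs : List ((ℕ × ℕ) × (ℕ × ℕ))} (hE : Env G σ.a) (hQ : Queue G σ qs)
    {j : ℕ} (hj : G.Valid j) (hR : σ.v .R = G.R) (hk : σ.v .k = G.rk j) (hp : σ.v .p = G.st j) :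
    wp I rowProg (fun σ' => ∃ qs', Queue G σ' (qs ++ qs') ∧ qs'.length ≤ G.rk j * G.R ∧
      (σ'.v .ok = 1 → σ.v .ok = 1 ∧ ∀ j' i, EqnIn G (qs ++ qs') j j' i) ∧
      σ'.t ≤ σ.t + 2 + (9 + 11 * G.rk j) * G.R) σ := by
  unfold rowProg
  refine wp_for (fun n σ' => ∃ qs', Queue G σ' (qs ++ qs') ∧ qs'.length ≤ G.rk j * n ∧
      (σ'.v .ok = 1 → σ.v .ok = 1 ∧ ∀ j' < n, ∀ i, EqnIn G (qs ++ qs') j j' i) ∧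
      σ'.t ≤ σ.t + 1 + (9 + 11 * G.rk j) * n) rfl rfl ?_ ?_ ?_
  · refine ⟨[], ?_, by simp, by simp, by simp⟩
    rw [List.append_nil]
    exact hQ.congr rfl rfl (by simp) (by simp)
  · rintro j' σ' hj' hf hjj ⟨qs', hQ', hlen, hok, ht⟩
    rw [hR] at hj'
    have hE' : Env G σ'.a := hE.frame hf fun b _ _ _ _ _ => by cases b <;> first | rfl | contradiction
    have hp' : σ'.v .p = G.st j := by rw [hf.v .p rfl, hp]
    have hk' : σ'.v .k = G.rk j := by rw [hf.v .k rfl, hk]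
    have none : ∀ σ₁ : St, σ₁.a = σ'.a → σ₁.v .tl = σ'.v .tl → σ₁.v .ok = σ'.v .ok →
        σ₁.t ≤ σ'.t + 9 + 11 * G.rk j → (∀ i, ¬ (G.Letter j i ∧ G.Valid j' ∧ G.sy j = G.sy j' ∧
          G.Live (G.tg j, G.tg j'))) →
        ∃ qs', Queue G σ₁ (qs ++ qs') ∧ qs'.length ≤ G.rk j * (j' + 1) ∧
          (σ₁.v .ok = 1 → σ.v .ok = 1 ∧ ∀ j'' < j' + 1, ∀ i, EqnIn G (qs ++ qs') j j'' i) ∧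
          σ₁.t ≤ σ.t + 1 + (9 + 11 * G.rk j) * (j' + 1) := by
      intro σ₁ h1 h2 h3 h4 h5
      refine ⟨qs', hQ'.congr (by rw [h1]) (by rw [h1]) h2 h3, hlen.trans (by nlinarith), fun h => ?_,
        by nlinarith⟩
      rw [h3] at h
      obtain ⟨h6, h7⟩ := hok h
      refine ⟨h6, fun l hl => ?_⟩
      rcases Nat.lt_succ_iff_lt_or_eq.1 hl with h | rfl
      · exact h7 l h
      · exact fun i a b c d => absurd ⟨a, b, c, d⟩ (h5 i)
    simp only [wp_ite, wp_seq, wp_set, wp_skip, Ne, eval_dif]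
    simp only [Ex.eval_v, Ex.eval_add, Ex.eval_rd, Ex.eval_a, Ex.eval_c, St.tick_a, St.tick_v,
      St.setV_a, St.setV_v, reduceCtorEq, if_true, if_false, hjj, hp', hk', hE'.st _ hj',
      G.inp_sy hj.1, G.inp_sy hj', G.inp_tg hj.1]
    have hval := hE'.val _ hj'
    refine ⟨fun hv => ⟨fun hs _ => ?_, fun hs => ?_⟩, fun hv _ => ?_⟩
    · refine none _ (by simp) (by simp) (by simp) (by simp; omega) ?_
      rintro i ⟨-, -, h, -⟩
      exact hs h
    · have hv' := hval.1 hv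
      have hnd : G.Nd (G.tg j, G.tg j') := ⟨hj.acc_tg.lt, hv'.acc_tg.lt⟩
      have hrk : G.rk j = G.rk j' := Inst.rk_eq hj.1 hv'.1 hs
      have htg : inp I (G.st j' + 1 + G.rk j) = G.tg j' := by rw [hrk]; exact G.inp_tg hj'
      have h1 := hE'.nd _ hnd
      simp only at h1
      rw [htg, h1]
      have hlv := hE'.live _ hnd
      refine ⟨fun h2 => ?_, fun h2 _ => ?_⟩
      · refine (wp_eqn (qs := qs ++ qs') (by simpa using hE')
          (hQ'.congr (by simp) (by simp) (by simp) (by simp)) hj hv' hs (hlv.1 h2) (by simp)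
          (by simpa using hk') (by simpa using hp') (by simp)).mono ?_
        rintro σ₁ hf1 ⟨qs₁, h1, h2, h3, h4⟩ -
        refine ⟨qs' ++ qs₁, ?_, ?_, fun h => ?_, ?_⟩
        · rw [← List.append_assoc]
          exact h1.congr (by simp) (by simp) (by simp) (by simp)
        · rw [List.length_append, mul_add]; omega
        · obtain ⟨h5, h6⟩ := h3 h
          simp at h5
          obtain ⟨h10, h11⟩ := hok h5
          refine ⟨h10, fun l hl' => ?_⟩
          rw [← List.append_assoc]
          rcases Nat.lt_succ_iff_lt_or_eq.1 hl' with h | rfl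
          · exact fun i => (h11 l h i).append
          · exact h6
        · simp at h4 ⊢
          rw [mul_add]
          omega
      · refine none _ (by simp) (by simp) (by simp) (by simp; omega) ?_
        rintro i ⟨-, -, -, h⟩
        exact hlv.2 h h2
    · refine none _ (by simp) (by simp) (by simp) (by simp; omega) ?_
      rintro i ⟨-, h, -, -⟩
      exact hval.2 h hv
  · rintro σ' hf hi' ⟨qs', hQ', hlen, hok, ht⟩
    rw [hR] at hlen ht hok
    refine ⟨qs', hQ'.congr rfl rfl rfl rfl, hlen, fun h => ?_, by simp; omega⟩
    obtain ⟨h1, h2⟩ := hok h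
    refine ⟨h1, fun j' => ?_⟩
    by_cases hi : j' < G.R
    · exact h2 j' hi
    · exact fun i _ hV => absurd hV.1 hi

def eqnsProg : Cm :=
  .ok ::= c 1 ;; .tl ::= c 0 ;;
  .for .r .R (.ite (a .val (v .r)) (.p ::= a .st (v .r) ;; .k ::= rd (c 2 + rd (v .p)) ;; rowProg)
    .skip)

/-- A pair of rules costs a constant plus the rank. Summed over all pairs this is at most a constant
times R · ∑ (rk j + 2), which is quadratic; the invariant telescopes it through `I.length * st n`.
-/
theorem wp_eqns {σ : St} (hE : Env G σ.a) (hR : σ.v .R = G.R) :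
    wp I eqnsProg (fun σ' => ∃ qs, Queue G σ' qs ∧ qs.length ≤ I.length * I.length ∧
      (σ'.v .ok = 1 → ∀ j j' i, EqnIn G qs j j' i) ∧
      σ'.t ≤ σ.t + 20 * (I.length * I.length)) σ := by
  have hsz := G.size_le
  unfold eqnsProg
  simp only [wp_seq, wp_set]
  refine wp_for (fun n σ' => ∃ qs, Queue G σ' qs ∧
      qs.length + I.length * G.st 0 ≤ I.length * G.st n ∧
      (σ'.v .ok = 1 → ∀ j < n, ∀ j' i, EqnIn G qs j j' i) ∧
      σ'.t + 12 * (I.length * G.st 0) ≤ σ.t + 3 + 12 * (I.length * G.st n)) rfl rfl ?_ ?_ ?_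
  · refine ⟨[], ⟨by simp, by simp, by simp, by simp, by simp⟩, by simp, by simp, by simp⟩
  · rintro j σ' hj hf hjj ⟨qs, hQ, hlen, hok, ht⟩
    simp [hR] at hj
    have hE' : Env G σ'.a := by
      refine Env.frame ?_ hf fun b _ _ _ _ _ => by cases b <;> first | rfl | contradiction
      simpa using hE
    have hR' : σ'.v .R = G.R := by rw [hf.v .R rfl]; simp [hR]
    have hst := G.st_succ j hj
    have hmul : I.length * G.st (j + 1) = I.length * G.st j + (I.length * G.rk j + 2 * I.length) := by
      rw [hst]; ring
    have hmr : G.rk j * G.R ≤ I.length * G.rk j := by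
      rw [mul_comm]; exact Nat.mul_le_mul_right _ (by omega)
    simp only [wp_ite, wp_seq, wp_set, wp_skip]
    simp only [Ex.eval_v, Ex.eval_add, Ex.eval_rd, Ex.eval_a, Ex.eval_c, St.tick_a, St.tick_v,
      St.setV_a, St.setV_v, reduceCtorEq, if_true, if_false, hjj, hE'.st _ hj, G.inp_sy hj,
      G.inp_rk hj]
    have hval := hE'.val _ hj
    refine ⟨fun hv => ?_, fun hv _ => ?_⟩
    · refine (wp_row (qs := qs) (by simpa using hE')
          (hQ.congr (by simp) (by simp) (by simp) (by simp)) (hval.1 hv) (by simpa using hR')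
          (by simp) (by simp)).mono ?_
      rintro σ₁ hf1 ⟨qs₁, h1, h2, h3, h4⟩ -
      refine ⟨qs ++ qs₁, h1.congr (by simp) (by simp) (by simp) (by simp), ?_, fun h => ?_, ?_⟩
      · rw [List.length_append]; omega
      · obtain ⟨h5, h6⟩ := h3 h
        simp at h5
        intro l hl'
        rcases Nat.lt_succ_iff_lt_or_eq.1 hl' with h | rfl
        · exact fun j' i => (hok h5 l h j' i).append
        · exact h6
      · simp at h4 ⊢
        have : (9 + 11 * G.rk j) * G.R = 9 * G.R + 11 * (G.rk j * G.R) := by ring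
        omega
    · refine ⟨qs, hQ.congr (by simp) (by simp) (by simp) (by simp), by omega, fun h => ?_,
        by simp; omega⟩
      intro l hl'
      rcases Nat.lt_succ_iff_lt_or_eq.1 hl' with h' | rfl
      · exact hok (by simpa using h) l h'
      · exact fun j' i hL => absurd hv (hval.2 hL.1)
  · rintro σ' hf hi' ⟨qs, hQ, hlen, hok, ht⟩
    simp [hR] at hlen ht hok
    rw [G.st_R] at hlen ht
    have : I.length * 3 ≤ I.length * I.length := Nat.mul_le_mul_left _ (by omega)
    refine ⟨qs, hQ.congr rfl rfl rfl rfl, by omega, fun h j j' i => ?_, by simp; omega⟩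
    by_cases hi : j < G.R
    · exact hok h j hi j' i
    · exact fun hL => absurd hL.1.1 hi

end TreeAut

namespace TreeAut

open Cm Ex

/-! ### Merging classes -/

section merge

variable {α : Type*} [DecidableEq α] {N : Finset α} {ρ : α → α} {a b : α}

/-- Gives the members of class `a` the label `b`. -/
def merge (ρ : α → α) (a b u : α) : α := if ρ u = a then b else ρ u

/-- The size of class `r`. -/
def csz (N : Finset α) (ρ : α → α) (r : α) : ℕ := (N.filter fun u => ρ u = r).card

/-- A potential for the number of changes of labels. -/
def psi (N : Finset α) (ρ : α → α) : ℕ := ∑ u ∈ N, (Nat.log 2 N.card - Nat.log 2 (csz N ρ (ρ u)))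

/-- A potential for the data of the labels that are in use. -/
def theta (N : Finset α) (f : α → ℕ) (ρ : α → α) : ℕ := ∑ u ∈ N with ρ u = u, (f u + 1)

theorem merge_eq_merge {u v : α} (h : merge ρ a b u = merge ρ a b v) :
    ρ u = ρ v ∨ (ρ u = a ∧ ρ v = b) ∨ (ρ u = b ∧ ρ v = a) := by
  unfold merge at h
  split_ifs at h with h1 h2 h2
  · exact .inl (h1.trans h2.symm)
  · exact .inr (.inl ⟨h1, h.symm⟩)
  · exact .inr (.inr ⟨h, h2⟩)
  · exact .inl h

theorem csz_merge_le {r : α} (hr : r ≠ a) : csz N ρ r ≤ csz N (merge ρ a b) r := by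
  refine Finset.card_le_card fun u hu => ?_
  rw [Finset.mem_filter] at hu ⊢
  refine ⟨hu.1, ?_⟩
  rw [merge, if_neg (by rw [hu.2]; exact hr), hu.2]

theorem csz_merge (hab : a ≠ b) : csz N (merge ρ a b) b = csz N ρ a + csz N ρ b := by
  unfold csz
  rw [← Finset.card_union_of_disjoint]
  · congr 1
    ext u
    rw [Finset.mem_union, Finset.mem_filter, Finset.mem_filter, Finset.mem_filter, merge]
    split_ifs with h <;> simp [h, hab]
  · rw [Finset.disjoint_left]
    intro u h1 h2
    exact hab ((Finset.mem_filter.1 h1).2.symm.trans (Finset.mem_filter.1 h2).2)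

/-- Each relabelled element moves into a class at least twice as large, so its term drops by at
least one; other terms do not grow. The truncated subtraction is harmless because no class is larger
than `N`. -/
theorem psi_merge (hab : a ≠ b) (hle : csz N ρ a ≤ csz N ρ b) :
    psi N (merge ρ a b) + csz N ρ a ≤ psi N ρ := by
  have h1 : csz N ρ a = ∑ u ∈ N, if ρ u = a then 1 else 0 := by
    rw [csz, Finset.card_filter]
  unfold psi
  conv_lhs => rw [h1]
  rw [← Finset.sum_add_distrib]
  refine Finset.sum_le_sum fun u hu => ?_
  by_cases h : ρ u = a
  · have h2 : merge ρ a b u = b := by simp [merge, h]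
    rw [if_pos h, h2, h, csz_merge hab]
    have h3 : 0 < csz N ρ a := Finset.card_pos.2 ⟨u, Finset.mem_filter.2 ⟨hu, h⟩⟩
    have h4 : Nat.log 2 (csz N ρ a) + 1 ≤ Nat.log 2 (csz N ρ a + csz N ρ b) := by
      rw [← Nat.log_mul_base one_lt_two (by omega)]
      exact Nat.log_mono_right (by omega)
    have h5 : Nat.log 2 (csz N ρ a + csz N ρ b) ≤ Nat.log 2 N.card := by
      rw [← csz_merge hab]
      exact Nat.log_mono_right (Finset.card_filter_le _ _)
    omega
  · have h2 : merge ρ a b u = ρ u := by simp [merge, h]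
    rw [if_neg h, h2]
    have := Nat.log_mono_right (b := 2) (csz_merge_le (N := N) (ρ := ρ) (b := b) h)
    omega

theorem psi_le : psi N ρ ≤ N.card * Nat.log 2 N.card :=
  Finset.sum_le_card_nsmul _ _ _ fun _ _ => Nat.sub_le _ _

/-- After the merge `a` is no longer a fixed point and no new fixed point arises, so the weight `f a
+ 1` is released exactly when label `a` disappears. -/
theorem theta_merge (f : α → ℕ) (hab : a ≠ b) (ha : ρ a = a) (hb : ρ b = b) (haN : a ∈ N) :
    theta N f (merge ρ a b) + (f a + 1) ≤ theta N f ρ := by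
  unfold theta
  have h1 : a ∉ N.filter fun u => merge ρ a b u = u := by
    rw [Finset.mem_filter, merge, if_pos ha]
    exact fun h => hab h.2.symm
  rw [add_comm, ← Finset.sum_insert (f := fun u => f u + 1) h1]
  refine Finset.sum_le_sum_of_subset fun u hu => ?_
  rw [Finset.mem_insert, Finset.mem_filter] at hu
  rw [Finset.mem_filter]
  rcases hu with rfl | ⟨hu, h⟩
  · exact ⟨haN, ha⟩
  · refine ⟨hu, ?_⟩
    unfold merge at h
    split_ifs at h with h2
    · subst h; exact hb
    · exact h

end merge

variable {I : List ℕ} {G : Inst I}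

open Classical in
/-- The live pairs. -/
noncomputable def Inst.lives (G : Inst I) : Finset (ℕ × ℕ) :=
  (Finset.range G.m ×ˢ Finset.range G.m).filter G.Live

theorem Inst.mem_lives {u : ℕ × ℕ} : u ∈ G.lives ↔ G.Live u := by
  simp only [lives, Finset.mem_filter, Finset.mem_product, Finset.mem_range, and_iff_right_iff_imp]
  exact fun h => h.nd

/-- The arrays represent the partition of the live pairs into the classes of pairs with the same
label. -/
structure UF (G : Inst I) (f : Ar → ℕ → ℕ) (ρ : ℕ × ℕ → ℕ × ℕ) : Prop where
  lab : ∀ u, G.Live u → f .lab (G.nid u) = G.nid (ρ u)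
  live : ∀ u, G.Live u → G.Live (ρ u)
  idem : ∀ u, G.Live u → ρ (ρ u) = ρ u
  cls : ∀ r, G.Live r → ρ r = r → ∃ ls : List (ℕ × ℕ), ls.Nodup ∧
    (∀ u, u ∈ ls ↔ G.Live u ∧ ρ u = r) ∧
    cells (f .mem) (G.nid r) (f .size (G.nid r)) = ls.map G.nid

theorem UF.congr {f f' : Ar → ℕ → ℕ} {ρ : ℕ × ℕ → ℕ × ℕ} (h : UF G f ρ) (h1 : f' .lab = f .lab)
    (h2 : f' .mem = f .mem) (h3 : f' .size = f .size) : UF G f' ρ :=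
  ⟨by rw [h1]; exact h.lab, h.live, h.idem, by rw [h2, h3]; exact h.cls⟩

theorem UF.size {f : Ar → ℕ → ℕ} {ρ : ℕ × ℕ → ℕ × ℕ} (h : UF G f ρ) {r : ℕ × ℕ} (hr : G.Live r)
    (hρ : ρ r = r) : f .size (G.nid r) = csz G.lives ρ r := by
  obtain ⟨ls, h1, h2, h3⟩ := h.cls r hr hρ
  have h4 := congrArg List.length h3
  rw [length_cells, List.length_map] at h4
  rw [h4, csz, ← List.toFinset_card_of_nodup h1]
  congr 1
  ext u
  simp [h2, Inst.mem_lives]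

/-- Merges class `a` into class `b`. -/
def relabelProg : Cm :=
  .n ::= a .size (v .a) ;; .g ::= a .size (v .b) ;;
  .for .j .n (.x ::= a .mem (v .a + v .j) ;; put .lab (v .x) (v .b) ;;
    put .mem (v .b + v .g) (v .x) ;; .g ::= v .g + c 1) ;;
  put .size (v .b) (v .g)

/-- The members of `ra` are appended to the list of `rb`. The two lists together have at most m²
entries, which fits into the gap behind `nid rb`. -/
theorem wp_relabel {σ : St} {ρ : ℕ × ℕ → ℕ × ℕ} (hU : UF G σ.a ρ) {ra rb : ℕ × ℕ}
    (hla : G.Live ra) (hlb : G.Live rb) (hra : ρ ra = ra) (hrb : ρ rb = rb) (hab : ra ≠ rb)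
    (hva : σ.v .a = G.nid ra) (hvb : σ.v .b = G.nid rb) :
    wp I relabelProg (fun σ' => UF G σ'.a (merge ρ ra rb) ∧
      σ'.t ≤ σ.t + 5 + 6 * csz G.lives ρ ra) σ := by
  have hsz := G.size_le
  have hmm : G.m * G.m < I.length * I.length := by nlinarith
  obtain ⟨la, a1, a2, a3⟩ := hU.cls ra hla hra
  obtain ⟨lb, b1, b2, b3⟩ := hU.cls rb hlb hrb
  have ka : σ.a .size (G.nid ra) = la.length := by
    have := congrArg List.length a3
    simpa using this
  have kb : σ.a .size (G.nid rb) = lb.length := by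
    have := congrArg List.length b3
    simpa using this
  have hcs := hU.size hla hra
  have hlab : (lb ++ la).Nodup := b1.append a1 fun u h1 h2 =>
    hab (((a2 u).1 h2).2.symm.trans ((b2 u).1 h1).2)
  have hlen : lb.length + la.length ≤ G.m * G.m := by
    rw [← List.length_append]
    refine Inst.length_le_of_nodup hlab fun u hu => ?_
    rcases List.mem_append.1 hu with h | h
    · exact ((b2 u).1 h).1.nd
    · exact ((a2 u).1 h).1.nd
  -- The bound on all member lists ensures that writing behind the list of `rb` does not reach the
  -- list of another class.
  have hcap : ∀ r, G.Live r → ρ r = r → σ.a .size (G.nid r) ≤ G.m * G.m := fun r h1 h2 => by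
    obtain ⟨lr, c1, c2, c3⟩ := hU.cls r h1 h2
    have := congrArg List.length c3
    simp only [length_cells, List.length_map] at this
    rw [this]
    exact Inst.length_le_of_nodup c1 fun u hu => ((c2 u).1 hu).1.nd
  unfold relabelProg
  simp only [wp_seq, wp_set, Ex.eval_a, Ex.eval_v, hva]
  refine wp_for (fun j σ' => (∀ u, G.Live u → σ'.a .lab (G.nid u) =
      G.nid (if u ∈ la.take j then rb else ρ u)) ∧
    cells (σ'.a .mem) (G.nid rb) (lb.length + j) = (lb ++ la.take j).map G.nid ∧
    (∀ r, G.Live r → ρ r = r → r ≠ rb → cells (σ'.a .mem) (G.nid r) (σ.a .size (G.nid r)) =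
      cells (σ.a .mem) (G.nid r) (σ.a .size (G.nid r))) ∧ σ'.v .g = lb.length + j ∧
      σ'.t ≤ σ.t + 3 + 6 * j) rfl rfl ?_ ?_ ?_
  · refine ⟨fun u hu => ?_, ?_, ?_, ?_, ?_⟩
    · simp [hU.lab u hu]
    · rw [kb] at b3
      simp [b3]
    · simp
    · simp [hvb, kb]
    · simp
  · rintro j σ' hj hf hj' ⟨h1, h2, h3, h4, h5⟩
    simp [ka] at hj
    obtain ⟨w, hw⟩ : ∃ w, la[j] = w := ⟨_, rfl⟩
    have hwm : w ∈ la := hw ▸ List.getElem_mem hj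
    have hwl := ((a2 w).1 hwm).1
    have hva' : σ'.v .a = G.nid ra := by rw [hf.v .a rfl]; simp [hva]
    have hvb' : σ'.v .b = G.nid rb := by rw [hf.v .b rfl]; simp [hvb]
    have hmem : σ'.a .mem (G.nid ra + j) = G.nid w := by
      have c1 := h3 ra hla hra hab
      rw [a3] at c1
      have c2 : j < (cells (σ'.a .mem) (G.nid ra) (σ.a .size (G.nid ra))).length := by
        simpa [ka] using hj
      rw [← getElem_cells c2]
      simp only [c1, List.getElem_map, hw]
    have htk : la.take (j + 1) = la.take j ++ [w] := by
      rw [List.take_succ_eq_append_getElem hj, hw]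
    simp only [wp_seq, wp_set, wp_put]
    simp only [Ex.eval_a, Ex.eval_v, Ex.eval_add, Ex.eval_c, St.tick_a, St.tick_v, St.tick_t,
        St.setV_a, St.setV_v, St.setV_t, St.setA_a, St.setA_v, St.setA_t, hva', hvb', hj', hmem, h4,
        reduceCtorEq, if_true, if_false]
    intro _
    refine ⟨fun u hu => ?_, ?_, fun r c1 c2 c3 => ?_, by omega, by omega⟩
    · rw [htk]
      by_cases e : u = w
      · subst e; simp
      · rw [Function.update_of_ne fun h' => e (Inst.nid_inj hu.nd hwl.nd h'), h1 u hu]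
        simp [e]
    · have := cells_update_end (σ'.a .mem) (G.nid rb) (lb.length + j) (G.nid w)
      rw [← add_assoc lb.length j 1, this, h2, htk]
      simp
    · rw [cells_update_of_ne, h3 r c1 c2 c3]
      intro i hi h'
      have := hcap r c1 c2
      exact c3 (Inst.nid_add_inj c1.nd hlb.nd (by omega) (by omega) h').1
  · rintro σ₁ hf - ⟨h1, h2, h3, h4, h5⟩
    have hvb' : σ₁.v .b = G.nid rb := by rw [hf.v .b rfl]; simp [hvb]
    have hsize : σ₁.a .size = σ.a .size := by rw [hf.a .size rfl]; simp
    replace h1 : ∀ u, G.Live u → σ₁.a .lab (G.nid u) = G.nid (if u ∈ la then rb else ρ u) :=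
      fun u hu => by simpa [ka] using h1 u hu
    simp [ka] at h2 h4 h5
    simp only [wp_put]
    simp only [Ex.eval_a, Ex.eval_v, Ex.eval_add, Ex.eval_c, St.tick_a, St.tick_v, St.tick_t,
        St.setV_a, St.setV_v, St.setV_t, St.setA_a, St.setA_v, St.setA_t, hvb', h4,
        reduceCtorEq, if_true, if_false]
    have hlabel : ∀ u, G.Live u → (if u ∈ la then rb else ρ u) = merge ρ ra rb u := by
      intro u hu
      unfold merge
      simp [a2, hu]
    refine ⟨⟨fun u hu => ?_, fun u hu => ?_, fun u hu => ?_, fun r hr hρ => ?_⟩, by omega⟩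
    · simp only [St.setA_a, St.tick_a, reduceCtorEq, if_false]
      rw [h1 u hu, hlabel u hu]
    · unfold merge
      split_ifs
      · exact hlb
      · exact hU.live u hu
    · by_cases h : ρ u = ra
      · simp [merge, h, hrb]
      · simp [merge, h, hU.idem u hu]
    · simp only [St.setA_a, St.tick_a, reduceCtorEq, if_false, if_true, hsize]
      by_cases e : r = rb
      · subst e
        rw [Function.update_self]
        refine ⟨lb ++ la, hlab, fun u => ?_, by simpa using h2⟩
        rw [List.mem_append, a2, b2, ← and_or_left]
        refine and_congr_right fun _ => ?_
        unfold merge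
        split_ifs with h
        · simp [h]
        · simp [h]
      · rw [Function.update_of_ne fun h' => e (Inst.nid_inj hr.nd hlb.nd h')]
        have hr' : ρ r = r := by
          unfold merge at hρ
          split_ifs at hρ with h
          · exact absurd hρ.symm e
          · exact hρ
        obtain ⟨lr, c1, c2, c3⟩ := hU.cls r hr hr'
        refine ⟨lr, c1, fun u => ?_, by rw [h3 r hr hr' e, c3]⟩
        rw [c2]
        refine and_congr_right fun _ => ?_
        unfold merge
        split_ifs with h
        · rw [h]
          constructor
          · rintro rfl
            simp [merge, hra] at hρ
            exact absurd hρ.symm hab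
          · intro h'; exact absurd h'.symm e
        · rfl

/-- Merges the classes `a` and `b`. -/
def mergeProg : Cm :=
  .ite (a .size (v .a) - a .size (v .b)) (.x ::= v .a ;; .a ::= v .b ;; .b ::= v .x) .skip ;;
  relabelProg

theorem wp_merge {σ : St} {ρ : ℕ × ℕ → ℕ × ℕ} (hU : UF G σ.a ρ) {ra rb : ℕ × ℕ}
    (hla : G.Live ra) (hlb : G.Live rb) (hra : ρ ra = ra) (hrb : ρ rb = rb) (hab : ra ≠ rb)
    (hva : σ.v .a = G.nid ra) (hvb : σ.v .b = G.nid rb) :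
    wp I mergeProg (fun σ' => ∃ a b, (a = ra ∧ b = rb ∨ a = rb ∧ b = ra) ∧
      csz G.lives ρ a ≤ csz G.lives ρ b ∧ UF G σ'.a (merge ρ a b) ∧
      σ'.t ≤ σ.t + 9 + 6 * csz G.lives ρ a) σ := by
  have ha := hU.size hla hra
  have hb := hU.size hlb hrb
  unfold mergeProg
  rw [wp_seq, wp_ite]
  simp only [wp_seq, wp_set, wp_skip, Ex.eval_sub, Ex.eval_a, Ex.eval_v, hva, hvb, ha, hb]
  constructor
  · intro h
    refine (wp_relabel (ra := rb) (rb := ra) (ρ := ρ) ?_ hlb hla hrb hra hab.symm ?_ ?_).mono ?_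
    · simpa using hU
    · simp [hvb]
    · simp [hva]
    · rintro σ' - ⟨h1, h2⟩
      refine ⟨rb, ra, .inr ⟨rfl, rfl⟩, by omega, h1, ?_⟩
      simp at h2
      omega
  · intro h
    refine (wp_relabel (ra := ra) (rb := rb) (ρ := ρ) ?_ hla hlb hra hrb hab ?_ ?_).mono ?_
    · simpa using hU
    · simp [hva]
    · simp [hvb]
    · rintro σ' - ⟨h1, h2⟩
      refine ⟨ra, rb, .inl ⟨rfl, rfl⟩, by omega, h1, ?_⟩
      simp at h2
      omega

/-! ### Equations between successors -/

/-- A letter stored for `u` is given by a rule with argument `u.1`, so the first component of the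
successor of `u` is the target of this rule. The other component and the successor of the second
pair come from lookups. -/
def succProg : Cm :=
  .n ::= a .fcnt (v .u) ;; .row ::= a .snd (v .u) ;; .p ::= a .fst (v .z) ;;
  .q ::= a .snd (v .z) ;;
  .for .j .n (.pos ::= a .fadj (v .u + v .j) ;;
    .x ::= a .nd1 (a .tgt (v .pos)) +
      a .nd2 (a .D (a .kap (v .pos) + a .T (a .crow (v .pos) + v .row)) - c 1) ;;
    .d ::= a .D (a .kap (v .pos) + a .T (a .crow (v .pos) + v .p)) ;;
    .e ::= a .D (a .kap (v .pos) + a .T (a .crow (v .pos) + v .q)) ;; pushProg)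

theorem wp_succ {σ : St} {qs : List ((ℕ × ℕ) × (ℕ × ℕ))} (hE : Env G σ.a) (hQ : Queue G σ qs)
    {u v : ℕ × ℕ} (hu : G.Live u) (hv : G.Live v) (hvu : σ.v .u = G.nid u) (hvz : σ.v .z = G.nid v)
    (hEq : G.Exchange → G.Equiv u v) :
    wp I succProg (fun σ' => ∃ qs', Queue G σ' (qs ++ qs') ∧ qs'.length ≤ (G.liveOut u).ncard ∧
      (σ'.v .ok = 1 → σ.v .ok = 1 ∧ ∀ l ∈ G.liveOut u, ∃ w z, G.Step l.1 l.2 u w ∧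
        G.Step l.1 l.2 v z ∧ G.Live z ∧ (w, z) ∈ qs ++ qs') ∧
      σ'.t ≤ σ.t + 6 + 13 * (G.liveOut u).ncard) σ := by
  obtain ⟨ls, l1, l2⟩ := hE.out u hu.nd
  have hcnt := hE.cnt u hu.nd
  have hlen : (G.liveOut u).ncard = ls.length := by
    have := congrArg List.length l2
    rw [length_cells, List.length_map, hcnt] at this
    exact this
  rw [hcnt, hlen] at l2
  rw [hlen]
  rw [hlen] at hcnt
  unfold succProg
  simp only [wp_seq, wp_set, Ex.eval_a, Ex.eval_v, hvu]
  refine wp_for (fun n σ' => ∃ qs', Queue G σ' (qs ++ qs') ∧ qs'.length ≤ n ∧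
      (σ'.v .ok = 1 → σ.v .ok = 1 ∧ ∀ l ∈ ls.take n, ∃ w z, G.Step l.1 l.2 u w ∧
        G.Step l.1 l.2 v z ∧ G.Live z ∧ (w, z) ∈ qs ++ qs') ∧
      σ'.t ≤ σ.t + 5 + 13 * n) rfl rfl ?_ ?_ ?_
  · refine ⟨[], ?_, by simp, by simp, by simp⟩
    rw [List.append_nil]
    exact hQ.congr (by simp) (by simp) (by simp) (by simp)
  · rintro j σ' hj hf hj' ⟨qs', hQ', hle, hok, ht⟩
    simp [hcnt] at hj
    have hE' : Env G σ'.a := by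
      refine Env.frame ?_ hf fun b _ _ _ _ _ => by cases b <;> first | rfl | contradiction
      simpa using hE
    have w1 : σ'.v .u = G.nid u := by rw [hf.v .u rfl]; simp [hvu]
    have w2 : σ'.v .row = u.2 := by rw [hf.v .row rfl]; simp [hvu, hE.snd u hu.nd]
    have w3 : σ'.v .p = v.1 := by rw [hf.v .p rfl]; simp [hvz, hE.fst v hv.nd]
    have w4 : σ'.v .q = v.2 := by rw [hf.v .q rfl]; simp [hvz, hE.snd v hv.nd]
    have hfadj : σ'.a .fadj = σ.a .fadj := by rw [hf.a .fadj rfl]; simp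
    obtain ⟨l, hl⟩ : ∃ l, ls[j] = l := ⟨_, rfl⟩
    have hlm : l ∈ G.liveOut u := (l1 l).1 (hl ▸ List.getElem_mem hj)
    obtain ⟨hL, hag, w, hw, hwl⟩ := hlm
    have hpos : σ'.a .fadj (G.nid u + j) = G.pos l.1 l.2 := by
      have c2 : j < (cells (σ.a .fadj) (G.nid u) ls.length).length := by simpa using hj
      rw [hfadj, ← getElem_cells c2]
      simp only [l2, List.getElem_map, hl]
    have htk : ls.take (j + 1) = ls.take j ++ [l] := by
      rw [List.take_succ_eq_append_getElem hj, hl]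
    have d1 := hE'.look _ _ hL _ hu.nd.2
    have d2 := hE'.look _ _ hL _ hv.nd.1
    have d3 := hE'.look _ _ hL _ hv.nd.2
    have d4 := hE'.tgt _ _ hL
    have d5 : G.tg l.1 = w.1 := by
      have h1 := hL.ap_self
      rw [hag, hw.1] at h1
      omega
    have d6 := hE'.nd w hwl.nd
    simp only [wp_seq, wp_set]
    simp only [Ex.eval_v, Ex.eval_add, Ex.eval_sub, Ex.eval_a, Ex.eval_c, St.tick_a, St.tick_v,
      St.setV_a, St.setV_v, reduceCtorEq, if_true, if_false, w1, w2, w3, w4, hj', hpos, d1, d2, d3,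
      d4, d5, hw.2, Nat.add_sub_cancel, d6]
    refine (wp_push (qs := qs ++ qs') (w := w) (by simpa using hE')
      (hQ'.congr (by simp) (by simp) (by simp) (by simp)) hwl (by simp)
      (by simpa using Inst.ap_le) (by simpa using Inst.ap_le) ?_).mono ?_
    · intro hX
      obtain ⟨z, z1, z2, z3⟩ := (hEq hX).step hL hw hwl
      exact ⟨z, by simpa using z1.1, by simpa using z1.2, z2, z3⟩
    · rintro σ₁ hf1 ⟨qs₁, h1, h2, h3, h4⟩ -
      refine ⟨qs' ++ qs₁, ?_, by simp; omega, fun h => ?_, ?_⟩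
      · rw [← List.append_assoc]
        exact h1.congr (by simp) (by simp) (by simp) (by simp)
      · obtain ⟨h5, z, h6, h7, h8, h9⟩ := h3 h
        simp at h5 h6 h7
        obtain ⟨h10, h11⟩ := hok h5
        refine ⟨h10, fun l' hl' => ?_⟩
        rw [← List.append_assoc]
        rw [htk] at hl'
        rcases List.mem_append.1 hl' with h | h
        · obtain ⟨w', z', i1, i2, i3, i4⟩ := h11 l' h
          exact ⟨w', z', i1, i2, i3, List.mem_append_left _ i4⟩
        · rw [List.mem_singleton.1 h]
          exact ⟨w, z, hw, ⟨h6, h7⟩, h8, h9⟩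
      · simp at h4 ⊢
        omega
  · rintro σ' hf hi' ⟨qs', hQ', hle, hok, ht⟩
    simp [hcnt] at hle ht hok
    refine ⟨qs', hQ'.congr rfl rfl rfl rfl, hle, fun h => ?_, by simp; omega⟩
    obtain ⟨h1, h2⟩ := hok h
    refine ⟨h1, fun l hl => ?_⟩
    simpa using h2 _ _ ((l1 l).2 hl)

end TreeAut

/-! ### The main loop of the congruence closure and its amortized time -/

namespace TreeAut

open Cm Ex

variable {I : List ℕ} {G : Inst I}

theorem Inst.AccFin.iff {u : ℕ × ℕ} (hu : G.Live u) : G.AccFin u ↔ G.Fin2 u :=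
  ⟨fun h => h.2.2, fun h => ⟨hu.acc.1, hu.acc.2, h⟩⟩

/-- Merges classes until all equations in the queue are satisfied. -/
def closeProg : Cm :=
  .hd ::= c 0 ;; .loop (v .tl - v .hd) (.u ::= a .QU (v .hd) ;; .z ::= a .QV (v .hd) ;;
    .hd ::= v .hd + c 1 ;;
    .ite (v .ok) (.a ::= a .lab (v .u) ;; .b ::= a .lab (v .z) ;;
      .ite (dif (v .a) (v .b))
        (.ite (dif (a .fin (v .u)) (a .fin (v .z)) + dif (a .fcnt (v .u)) (a .fcnt (v .z)))
          (.ok ::= c 0) (mergeProg ;; succProg)) .skip) .skip)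

/-- The invariant of the main loop. -/
structure CloseInv (G : Inst I) (σ : St) (qs : List ((ℕ × ℕ) × (ℕ × ℕ)))
    (ρ : ℕ × ℕ → ℕ × ℕ) : Prop where
  env : Env G σ.a
  queue : Queue G σ qs
  hd : σ.v .hd ≤ qs.length
  uf : UF G σ.a ρ
  deg : ∀ u v, G.Live u → G.Live v → ρ u = ρ v → (G.liveOut u).ncard = (G.liveOut v).ncard
  eqn : σ.v .ok = 1 → ∀ j j' i, EqnIn G qs j j' i
  done : σ.v .ok = 1 → ∀ e ∈ qs.take (σ.v .hd), ρ e.1 = ρ e.2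
  cl : σ.v .ok = 1 → ∀ u v, G.Live u → G.Live v → ρ u = ρ v → G.Cl (fun u v => (u, v) ∈ qs) u v

/-- Once the whole queue is processed, the kernel of `ρ` contains all equations, so the hypotheses
of `Inst.Exchange.of_closure` are met with this equivalence relation. -/
theorem CloseInv.exchange {σ : St} {qs : List ((ℕ × ℕ) × (ℕ × ℕ))} {ρ : ℕ × ℕ → ℕ × ℕ}
    (h : CloseInv G σ qs ρ) (hd : σ.v .hd = qs.length) (hok : σ.v .ok = 1) : G.Exchange := by
  have hdone := h.done hok
  rw [hd, List.take_length] at hdone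
  exact Inst.Exchange.of_closure (fun u v => ρ u = ρ v)
    ⟨fun _ => rfl, fun h => h.symm, fun h h' => h.trans h'⟩ (fun u v he => h.queue.live _ he)
    (fun u v he => hdone _ he) (h.cl hok) (h.eqn hok)

/-- The out-degree of a pair. -/
noncomputable def Inst.deg (G : Inst I) (u : ℕ × ℕ) : ℕ := (G.liveOut u).ncard

/-- The invariant with the bound `T` for the time, and a measure that decreases. -/
def CloseStep (G : Inst I) (T n : ℕ) (σ : St) : Prop :=
  ∃ qs ρ, CloseInv G σ qs ρ ∧ n = qs.length - σ.v .hd + theta G.lives G.deg ρ ∧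
    σ.t + 20 * (qs.length - σ.v .hd) + 40 * theta G.lives G.deg ρ + 10 * psi G.lives ρ ≤ T

/-- Merging class `x` takes a constant plus 6 steps for each of its members and 13 for each letter
of `u`, and queues at most `deg u` equations of price 20. The potentials release 10 times the size
of `x` and `40 * (deg u + 1)`, and the processed equation releases 20. The measure decreases since
`theta` loses at least `deg u + 1`, more than the number of new equations. -/
theorem wp_closeStep {T n : ℕ} {σ : St} (h : CloseStep G T n σ)
    (hc : (v .tl - v .hd).eval I σ ≠ 0) :
    wp I (.u ::= a .QU (v .hd) ;; .z ::= a .QV (v .hd) ;; .hd ::= v .hd + c 1 ;;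
      .ite (v .ok) (.a ::= a .lab (v .u) ;; .b ::= a .lab (v .z) ;;
      .ite (dif (v .a) (v .b))
        (.ite (dif (a .fin (v .u)) (a .fin (v .z)) + dif (a .fcnt (v .u)) (a .fcnt (v .z)))
          (.ok ::= c 0) (mergeProg ;; succProg)) .skip) .skip)
      (fun σ' => ∃ n' < n, CloseStep G T n' σ') σ.tick := by
  obtain ⟨qs, ρ, hI, hn, ht⟩ := h
  have htl := hI.queue.tl
  simp only [Ex.eval_sub, Ex.eval_v, htl] at hc
  have hlt : σ.v .hd < qs.length := by omega
  obtain ⟨e, he⟩ : ∃ e, qs[σ.v .hd] = e := ⟨_, rfl⟩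
  obtain ⟨u, w⟩ := e
  have hmem : (u, w) ∈ qs := he ▸ List.getElem_mem hlt
  obtain ⟨hu, hw⟩ := hI.queue.live _ hmem
  simp only at hu hw
  have hQU : σ.a .QU (σ.v .hd) = G.nid u := by
    have h1 : σ.v .hd < (cells (σ.a .QU) 0 (σ.v .tl)).length := by simpa [htl] using hlt
    have h2 := getElem_cells h1
    rw [zero_add] at h2
    rw [← h2]
    simp only [hI.queue.left, List.getElem_map, he]
  have hQV : σ.a .QV (σ.v .hd) = G.nid w := by
    have h1 : σ.v .hd < (cells (σ.a .QV) 0 (σ.v .tl)).length := by simpa [htl] using hlt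
    have h2 := getElem_cells h1
    rw [zero_add] at h2
    rw [← h2]
    simp only [hI.queue.right, List.getElem_map, he]
  have hlu := hI.uf.lab u hu
  have hlw := hI.uf.lab w hw
  have hru := hI.uf.live u hu
  have hrw := hI.uf.live w hw
  have htake : qs.take (σ.v .hd + 1) = qs.take (σ.v .hd) ++ [(u, w)] := by
    rw [List.take_succ_eq_append_getElem hlt, he]
  -- the cases without a change of the classes
  have same : ∀ σ' : St, σ'.a = σ.a → σ'.v .tl = σ.v .tl → σ'.v .hd = σ.v .hd + 1 →
      σ'.t ≤ σ.t + 20 → (σ'.v .ok = σ.v .ok ∧ (σ.v .ok = 1 → ρ u = ρ w) ∨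
        σ'.v .ok = 0 ∧ ¬ G.Exchange) → ∃ n' < n, CloseStep G T n' σ' := by
    intro σ' h1 h2 h3 h4 h5
    have hle : σ'.v .ok = 1 → σ.v .ok = 1 ∧ ρ u = ρ w := fun h => by
      rcases h5 with ⟨h5, h6⟩ | ⟨h5, -⟩
      · rw [h] at h5; exact ⟨h5.symm, h6 h5.symm⟩
      · omega
    refine ⟨_, ?_, qs, ρ, ⟨by rw [h1]; exact hI.env, ?_, by omega, by rw [h1]; exact hI.uf, hI.deg,
      fun h => hI.eqn (hle h).1, fun h => ?_, fun h => hI.cl (hle h).1⟩, rfl, by omega⟩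
    · omega
    · rcases h5 with ⟨h5, -⟩ | ⟨h5, h6⟩
      · exact hI.queue.congr (by rw [h1]) (by rw [h1]) h2 h5
      · exact hI.queue.fail (by rw [h1]) (by rw [h1]) h2 h5 h6
    · rw [h3, htake]
      intro e he
      rcases List.mem_append.1 he with h' | h'
      · exact hI.done (hle h).1 e h'
      · rw [List.mem_singleton.1 h']; exact (hle h).2
  generalize hP : (fun σ' => ∃ n' < n, CloseStep G T n' σ') = P
  have same' : ∀ σ' : St, σ'.a = σ.a → σ'.v .tl = σ.v .tl → σ'.v .hd = σ.v .hd + 1 →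
      σ'.t ≤ σ.t + 20 → (σ'.v .ok = σ.v .ok ∧ (σ.v .ok = 1 → ρ u = ρ w) ∨
        σ'.v .ok = 0 ∧ ¬ G.Exchange) → P σ' := by rw [← hP]; exact same
  have hfin := hI.env.fin u w hu hw
  have hcu : σ.a .fcnt (G.nid u) = G.deg u := hI.env.cnt u hu.nd
  have hcw : σ.a .fcnt (G.nid w) = G.deg w := hI.env.cnt w hw.nd
  simp only [wp_seq, wp_set, wp_skip, wp_ite, Ne, Ex.eval_add, Nat.add_eq_zero_iff, eval_dif]
  simp only [Ex.eval_v, Ex.eval_add, Ex.eval_sub, Ex.eval_a, Ex.eval_c, St.tick_a, St.tick_v,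
    St.setV_a, St.setV_v, reduceCtorEq, if_true, if_false, hQU, hQV, hlu, hlw, hfin, hcu, hcw]
  refine ⟨fun hok => ⟨fun hab => ⟨fun hchk => ?_, fun hchk => ?_⟩, fun hab => ?_⟩, fun hok => ?_⟩
  -- Under exchange the two pairs would be equivalent, hence agree in finality and degree; a failed
  -- check therefore refutes exchange.
  · refine same' _ (by simp) (by simp) (by simp) (by simp) (.inr ⟨by simp, fun hX => hchk ?_⟩)
    have hEq := hI.queue.sound hX _ hmem
    exact ⟨⟨fun h => hEq.fin2 hu h, fun h => hEq.symm.fin2 hw h⟩, hEq.ncard_eq⟩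
  · have hok1 : σ.v .ok = 1 := by
      rcases hI.queue.ok with h | h
      · exact h
      · exact absurd h.1 hok
    have hne : ρ u ≠ ρ w := fun h => hab (by rw [h])
    refine (wp_merge (ρ := ρ) (ra := ρ u) (rb := ρ w) (by simpa using hI.uf) hru hrw
      (hI.uf.idem u hu) (hI.uf.idem w hw) hne (by simp) (by simp)).mono ?_
    rintro σ₁ hf1 ⟨x, y, hxy, hle, hU1, ht1⟩
    have hE1 : Env G σ₁.a := by
      refine Env.frame ?_ hf1 fun b _ _ _ _ _ => by cases b <;> first | rfl | contradiction
      simpa using hI.env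
    have hQ1 : Queue G σ₁ qs := by
      refine hI.queue.congr ?_ ?_ ?_ ?_
      · rw [hf1.a .QU rfl]; simp
      · rw [hf1.a .QV rfl]; simp
      · rw [hf1.v .tl rfl]; simp
      · rw [hf1.v .ok rfl]; simp
    have hok1' : σ₁.v .ok = 1 := by rw [hf1.v .ok rfl]; simpa using hok1
    have hhd1 : σ₁.v .hd = σ.v .hd + 1 := by rw [hf1.v .hd rfl]; simp
    refine (wp_succ hE1 hQ1 hu hw (by rw [hf1.v .u rfl]; simp) (by rw [hf1.v .z rfl]; simp)
      fun hX => hI.queue.sound hX _ hmem).mono ?_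
    rintro σ₂ hf2 ⟨qs', hQ2, hlen, hchk2, ht2⟩
    have hhd2 : σ₂.v .hd = σ.v .hd + 1 := by rw [hf2.v .hd rfl, hhd1]
    have hdeg : G.deg u = G.deg w := hchk.2
    -- Degrees are constant on classes, and the check has just compared those of `u` and `w`. So
    -- whichever label disappears has the degree of `u` and can pay for its letters.
    have hx : G.Live x ∧ ρ x = x ∧ ρ y = y ∧ x ≠ y ∧ G.deg x = G.deg u := by
      have hdu : G.deg (ρ u) = G.deg u := hI.deg _ _ hru hu (hI.uf.idem u hu)
      have hdw : G.deg (ρ w) = G.deg w := hI.deg _ _ hrw hw (hI.uf.idem w hw)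
      rcases hxy with ⟨rfl, rfl⟩ | ⟨rfl, rfl⟩
      · exact ⟨hru, hI.uf.idem u hu, hI.uf.idem w hw, hne, hdu⟩
      · exact ⟨hrw, hI.uf.idem w hw, hI.uf.idem u hu, hne.symm, hdw.trans hdeg.symm⟩
    obtain ⟨hx1, hx2, hx3, hx4, hx5⟩ := hx
    -- pairs whose classes have been merged
    have hcase : ∀ p q, merge ρ x y p = merge ρ x y q → ρ p = ρ q ∨ (ρ p = ρ u ∧ ρ q = ρ w) ∨
        (ρ p = ρ w ∧ ρ q = ρ u) := by
      intro p q h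
      rcases merge_eq_merge h with h | ⟨h1, h2⟩ | ⟨h1, h2⟩ <;>
        rcases hxy with ⟨rfl, rfl⟩ | ⟨rfl, rfl⟩ <;> simp_all
    have hth := theta_merge (N := G.lives) (ρ := ρ) G.deg hx4 hx2 hx3 (Inst.mem_lives.2 hx1)
    have hps := psi_merge (N := G.lives) (ρ := ρ) hx4 hle
    rw [hx5] at hth
    have hlen' : qs'.length ≤ G.deg u := hlen
    rw [← hP]
    refine ⟨_, ?_, qs ++ qs', merge ρ x y, ⟨?_, hQ2, ?_, ?_, ?_, ?_, ?_, ?_⟩, rfl, ?_⟩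
    · rw [List.length_append]; omega
    · exact hE1.frame hf2 fun b _ _ _ _ _ => by cases b <;> first | rfl | contradiction
    · rw [List.length_append]; omega
    · exact hU1.congr (hf2.a _ rfl) (hf2.a _ rfl) (hf2.a _ rfl)
    · intro p q hp hq h
      have d1 : ∀ p, G.Live p → ρ p = ρ u → (G.liveOut p).ncard = G.deg u := fun p hp h =>
        hI.deg _ _ hp hu h
      have d2 : ∀ p, G.Live p → ρ p = ρ w → (G.liveOut p).ncard = G.deg u := fun p hp h =>
        (hI.deg _ _ hp hw h).trans hdeg.symm
      rcases hcase p q h with h | ⟨h1, h2⟩ | ⟨h1, h2⟩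
      · exact hI.deg p q hp hq h
      · rw [d1 p hp h1, d2 q hq h2]
      · rw [d2 p hp h1, d1 q hq h2]
    · exact fun _ j j' i => (hI.eqn hok1 j j' i).append
    · intro _ e he
      rw [hhd2, List.take_append_of_le_length (by omega), htake] at he
      rcases List.mem_append.1 he with h' | h'
      · have := hI.done hok1 e h'
        simp [merge, this]
      · rw [List.mem_singleton.1 h']
        rcases hxy with ⟨rfl, rfl⟩ | ⟨rfl, rfl⟩ <;> simp [merge]
    · intro hok2 p q hp hq h
      have hmono : ∀ p q, G.Cl (fun u v => (u, v) ∈ qs) p q →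
          G.Cl (fun u v => (u, v) ∈ qs ++ qs') p q :=
        fun p q h => h.mono fun a b h => List.mem_append_left _ h
      have hcl : ∀ p q, G.Live p → G.Live q → ρ p = ρ q →
          G.Cl (fun u v => (u, v) ∈ qs ++ qs') p q :=
        fun p q hp hq h => hmono _ _ (hI.cl hok1 p q hp hq h)
      -- The local condition only has to be verified for `u` and `w`: it is an equivalence relation,
      -- and any other newly related pairs are connected through them and their old classes.
      have huw : G.Cl (fun u v => (u, v) ∈ qs ++ qs') u w :=
        Inst.Cl.of_check hchk.1 hdeg (hchk2 hok2).2
      rcases hcase p q h with h | ⟨h1, h2⟩ | ⟨h1, h2⟩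
      · exact hcl p q hp hq h
      · exact ((hcl p u hp hu h1).trans huw).trans (hcl w q hw hq h2.symm)
      · exact ((hcl p w hp hw h1).trans huw.symm).trans (hcl u q hu hq h2.symm)
    · have ht1' : σ₁.t ≤ σ.t + 9 + 9 + 6 * csz G.lives ρ x := by simpa [add_assoc] using ht1
      have ht2' : σ₂.t ≤ σ₁.t + 6 + 13 * G.deg u := ht2
      rw [List.length_append]
      omega
  · refine same' _ (by simp) (by simp) (by simp) (by simp) (.inl ⟨by simp, fun _ => ?_⟩)
    exact Inst.nid_inj hru.nd hrw.nd hab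
  -- After a failure the loop merely empties the queue.
  · refine same' _ (by simp) (by simp) (by simp) (by simp) (.inl ⟨by simp, fun h => ?_⟩)
    omega

theorem wp_close {σ : St} {qs : List ((ℕ × ℕ) × (ℕ × ℕ))} (hE : Env G σ.a) (hQ : Queue G σ qs)
    (heq : σ.v .ok = 1 → ∀ j j' i, EqnIn G qs j j' i) (hU : UF G σ.a id) :
    wp I closeProg (fun σ' => (G.Exchange → σ'.v .ok = 1) ∧ (¬ G.Exchange → σ'.v .ok = 0) ∧
      σ'.t ≤ σ.t + 2 + 20 * qs.length + 40 * ∑ u ∈ G.lives, (G.deg u + 1) +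
        10 * (G.lives.card * Nat.log 2 G.lives.card)) σ := by
  unfold closeProg
  simp only [wp_seq (q := Cm.loop _ _), wp_set, Ex.eval_c]
  have hps := psi_le (N := G.lives) (ρ := id)
  have hth : theta G.lives G.deg id = ∑ u ∈ G.lives, (G.deg u + 1) := by simp [theta]
  refine wp_loop (CloseStep G (σ.t + 1 + 20 * qs.length + 40 * ∑ u ∈ G.lives, (G.deg u + 1) +
        10 * (G.lives.card * Nat.log 2 G.lives.card))) _
      ⟨qs, id, ⟨by simpa using hE, hQ.congr (by simp) (by simp) (by simp) (by simp), by simp,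
        by simpa using hU, ?_, ?_, ?_, ?_⟩, rfl, ?_⟩ ?_ ?_
  · rintro u v - - rfl; rfl
  · intro h; exact heq (by simpa using h)
  · simp
  · rintro - u v - - rfl; exact .refl _
  · simp [hth]
    omega
  · intro n σ' _ h hc
    exact wp_closeStep h hc
  · rintro n σ' - ⟨qs', ρ, hI, -, ht⟩ hc
    have htl := hI.queue.tl
    have hhd := hI.hd
    simp only [Ex.eval_sub, Ex.eval_v, htl] at hc
    have hX := hI.exchange (by omega)
    refine ⟨fun h => ?_, fun h => ?_, by simp; omega⟩
    · rcases hI.queue.ok with h' | h'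
      · exact h'
      · exact absurd h h'.2
    · rcases hI.queue.ok with h' | h'
      · exact absurd (hX h') h
      · exact h'.1

/-- The letters counted for `u` have rules with argument `u.1`. For each fixed second component the
degrees therefore sum to at most the number of letters, and there are m second components. -/
theorem sum_deg_le : ∑ u ∈ G.lives, (G.deg u + 1) ≤ 2 * (I.length * I.length) := by
  classical
  have hsz := G.size_le
  have h1 : ∀ u, G.deg u ≤
      ((G.letters G.R).filter fun l => decide (G.ag l.1 l.2 = u.1)).length := by
    intro u
    have : G.liveOut u ⊆ (((G.letters G.R).filter fun l => decide (G.ag l.1 l.2 = u.1)).toFinset :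
        Set (ℕ × ℕ)) := by
      intro l hl
      simp only [List.coe_toFinset, Set.mem_ofPred_eq, List.mem_filter, decide_eq_true_iff]
      exact ⟨Inst.mem_letters.2 ⟨hl.1.1.1, hl.1⟩, hl.2.1⟩
    have h2 := Set.ncard_le_ncard this (Finset.finite_toSet _)
    rw [Set.ncard_coe_finset] at h2
    exact h2.trans (List.toFinset_card_le _)
  have h3 := sum_length_filter_le (fun l : ℕ × ℕ => G.ag l.1 l.2) (G.letters G.R)
    (List.nodup_range (n := G.m))
  have h4 := Inst.length_letters_lt (G := G)
  calc ∑ u ∈ G.lives, (G.deg u + 1)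
      ≤ ∑ u ∈ Finset.range G.m ×ˢ Finset.range G.m, (G.deg u + 1) :=
        Finset.sum_le_sum_of_subset (Finset.filter_subset _ _)
    _ ≤ ∑ u ∈ Finset.range G.m ×ˢ Finset.range G.m,
        (((G.letters G.R).filter fun l => decide (G.ag l.1 l.2 = u.1)).length + 1) :=
        Finset.sum_le_sum fun u _ => Nat.add_le_add_right (h1 u) 1
    _ = (∑ p ∈ Finset.range G.m,
        ((G.letters G.R).filter fun l => decide (G.ag l.1 l.2 = p)).length) * G.m + G.m * G.m := by
        rw [Finset.sum_add_distrib, Finset.sum_product, Finset.sum_mul]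
        refine congrArg₂ _ (Finset.sum_congr rfl fun p _ => ?_) (by simp)
        change ∑ _q ∈ Finset.range G.m,
          ((G.letters G.R).filter fun l => decide (G.ag l.1 l.2 = p)).length = _
        rw [Finset.sum_const, smul_eq_mul, Finset.card_range, mul_comm]
    _ ≤ I.length * I.length + I.length * I.length := by
        refine Nat.add_le_add (Nat.mul_le_mul ?_ (by omega)) (Nat.mul_le_mul (by omega) (by omega))
        exact le_trans (le_of_eq rfl) (h3.trans h4.le)
    _ = 2 * (I.length * I.length) := by ring

end TreeAut

namespace TreeAut

open Cm Ex

/-! ### Sizes of descriptions -/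

theorem length_le_inputSize (I : List ℕ) : I.length ≤ inputSize I := by
  induction I with
  | nil => simp [inputSize]
  | cons x I ih =>
    have : 1 ≤ binLength x := le_max_left _ _
    simp only [inputSize, List.map_cons, List.sum_cons, List.length_cons] at ih ⊢
    omega

/-- Distinct numbers occur at distinct places of the input, so their lengths are all paid for. -/
theorem sum_binLength_le {I : List ℕ} {S : Finset ℕ} (h : ∀ q ∈ S, q ∈ I) :
    ∑ q ∈ S, binLength q ≤ inputSize I := by
  calc ∑ q ∈ S, binLength q ≤ ∑ q ∈ I.dedup.toFinset, binLength q :=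
        Finset.sum_le_sum_of_subset fun q hq => by simpa using h q hq
    _ = (I.dedup.map binLength).sum := List.sum_toFinset _ I.nodup_dedup
    _ ≤ inputSize I := ((I.dedup_sublist).map binLength).sum_le_sum fun _ _ => Nat.zero_le _

theorem log_le_binLength {a q : ℕ} (h : a / 2 ≤ q) : Nat.log 2 a ≤ binLength q := by
  refine le_trans ?_ (le_max_right _ _)
  rcases hl : Nat.log 2 a with _ | l
  · omega
  · rw [Nat.succ_le_iff, Nat.lt_size]
    have ha : a ≠ 0 := by rintro rfl; simp at hl
    have := Nat.pow_log_le_self 2 ha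
    rw [hl, pow_succ] at this
    omega

/-- The binary representations of `a` different numbers have total length at least
`a log₂ a / 2`. -/
theorem card_mul_log_le (S : Finset ℕ) :
    S.card * Nat.log 2 S.card ≤ 2 * ∑ q ∈ S, binLength q := by
  -- At most half of the elements lie below `S.card / 2`; each of the others has at least `Nat.log 2
  -- S.card` binary digits.
  have h1 : S.card ≤ S.card / 2 + (S.filter fun q => S.card / 2 ≤ q).card := by
    have h2 : S ⊆ Finset.range (S.card / 2) ∪ S.filter fun q => S.card / 2 ≤ q := by
      intro q hq
      rw [Finset.mem_union, Finset.mem_range, Finset.mem_filter]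
      rcases lt_or_ge q (S.card / 2) with h | h
      · exact .inl h
      · exact .inr ⟨hq, h⟩
    have := (Finset.card_le_card h2).trans (Finset.card_union_le _ _)
    simpa using this
  have h3 : (S.filter fun q => S.card / 2 ≤ q).card * Nat.log 2 S.card ≤ ∑ q ∈ S, binLength q := by
    refine le_trans ?_ (Finset.sum_le_sum_of_subset (Finset.filter_subset (S.card / 2 ≤ ·) S))
    exact Finset.card_nsmul_le_sum _ _ _ fun q hq => log_le_binLength (Finset.mem_filter.1 hq).2
  calc S.card * Nat.log 2 S.card
      ≤ 2 * (S.filter fun q => S.card / 2 ≤ q).card * Nat.log 2 S.card :=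
        Nat.mul_le_mul_right _ (by omega)
    _ ≤ _ := by rw [mul_assoc]; exact Nat.mul_le_mul_left 2 h3

variable {I : List ℕ} {G : Inst I}

/-- An accessible state is the target of a rule and is therefore written out in the description.
States that occur in no rule contribute only one bit each, which is why the count is restricted to
accessible states. -/
theorem Inst.Acc.mem {q : ℕ} (h : G.Acc q) : q ∈ I := by
  cases h with
  | intro j hj h =>
    have hlt := G.st_add_rk_lt hj
    rw [← G.rd_tg j hj, List.getD_eq_getElem _ _ (by omega)]
    exact List.getElem_mem _

/-- With a accessible states there are N ≤ a² live pairs and log N ≤ 2 log a + 1. As a ≤ n and a log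
a ≤ 2n for the input size n, N log N ≤ 2a(a log a) + a² ≤ 5n². This removes the logarithm that
relabelling smaller classes would otherwise cost. -/
theorem lives_mul_log_le :
    G.lives.card * Nat.log 2 G.lives.card ≤ 5 * (inputSize I * inputSize I) := by
  classical
  obtain ⟨S, hS⟩ : ∃ S, S = (Finset.range G.m).filter G.Acc := ⟨_, rfl⟩
  have h1 : ∑ q ∈ S, binLength q ≤ inputSize I :=
    sum_binLength_le fun q hq => by rw [hS] at hq; exact (Finset.mem_filter.1 hq).2.mem
  have h2 := card_mul_log_le S
  have h6 : S.card * Nat.log 2 S.card ≤ 2 * inputSize I := by omega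
  have h3 : S.card ≤ inputSize I := by
    refine le_trans ?_ h1
    rw [Finset.card_eq_sum_ones]
    exact Finset.sum_le_sum fun q _ => le_max_left _ _
  have h4 : G.lives.card ≤ S.card * S.card := by
    rw [← Finset.card_product]
    refine Finset.card_le_card fun u hu => ?_
    have := Inst.mem_lives.1 hu
    simp [hS, this.acc.1, this.acc.2, this.acc.1.lt, this.acc.2.lt]
  have h5 : Nat.log 2 G.lives.card ≤ 2 * Nat.log 2 S.card + 1 := by
    rw [← Nat.lt_succ_iff]
    refine Nat.log_lt_of_lt_pow' (by omega) (h4.trans_lt ?_)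
    have h7 := Nat.lt_pow_succ_log_self one_lt_two S.card
    calc S.card * S.card < 2 ^ (Nat.log 2 S.card + 1) * 2 ^ (Nat.log 2 S.card + 1) :=
          Nat.mul_self_lt_mul_self h7
      _ = _ := by rw [← pow_add]; congr 1; simp only [Nat.succ_eq_add_one]; ring
  calc G.lives.card * Nat.log 2 G.lives.card
      ≤ S.card * S.card * (2 * Nat.log 2 S.card + 1) := Nat.mul_le_mul h4 h5
    _ = 2 * (S.card * (S.card * Nat.log 2 S.card)) + S.card * S.card := by ring
    _ ≤ 2 * (inputSize I * (2 * inputSize I)) + inputSize I * inputSize I := by gcongr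
    _ = 5 * (inputSize I * inputSize I) := by ring

/-! ### The whole algorithm -/

def mainProg : Cm :=
  parseProg ;; tableProg ;; accProg ;; dtabProg ;; nidProg ;; edgeProg backAct ;; initProg ;;
  liveProg ;; edgeProg outAct ;; eqnsProg ;; closeProg

theorem wp_main (G : Inst I) :
    wp I mainProg (fun σ => σ.t ≤ 500 * (inputSize I * inputSize I) ∧
      (G.Exchange → σ.v .ok = 1) ∧ (¬ G.Exchange → σ.v .ok = 0)) St.zero := by
  have hsz := G.size_le
  unfold mainProg
  rw [wp_seq]
  refine (wp_parse G St.zero).mono fun σ1 f1 ⟨B1, t1⟩ => ?_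
  rw [wp_seq]
  refine (wp_table B1).mono fun σ2 f2 ⟨X2, t2⟩ => ?_
  have B2 := B1.frame f2
  rw [wp_seq]
  refine (wp_acc B2 fun q => ?_).mono fun σ3 f3 ⟨A3, t3⟩ => ?_
  · rw [f2.a .acc rfl, f1.a .acc rfl]; rfl
  have B3 := B2.frame f3
  have T3 : IsTable G σ3 := by unfold IsTable; rw [f3.a .T rfl]; exact X2
  rw [wp_seq]
  refine (wp_dtab B3 T3 A3 fun q => ?_).mono fun σ4 f4 ⟨D4, t4⟩ => ?_
  · rw [f3.a .D rfl, f2.a .D rfl, f1.a .D rfl]; rfl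
  rw [wp_seq]
  refine (wp_nid D4.base).mono fun σ5 f5 ⟨N5, t5⟩ => ?_
  have D5 := D4.frame f5
  rw [wp_seq]
  refine (wp_back D5 N5 fun q => ?_).mono fun σ6 f6 ⟨es, _, e2, e3, L6, t6⟩ => ?_
  · rw [f5.a .bcnt rfl, f4.a .bcnt rfl, f3.a .bcnt rfl, f2.a .bcnt rfl, f1.a .bcnt rfl]; rfl
  have D6 := D5.frame f6
  have N6 : IsNid G σ6 := by unfold IsNid; rw [f6.a .nd1 rfl, f6.a .nd2 rfl]; exact N5
  rw [wp_seq]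
  refine (wp_init D6.base D6.acc N6 (fun q => ?_) fun q => ?_).mono fun σ7 f7 ⟨I7, t7⟩ => ?_
  · rw [f6.a .live rfl, f5.a .live rfl, f4.a .live rfl, f3.a .live rfl, f2.a .live rfl,
      f1.a .live rfl]; rfl
  · rw [f6.a .fin rfl, f5.a .fin rfl, f4.a .fin rfl, f3.a .fin rfl, f2.a .fin rfl,
      f1.a .fin rfl]; rfl
  have D7 := D6.frame f7
  have N7 : IsNid G σ7 := by unfold IsNid; rw [f7.a .nd1 rfl, f7.a .nd2 rfl]; exact N6
  rw [wp_seq]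
  refine (wp_live I7 e2 e3 (by rw [f7.a .badj rfl, f7.a .bcnt rfl]; exact L6)).mono
    fun σ8 f8 ⟨V8, t8⟩ => ?_
  have D8 := D7.frame f8
  have N8 : IsNid G σ8 := by unfold IsNid; rw [f8.a .nd1 rfl, f8.a .nd2 rfl]; exact N7
  rw [wp_seq]
  refine (wp_out D8 N8 (fun q => ?_) V8).mono fun σ9 f9 ⟨O9, t9⟩ => ?_
  · rw [f8.a .fcnt rfl, f7.a .fcnt rfl, f6.a .fcnt rfl, f5.a .fcnt rfl, f4.a .fcnt rfl,
      f3.a .fcnt rfl, f2.a .fcnt rfl, f1.a .fcnt rfl]; rfl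
  have D9 := D8.frame f9
  have N9 : IsNid G σ9 := by unfold IsNid; rw [f9.a .nd1 rfl, f9.a .nd2 rfl]; exact N8
  have K : ∀ u, G.Nd u → NodeOK G σ9 u := fun u hu => by
    obtain ⟨k1, k2, k3, k4, k5⟩ := I7.node u hu (Inst.idx_lt hu)
    exact ⟨by rw [f9.a .fst rfl, f8.a .fst rfl, k1], by rw [f9.a .snd rfl, f8.a .snd rfl, k2],
      by rw [f9.a .lab rfl, f8.a .lab rfl, k3], by rw [f9.a .mem rfl, f8.a .mem rfl, k4],
      by rw [f9.a .size rfl, f8.a .size rfl, k5]⟩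
  have F9 : σ9.a .fin = σ7.a .fin := by rw [f9.a .fin rfl, f8.a .fin rfl]
  have E9 : Env G σ9.a := by
    refine ⟨D9.base.st, D9.val, D9.tgt, D9.look, fun u hu => N9.eq hu, ?_, fun u hu => (K u hu).fst,
      fun u hu => (K u hu).snd, fun u v hu hv => ?_, fun u hu => O9.ncard hu, fun u hu => ?_⟩
    · rw [f9.a .live rfl]; exact V8
    -- The entries of `fin` are 0 or 1, so equality of two entries means that finality agrees.
    · have h : ∀ u, G.Live u → (σ9.a .fin (G.nid u) ≠ 0 ↔ G.Fin2 u) := fun u hu => by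
        rw [F9, I7.fin u hu.nd, Inst.AccFin.iff hu]
        simp [Inst.idx_lt hu.nd]
      have h1 := I7.fin_le (G.nid u)
      have h2 := I7.fin_le (G.nid v)
      rw [← F9] at h1 h2
      rw [← h u hu, ← h v hv]
      omega
    · obtain ⟨ls, -, h2, h3⟩ := O9 u hu
      exact ⟨ls, h2, h3⟩
  rw [wp_seq]
  refine (wp_eqns E9 D9.base.R).mono fun σ10 f10 ⟨qs, Q10, q2, q3, t10⟩ => ?_
  have E10 : Env G σ10.a := E9.frame f10 fun b _ _ _ _ _ => by
    cases b <;> first | rfl | contradiction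
  have U10 : UF G σ10.a id := by
    have k3 := f10.a .lab rfl
    have k4 := f10.a .mem rfl
    have k5 := f10.a .size rfl
    refine ⟨fun u hu => by rw [k3, (K u hu.nd).lab]; rfl, fun u hu => hu, fun u hu => rfl,
      fun r hr _ => ⟨[r], by simp, fun u => ?_, ?_⟩⟩
    · rw [List.mem_singleton]
      exact ⟨by rintro rfl; exact ⟨hr, rfl⟩, fun h => h.2⟩
    · rw [k5, (K r hr.nd).size, k4]
      simp [cells_succ, (K r hr.nd).mem, cells]
  refine (wp_close E10 Q10 q3 U10).mono fun σ11 _ ⟨h1, h2, t11⟩ => ⟨?_, h1, h2⟩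
  -- All phases are bounded in terms of the length of the input; only the relabelling term needs the
  -- lengths of the binary representations.
  have hL := length_le_inputSize I
  have hLL := Nat.mul_self_le_mul_self hL
  have h3 : I.length * 3 ≤ I.length * I.length := Nat.mul_le_mul_left _ (by omega)
  have h4 := sum_deg_le (G := G)
  have h5 := lives_mul_log_le (G := G)
  have t0 : St.zero.t = 0 := rfl
  omega

end TreeAut

theorem mainTheorem2 :
    ∃ (p : TreeAut.Prog) (c : ℕ),
      ∀ (s : ℕ) (ar : Fin s → ℕ) (m : ℕ) (A : TreeAut.BottomUp ar (Fin m)),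
        A.IsDeterministic →
        ∀ I : List ℕ, A.IsDescription I →
          p.DecidesWithin I (c * TreeAut.inputSize I ^ 2)
            (TreeAut.IsTopDownDeterministic A.language) := by
  refine ⟨TreeAut.mainProg.compile, TreeAut.mainProg.cost * 500, fun s ar m A hA I hI => ?_⟩
  obtain ⟨G, hG⟩ := TreeAut.exists_inst hA hI
  rw [← hG, mul_assoc, pow_two]
  exact (TreeAut.wp_main G).decidesWithin
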